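/- Consider the class of cubic Schrödinger equations $$i\psi_t+\psi_{xx}+\psi^2\psi^*+V\psi=0,\qquad (1)$$ where the potential $V=V(t,x)$ is an arbitrary complex-valued smooth function. An equivalence transformation of the class is a smooth nondegenerate local point transformation of the variables $(t,x,\psi,V)$ that projects to the space of $(t,x,\psi)$ and maps every equation of the class (with its solutions) to an equation of the class. The Lie algebra $A^{\rm equiv}$ of the equivalence group consists of the smooth real vector fields on the space of $(t,x,\psi,V)\in\mathbb R\times\mathbb R\times\mathbb C\times\mathbb C$ whose local flows consist of equivalence transformations. (A real vector field is written $\xi^t\partial_t+\xi^x\partial_x+\eta\partial_\psi+\eta^*\partial_{\psi^*}+\theta\partial_V+\theta^*\partial_{V^*}$, where $\eta^*$ and $\theta^*$ are the complex conjugates of $\eta$ and $\theta$.) Let $M=i(\psi\partial_\psi-\psi^*\partial_{\psi^*})$ and $I=\psi\partial_\psi+\psi^*\partial_{\psi^*}$, and for smooth real functions $\xi,\chi,\lambda$ of $t$ put $$D(\xi)=\xi\partial_t+\tfrac12\xi_tx\partial_x+\tfrac18\xi_{tt}x^2M-\tfrac12\xi_tI,\qquad G(\chi)=\chi\partial_x+\tfrac12\chi_txM.$$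 Let $A^{\cup}$ be the real linear span of all the operators $D(\xi)$, $G(\chi)$ and $\lambda M$. Theorem 3. $A^{\cup}$ and $A^{\rm equiv}$ are Lie algebras under the usual bracket of vector fields, and $A^{\rm equiv}$ is the real linear span of the operators $$D'(\xi)=D(\xi)+\tfrac18\xi_{ttt}x^2(\partial_V+\partial_{V^*})+\tfrac i4\xi_{tt}(\partial_V-\partial_{V^*})-\xi_t(V\partial_V+V^*\partial_{V^*}),$$ $$G'(\chi)=G(\chi)+\tfrac12\chi_{tt}x(\partial_V+\partial_{V^*}),\qquad M'(\lambda)=\lambda M+\lambda_t(\partial_V+\partial_{V^*}),$$ where $\xi,\chi,\lambda$ run through the smooth real functions of $t$. Moreover $A^{\rm equiv}\simeq A^{\cup}$ as Lie algebras, and the isomorphism is prolongation to $(V,V^*)$: each $Q\in A^{\cup}$ has exactly one prolongation $Q+\theta\partial_V+\theta^*\partial_{V^*}$ in $A^{\rm equiv}$, the map from $Q$ to this prolongation is a Lie algebra isomorphism of $A^{\cup}$ onto $A^{\rm equiv}$, and it takes $D(\xi)$, $G(\chi)$, $\lambda M$ to $D'(\xi)$, $G'(\chi)$, $M'(\lambda)$.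 -/

import Mathlib

open Set
open scoped ContDiff

namespace CubicNLS

/-! ### The Lie algebra of smooth vector fields on a real normed space -/

section VectorFields

/-- Smooth vector fields on `E`, as a subspace of the space of all maps `E → E`. -/
def smoothFields (E : Type*) [NormedAddCommGroup E] [NormedSpace ℝ E] : Submodule ℝ (E → E) where
  carrier := {X | ContDiff ℝ ∞ X}
  add_mem' := fun {X Y} (hX : ContDiff ℝ ∞ X) (hY : ContDiff ℝ ∞ Y) => hX.add hY
  zero_mem' := (contDiff_const : ContDiff ℝ ∞ fun _ : E => (0 : E))
  smul_mem' := fun c X (hX : ContDiff ℝ ∞ X) => hX.const_smul c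

/-- The type of smooth vector fields on `E`. -/
abbrev SmoothField (E : Type*) [NormedAddCommGroup E] [NormedSpace ℝ E] : Type _ :=
  ↥(smoothFields E)

variable {E : Type*} [NormedAddCommGroup E] [NormedSpace ℝ E]

theorem SmoothField.contDiff (X : SmoothField E) : ContDiff ℝ ∞ X.1 := X.2

theorem SmoothField.differentiableAt (X : SmoothField E) (p : E) : DifferentiableAt ℝ X.1 p :=
  (X.contDiff.differentiable (by simp)) p

/-- The usual Lie bracket of vector fields, `[X, Y](p) = DY(p) X(p) - DX(p) Y(p)`. -/
noncomputable instance : Bracket (SmoothField E) (SmoothField E) where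
  bracket X Y := ⟨VectorField.lieBracket ℝ X.1 Y.1,
    (X.contDiff.lieBracket_vectorField (m := ∞) Y.contDiff (by simp) :
      ContDiff ℝ ∞ (VectorField.lieBracket ℝ X.1 Y.1))⟩

theorem SmoothField.bracket_apply (X Y : SmoothField E) (p : E) :
    (⁅X, Y⁆ : SmoothField E).1 p = VectorField.lieBracket ℝ X.1 Y.1 p := rfl

noncomputable instance : LieRing (SmoothField E) where
  add_lie X Y Z := by
    ext p
    exact VectorField.lieBracket_add_left (X.differentiableAt p) (Y.differentiableAt p)
  lie_add X Y Z := by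
    ext p
    exact VectorField.lieBracket_add_right (Y.differentiableAt p) (Z.differentiableAt p)
  lie_self X := by
    ext p
    simp [SmoothField.bracket_apply]
  leibniz_lie X Y Z := by
    ext p
    exact VectorField.leibniz_identity_lieBracket (n := ∞) (by
      simpa using (WithTop.coe_le_coe.2 le_top : ((2 : ℕ∞) : ℕ∞ω) ≤ ∞))
      X.contDiff.contDiffAt Y.contDiff.contDiffAt Z.contDiff.contDiffAt

noncomputable instance : LieAlgebra ℝ (SmoothField E) where
  lie_smul c X Y := by
    ext p
    exact VectorField.lieBracket_const_smul_right (Y.differentiableAt p)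

end VectorFields

/-! ### The class of equations and its equivalence transformations -/

/-- The plane of the independent variables, with points `(t, x)`. -/
abbrev Plane : Type := ℝ × ℝ

/-- The space of the variables `((t, x), ψ)`. Complex coordinates are treated as pairs of real
ones, so that "smooth" is real-smooth, and a real vector field
`ξᵗ∂_t + ξˣ∂_x + η∂_ψ + η*∂_{ψ*}` (with `η*` conjugate to `η`) is the map `z ↦ ((ξᵗ, ξˣ), η)`. -/
abbrev Space : Type := Plane × ℂ

/-- The space of the variables `(((t, x), ψ), V)`. The vector field
`Q + θ∂_V + θ*∂_{V*}` is the map `p ↦ (Q, θ)`. -/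
abbrev ExtSpace : Type := Space × ℂ

/-- `u` satisfies `i u_t + u_xx + u² u* + V u = 0` at all points of `O`. -/
def Solves (V u : Plane → ℂ) (O : Set Plane) : Prop :=
  ∀ q ∈ O, Complex.I * deriv (fun t : ℝ => u (t, q.2)) q.1
    + iteratedDeriv 2 (fun x : ℝ => u (q.1, x)) q.2
    + u q ^ 2 * (starRingEnd ℂ) (u q) + V q * u q = 0

/-- `Φ`, with domain `U`, is an equivalence transformation of the class of the equations
`i ψ_t + ψ_xx + ψ² ψ* + V ψ = 0`: a nondegenerate point transformation of the variables
`(t, x, ψ, V)` that projects to the space of `(t, x, ψ)` and maps every equation of the class to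
an equation of the class. -/
structure IsEquivTransformation (U : Set ExtSpace) (Φ : ExtSpace → ExtSpace) : Prop where
  isOpen : IsOpen U
  smooth : ContDiffOn ℝ ∞ Φ U
  injOn : InjOn Φ U
  nondegenerate : ∀ p ∈ U, (fderiv ℝ Φ p).IsInvertible
  projectable : ∃ φ : Space → Space, ∀ p ∈ U, (Φ p).1 = φ p.1
  /-- Every smooth potential `V` on an open set `W` is transformed to a smooth potential `V'` on
  an open set `W'` (a function of the new independent variables only), and if the graph of
  `(u, V)` over `O` is carried to the graph of `(u', V')` over `O'`, then `u` is a solution of the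
  equation with potential `V` exactly when `u'` is a solution of that with potential `V'`. -/
  maps_class : ∀ (W : Set Plane) (V : Plane → ℂ), IsOpen W → ContDiffOn ℝ ∞ V W →
    ∃ (W' : Set Plane) (V' : Plane → ℂ), IsOpen W' ∧ ContDiffOn ℝ ∞ V' W' ∧
      (∀ (q : Plane) (ψ : ℂ), q ∈ W → ((q, ψ), V q) ∈ U →
        (Φ ((q, ψ), V q)).1.1 ∈ W' ∧ V' (Φ ((q, ψ), V q)).1.1 = (Φ ((q, ψ), V q)).2) ∧
      ∀ (O O' : Set Plane) (u u' : Plane → ℂ), IsOpen O → IsOpen O' → O ⊆ W → O' ⊆ W' →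
        ContDiffOn ℝ ∞ u O → ContDiffOn ℝ ∞ u' O' →
        (∀ q ∈ O, ((q, u q), V q) ∈ U) →
        (fun q => Φ ((q, u q), V q)) '' O = (fun q => ((q, u' q), V' q)) '' O' →
        (Solves V u O ↔ Solves V' u' O')

/-- `Q` belongs to the Lie algebra of the equivalence group: near every point, the local flow
`Φ` of `Q` (the local one-parameter group that `Q` generates) consists of equivalence
transformations. -/
def IsEquivGenerator (Q : SmoothField ExtSpace) : Prop :=
  ∀ p₀ : ExtSpace, ∃ (δ : ℝ) (U : Set ExtSpace) (Φ : ℝ → ExtSpace → ExtSpace),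
    0 < δ ∧ p₀ ∈ U ∧
    ContDiffOn ℝ ∞ (Function.uncurry Φ) (Ioo (-δ) δ ×ˢ U) ∧
    (∀ p ∈ U, Φ 0 p = p) ∧
    (∀ ε ∈ Ioo (-δ) δ, ∀ p ∈ U, HasDerivAt (fun s => Φ s p) (Q.1 (Φ ε p)) ε) ∧
    ∀ ε ∈ Ioo (-δ) δ, IsEquivTransformation U (Φ ε)

/-! ### The operators -/

/-- Smooth real functions of `t`. -/
abbrev SmoothFun : Type := {f : ℝ → ℝ // ContDiff ℝ ∞ f}

theorem SmoothFun.contDiff_iteratedDeriv (f : SmoothFun) (k : ℕ) :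
    ContDiff ℝ ∞ (iteratedDeriv k f.1) :=
  contDiff_infty.2 fun n => by
    rw [iteratedDeriv_eq_iterate]
    exact ContDiff.iterate_deriv' n k (f.2.of_le (by exact_mod_cast le_top))

theorem SmoothFun.contDiff_deriv (f : SmoothFun) : ContDiff ℝ ∞ (deriv f.1) := by
  simpa using f.contDiff_iteratedDeriv 1

theorem contDiff_ofReal {E : Type*} [NormedAddCommGroup E] [NormedSpace ℝ E] {f : E → ℝ}
    (hf : ContDiff ℝ ∞ f) : ContDiff ℝ ∞ (fun p => (f p : ℂ)) :=
  Complex.ofRealCLM.contDiff.comp hf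

/-- `D(ξ) = ξ ∂_t + (1/2) ξ_t x ∂_x + (1/8) ξ_tt x² M - (1/2) ξ_t I`, where
`M = i(ψ∂_ψ - ψ*∂_{ψ*})` and `I = ψ∂_ψ + ψ*∂_{ψ*}`. -/
noncomputable def opD (ξ : SmoothFun) : SmoothField Space :=
  ⟨fun z => ((ξ.1 z.1.1, 1 / 2 * deriv ξ.1 z.1.1 * z.1.2),
      ((1 / 8 * iteratedDeriv 2 ξ.1 z.1.1 * z.1.2 ^ 2 : ℝ) : ℂ) * (Complex.I * z.2)
        - ((1 / 2 * deriv ξ.1 z.1.1 : ℝ) : ℂ) * z.2), by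
    have h0 := ξ.2
    have h1 := ξ.contDiff_deriv
    have h2 := ξ.contDiff_iteratedDeriv 2
    have k1 : ContDiff ℝ ∞ fun z : Space =>
        ((1 / 8 * iteratedDeriv 2 ξ.1 z.1.1 * z.1.2 ^ 2 : ℝ) : ℂ) :=
      contDiff_ofReal (by fun_prop)
    have k2 : ContDiff ℝ ∞ fun z : Space => ((1 / 2 * deriv ξ.1 z.1.1 : ℝ) : ℂ) :=
      contDiff_ofReal (by fun_prop)
    show ContDiff ℝ ∞ _
    fun_prop⟩

/-- `G(χ) = χ ∂_x + (1/2) χ_t x M`. -/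
noncomputable def opG (χ : SmoothFun) : SmoothField Space :=
  ⟨fun z => ((0, χ.1 z.1.1), ((1 / 2 * deriv χ.1 z.1.1 * z.1.2 : ℝ) : ℂ) * (Complex.I * z.2)), by
    have h0 := χ.2
    have h1 := χ.contDiff_deriv
    have k1 : ContDiff ℝ ∞ fun z : Space => ((1 / 2 * deriv χ.1 z.1.1 * z.1.2 : ℝ) : ℂ) :=
      contDiff_ofReal (by fun_prop)
    show ContDiff ℝ ∞ _
    fun_prop⟩

/-- `λ M`. -/
noncomputable def opM (l : SmoothFun) : SmoothField Space :=
  ⟨fun z => ((0, 0), (l.1 z.1.1 : ℂ) * (Complex.I * z.2)), by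
    have h0 := l.2
    have k1 : ContDiff ℝ ∞ fun z : Space => (l.1 z.1.1 : ℂ) := contDiff_ofReal (by fun_prop)
    show ContDiff ℝ ∞ _
    fun_prop⟩

/-- `D'(ξ) = D(ξ) + (1/8) ξ_ttt x² (∂_V + ∂_{V*}) + (i/4) ξ_tt (∂_V - ∂_{V*})
- ξ_t (V∂_V + V*∂_{V*})`. -/
noncomputable def opD' (ξ : SmoothFun) : SmoothField ExtSpace :=
  ⟨fun p => ((opD ξ).1 p.1,
      ((1 / 8 * iteratedDeriv 3 ξ.1 p.1.1.1 * p.1.1.2 ^ 2 : ℝ) : ℂ)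
        + Complex.I / 4 * ((iteratedDeriv 2 ξ.1 p.1.1.1 : ℝ) : ℂ)
        - ((deriv ξ.1 p.1.1.1 : ℝ) : ℂ) * p.2), by
    have h1 := ξ.contDiff_deriv
    have h2 := ξ.contDiff_iteratedDeriv 2
    have h3 := ξ.contDiff_iteratedDeriv 3
    have h4 := (opD ξ).contDiff
    have k1 : ContDiff ℝ ∞ fun p : ExtSpace =>
        ((1 / 8 * iteratedDeriv 3 ξ.1 p.1.1.1 * p.1.1.2 ^ 2 : ℝ) : ℂ) :=
      contDiff_ofReal (by fun_prop)
    have k2 : ContDiff ℝ ∞ fun p : ExtSpace => ((iteratedDeriv 2 ξ.1 p.1.1.1 : ℝ) : ℂ) :=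
      contDiff_ofReal (by fun_prop)
    have k3 : ContDiff ℝ ∞ fun p : ExtSpace => ((deriv ξ.1 p.1.1.1 : ℝ) : ℂ) :=
      contDiff_ofReal (by fun_prop)
    show ContDiff ℝ ∞ _
    fun_prop⟩

/-- `G'(χ) = G(χ) + (1/2) χ_tt x (∂_V + ∂_{V*})`. -/
noncomputable def opG' (χ : SmoothFun) : SmoothField ExtSpace :=
  ⟨fun p => ((opG χ).1 p.1, ((1 / 2 * iteratedDeriv 2 χ.1 p.1.1.1 * p.1.1.2 : ℝ) : ℂ)), by
    have h2 := χ.contDiff_iteratedDeriv 2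
    have h4 := (opG χ).contDiff
    have k1 : ContDiff ℝ ∞ fun p : ExtSpace =>
        ((1 / 2 * iteratedDeriv 2 χ.1 p.1.1.1 * p.1.1.2 : ℝ) : ℂ) :=
      contDiff_ofReal (by fun_prop)
    show ContDiff ℝ ∞ _
    fun_prop⟩

/-- `M'(λ) = λ M + λ_t (∂_V + ∂_{V*})`. -/
noncomputable def opM' (l : SmoothFun) : SmoothField ExtSpace :=
  ⟨fun p => ((opM l).1 p.1, ((deriv l.1 p.1.1.1 : ℝ) : ℂ)), by
    have h1 := l.contDiff_deriv
    have h4 := (opM l).contDiff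
    have k1 : ContDiff ℝ ∞ fun p : ExtSpace => ((deriv l.1 p.1.1.1 : ℝ) : ℂ) :=
      contDiff_ofReal (by fun_prop)
    show ContDiff ℝ ∞ _
    fun_prop⟩

/-- `A^∪`, the linear span of all the operators `D(ξ)`, `G(χ)` and `λ M`. -/
noncomputable def spanCup : Submodule ℝ (SmoothField Space) :=
  Submodule.span ℝ (range opD ∪ range opG ∪ range opM)

/-- The linear span of all the operators `D'(ξ)`, `G'(χ)` and `M'(λ)`. -/
noncomputable def spanEquiv : Submodule ℝ (SmoothField ExtSpace) :=
  Submodule.span ℝ (range opD' ∪ range opG' ∪ range opM')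

/-- `P` prolongs `Q` to the variable `V`: `P = Q + θ∂_V + θ*∂_{V*}` for some `θ`. -/
def Prolongs (P : SmoothField ExtSpace) (Q : SmoothField Space) : Prop :=
  ∀ p : ExtSpace, (P.1 p).1 = Q.1 p.1

end CubicNLS

namespace CubicNLS

section Algebra

theorem SmoothFun.hasDerivAt_iteratedDeriv (f : SmoothFun) (k : ℕ) (t : ℝ) :
    HasDerivAt (iteratedDeriv k f.1) (iteratedDeriv (k + 1) f.1 t) t := by
  rw [iteratedDeriv_succ]
  exact ((f.contDiff_iteratedDeriv k).differentiable (by simp) t).hasDerivAt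

/-- The general element `D'(ξ) + G'(χ) + M'(l)`. -/
noncomputable def genField (ξ χ l : SmoothFun) : SmoothField ExtSpace :=
  opD' ξ + opG' χ + opM' l

/-- The general element `D(ξ) + G(χ) + l M`. -/
noncomputable def genBase (ξ χ l : SmoothFun) : SmoothField Space :=
  opD ξ + opG χ + opM l

theorem genBase_apply (ξ χ l : SmoothFun) (t x : ℝ) (ψ : ℂ) :
    (genBase ξ χ l).1 ((t, x), ψ) =
      ((iteratedDeriv 0 ξ.1 t, 1 / 2 * iteratedDeriv 1 ξ.1 t * x + iteratedDeriv 0 χ.1 t),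
        (((1 / 8 * iteratedDeriv 2 ξ.1 t * x ^ 2 + 1 / 2 * iteratedDeriv 1 χ.1 t * x
          + iteratedDeriv 0 l.1 t : ℝ) : ℂ) * Complex.I
          - ((1 / 2 * iteratedDeriv 1 ξ.1 t : ℝ) : ℂ)) * ψ) := by
  simp only [genBase, opD, opG, opM, Submodule.coe_add, Pi.add_apply, Prod.mk_add_mk,
    iteratedDeriv_zero, iteratedDeriv_one]
  refine Prod.ext (Prod.ext ?_ ?_) ?_
  · simp
  · simp
  · push_cast; ring

theorem genField_apply (ξ χ l : SmoothFun) (p : Space) (V : ℂ) :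
    (genField ξ χ l).1 (p, V) = ((genBase ξ χ l).1 p,
        ((1 / 8 * iteratedDeriv 3 ξ.1 p.1.1 * p.1.2 ^ 2 + 1 / 2 * iteratedDeriv 2 χ.1 p.1.1 * p.1.2
          + iteratedDeriv 1 l.1 p.1.1 : ℝ) : ℂ)
          + Complex.I / 4 * ((iteratedDeriv 2 ξ.1 p.1.1 : ℝ) : ℂ) - ((iteratedDeriv 1 ξ.1 p.1.1 : ℝ) : ℂ) * V) := by
  simp only [genField, opD', opG', opM', Submodule.coe_add, Pi.add_apply, Prod.mk_add_mk, genBase,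
    iteratedDeriv_one]
  refine Prod.ext rfl ?_
  push_cast; ring

theorem SmoothFun.contDiff_zero : ContDiff ℝ ∞ (fun _ : ℝ => (0 : ℝ)) := contDiff_const

/-- The zero function. -/
def SmoothFun.zero : SmoothFun := ⟨fun _ => 0, SmoothFun.contDiff_zero⟩

/-- The sum of two smooth functions. -/
def SmoothFun.add (f g : SmoothFun) : SmoothFun := ⟨f.1 + g.1, f.2.add g.2⟩

/-- A scalar multiple of a smooth function. -/
def SmoothFun.smul (c : ℝ) (f : SmoothFun) : SmoothFun := ⟨c • f.1, f.2.const_smul c⟩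

@[simp] theorem SmoothFun.iteratedDeriv_zero_fun (k : ℕ) (t : ℝ) :
    iteratedDeriv k SmoothFun.zero.1 t = 0 := by
  have : SmoothFun.zero.1 = 0 := rfl
  rw [this]; simp

theorem SmoothFun.contDiffAt (f : SmoothFun) (k : ℕ) (t : ℝ) : ContDiffAt ℝ k f.1 t :=
  (f.2.of_le (by exact_mod_cast le_top)).contDiffAt

@[simp] theorem SmoothFun.iteratedDeriv_add (f g : SmoothFun) (k : ℕ) (t : ℝ) :
    iteratedDeriv k (f.add g).1 t = iteratedDeriv k f.1 t + iteratedDeriv k g.1 t :=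
  _root_.iteratedDeriv_add (f.contDiffAt k t) (g.contDiffAt k t)

@[simp] theorem SmoothFun.iteratedDeriv_smul (c : ℝ) (f : SmoothFun) (k : ℕ) (t : ℝ) :
    iteratedDeriv k (f.smul c).1 t = c * iteratedDeriv k f.1 t :=
  iteratedDeriv_const_smul_field c f.1

theorem genField_zero : genField .zero .zero .zero = 0 := by
  ext1; funext ⟨⟨⟨t, x⟩, ψ⟩, V⟩
  rw [genField_apply, genBase_apply]
  simp

theorem genField_add (ξ χ l ξ' χ' l' : SmoothFun) :
    genField ξ χ l + genField ξ' χ' l' = genField (ξ.add ξ') (χ.add χ') (l.add l') := by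
  ext1; funext ⟨⟨⟨t, x⟩, ψ⟩, V⟩
  simp only [Submodule.coe_add, Pi.add_apply, genField_apply, genBase_apply,
    SmoothFun.iteratedDeriv_add, Prod.mk_add_mk]
  refine Prod.ext (Prod.ext (Prod.ext ?_ ?_) ?_) ?_
  · simp
  · simp; ring
  · push_cast; ring
  · push_cast; ring

theorem genField_smul (c : ℝ) (ξ χ l : SmoothFun) :
    c • genField ξ χ l = genField (ξ.smul c) (χ.smul c) (l.smul c) := by
  ext1; funext ⟨⟨⟨t, x⟩, ψ⟩, V⟩
  simp only [Submodule.coe_smul, Pi.smul_apply, genField_apply, genBase_apply,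
    SmoothFun.iteratedDeriv_smul, Prod.smul_mk, smul_eq_mul, Complex.real_smul]
  refine Prod.ext (Prod.ext (Prod.ext ?_ ?_) ?_) ?_
  · simp
  · simp; ring
  · push_cast; ring
  · push_cast; ring

theorem genField_D (ξ : SmoothFun) : genField ξ .zero .zero = opD' ξ := by
  ext1; funext ⟨⟨⟨t, x⟩, ψ⟩, V⟩
  simp only [genField_apply, genBase_apply, opD', opD, SmoothFun.iteratedDeriv_zero_fun]
  refine Prod.ext (Prod.ext (Prod.ext ?_ ?_) ?_) ?_
  · simp
  · simp
  · simp; ring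
  · simp

theorem genField_G (χ : SmoothFun) : genField .zero χ .zero = opG' χ := by
  ext1; funext ⟨⟨⟨t, x⟩, ψ⟩, V⟩
  simp only [genField_apply, genBase_apply, opG', opG, SmoothFun.iteratedDeriv_zero_fun]
  refine Prod.ext (Prod.ext (Prod.ext ?_ ?_) ?_) ?_
  · simp
  · simp
  · simp; ring
  · simp

theorem genField_M (l : SmoothFun) : genField .zero .zero l = opM' l := by
  ext1; funext ⟨⟨⟨t, x⟩, ψ⟩, V⟩
  simp only [genField_apply, genBase_apply, opM', opM, SmoothFun.iteratedDeriv_zero_fun]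
  refine Prod.ext (Prod.ext (Prod.ext ?_ ?_) ?_) ?_
  · simp
  · simp
  · simp; ring
  · simp

theorem prolongs_genField (ξ χ l : SmoothFun) : Prolongs (genField ξ χ l) (genBase ξ χ l) := by
  rintro ⟨p, V⟩
  rw [genField_apply]

theorem Prolongs.unique {P : SmoothField ExtSpace} {Q Q' : SmoothField Space}
    (h : Prolongs P Q) (h' : Prolongs P Q') : Q = Q' := by
  ext1; funext z
  exact (h (z, 0)).symm.trans (h' (z, 0))

theorem Prolongs.add {P P' : SmoothField ExtSpace} {Q Q' : SmoothField Space}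
    (h : Prolongs P Q) (h' : Prolongs P' Q') : Prolongs (P + P') (Q + Q') := fun p => by
  simp [h p, h' p]

theorem Prolongs.smul {P : SmoothField ExtSpace} {Q : SmoothField Space} (c : ℝ)
    (h : Prolongs P Q) : Prolongs (c • P) (c • Q) := fun p => by
  simp [h p]

theorem prolongs_zero : Prolongs 0 0 := fun _ => rfl

theorem Prolongs.lie {P P' : SmoothField ExtSpace} {Q Q' : SmoothField Space}
    (h : Prolongs P Q) (h' : Prolongs P' Q') : Prolongs ⁅P, P'⁆ ⁅Q, Q'⁆ := by
  have key : ∀ {P : SmoothField ExtSpace} {Q : SmoothField Space}, Prolongs P Q →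
      ∀ p v, (fderiv ℝ P.1 p v).1 = fderiv ℝ Q.1 p.1 v.1 := by
    intro P Q h p v
    have h1 : HasFDerivAt (fun p => (P.1 p).1) _ p :=
      (ContinuousLinearMap.fst ℝ Space ℂ).hasFDerivAt.comp p (P.differentiableAt p).hasFDerivAt
    have h2 : HasFDerivAt (fun p : ExtSpace => Q.1 p.1) _ p :=
      (Q.differentiableAt p.1).hasFDerivAt.comp p
        (ContinuousLinearMap.fst ℝ Space ℂ).hasFDerivAt
    have h3 : (fun p => (P.1 p).1) = fun p : ExtSpace => Q.1 p.1 := funext h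
    rw [h3] at h1
    exact congrArg (fun L => L v) (h1.unique h2)
  intro p
  simp only [SmoothField.bracket_apply, VectorField.lieBracket, Prod.fst_sub, key h, key h', h p,
    h' p]

theorem genBase_injective {ξ χ l ξ' χ' l' : SmoothFun} (h : genBase ξ χ l = genBase ξ' χ' l') :
    ξ = ξ' ∧ χ = χ' ∧ l = l' := by
  have h0 : ∀ t x ψ, (genBase ξ χ l).1 ((t, x), ψ) = (genBase ξ' χ' l').1 ((t, x), ψ) := by
    simp [h]
  simp only [genBase_apply, Prod.mk.injEq] at h0
  have h1 : ξ = ξ' := Subtype.ext (funext fun t => by simpa using (h0 t 0 0).1.1)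
  have h2 : χ = χ' := Subtype.ext (funext fun t => by simpa using (h0 t 0 0).1.2)
  refine ⟨h1, h2, Subtype.ext (funext fun t => ?_)⟩
  have := (h0 t 0 1).2
  subst h1 h2
  simpa using this

theorem mem_spanEquiv_iff (P : SmoothField ExtSpace) :
    P ∈ spanEquiv ↔ ∃ ξ χ l, P = genField ξ χ l := by
  constructor
  · intro h
    induction h using Submodule.span_induction with
    | mem P h =>
      rcases h with (⟨ξ, rfl⟩ | ⟨χ, rfl⟩) | ⟨l, rfl⟩
      · exact ⟨_, _, _, (genField_D ξ).symm⟩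
      · exact ⟨_, _, _, (genField_G χ).symm⟩
      · exact ⟨_, _, _, (genField_M l).symm⟩
    | zero => exact ⟨_, _, _, genField_zero.symm⟩
    | add P P' _ _ h h' =>
      obtain ⟨_, _, _, rfl⟩ := h
      obtain ⟨_, _, _, rfl⟩ := h'
      exact ⟨_, _, _, genField_add ..⟩
    | smul c P _ h =>
      obtain ⟨_, _, _, rfl⟩ := h
      exact ⟨_, _, _, genField_smul ..⟩
  · rintro ⟨ξ, χ, l, rfl⟩
    refine add_mem (add_mem ?_ ?_) ?_ <;> exact Submodule.subset_span (by simp)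

theorem mem_spanCup_iff (Q : SmoothField Space) :
    Q ∈ spanCup ↔ ∃ P ∈ spanEquiv, Prolongs P Q := by
  constructor
  · intro h
    induction h using Submodule.span_induction with
    | mem Q h =>
      rcases h with (⟨ξ, rfl⟩ | ⟨χ, rfl⟩) | ⟨l, rfl⟩
      · exact ⟨opD' ξ, Submodule.subset_span (by simp), fun _ => rfl⟩
      · exact ⟨opG' χ, Submodule.subset_span (by simp), fun _ => rfl⟩
      · exact ⟨opM' l, Submodule.subset_span (by simp), fun _ => rfl⟩
    | zero => exact ⟨0, zero_mem _, prolongs_zero⟩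
    | add Q Q' _ _ h h' =>
      obtain ⟨P, hP, hQ⟩ := h
      obtain ⟨P', hP', hQ'⟩ := h'
      exact ⟨P + P', add_mem hP hP', hQ.add hQ'⟩
    | smul c P _ h =>
      obtain ⟨P, hP, hQ⟩ := h
      exact ⟨c • P, Submodule.smul_mem _ _ hP, hQ.smul c⟩
  · rintro ⟨P, hP, hQ⟩
    obtain ⟨ξ, χ, l, rfl⟩ := (mem_spanEquiv_iff P).1 hP
    rw [hQ.unique (prolongs_genField ξ χ l)]
    refine add_mem (add_mem ?_ ?_) ?_ <;> exact Submodule.subset_span (by simp)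

theorem prolongation_unique {P P' : SmoothField ExtSpace} {Q : SmoothField Space}
    (hP : P ∈ spanEquiv) (hP' : P' ∈ spanEquiv) (h : Prolongs P Q) (h' : Prolongs P' Q) :
    P = P' := by
  obtain ⟨ξ, χ, l, rfl⟩ := (mem_spanEquiv_iff P).1 hP
  obtain ⟨ξ', χ', l', rfl⟩ := (mem_spanEquiv_iff P').1 hP'
  have e := (h.unique (prolongs_genField ξ χ l)).symm.trans
    (h'.unique (prolongs_genField ξ' χ' l'))
  obtain ⟨rfl, rfl, rfl⟩ := genBase_injective e
  rfl

theorem SmoothField.fderiv_eq_of_line {E : Type*} [NormedAddCommGroup E] [NormedSpace ℝ E]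
    (X : SmoothField E) (p v d : E) (h : HasDerivAt (fun s : ℝ => X.1 (p + s • v)) d 0) :
    fderiv ℝ X.1 p v = d := by
  have h1 := (X.differentiableAt p).hasFDerivAt.hasLineDerivAt v
  exact h1.lineDeriv ▸ HasLineDerivAt.lineDeriv h

/-- The derivative of `D'(ξ) + G'(χ) + M'(l)` at a point, in the direction `(((τ, y), ζ), w)`. -/
theorem fderiv_genField (ξ χ l : SmoothFun) (t x τ y : ℝ) (ψ V ζ w : ℂ) :
    fderiv ℝ (genField ξ χ l).1 (((t, x), ψ), V) (((τ, y), ζ), w) =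
      (((iteratedDeriv 1 ξ.1 t * τ, 1 / 2 * (iteratedDeriv 2 ξ.1 t * τ * x
          + iteratedDeriv 1 ξ.1 t * y) + iteratedDeriv 1 χ.1 t * τ),
        (((1 / 8 * (iteratedDeriv 3 ξ.1 t * τ * x ^ 2 + iteratedDeriv 2 ξ.1 t * (2 * x * y))
          + 1 / 2 * (iteratedDeriv 2 χ.1 t * τ * x + iteratedDeriv 1 χ.1 t * y)
          + iteratedDeriv 1 l.1 t * τ : ℝ) : ℂ) * Complex.I
          - ((1 / 2 * (iteratedDeriv 2 ξ.1 t * τ) : ℝ) : ℂ)) * ψ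
          + (((1 / 8 * iteratedDeriv 2 ξ.1 t * x ^ 2 + 1 / 2 * iteratedDeriv 1 χ.1 t * x
          + iteratedDeriv 0 l.1 t : ℝ) : ℂ) * Complex.I
          - ((1 / 2 * iteratedDeriv 1 ξ.1 t : ℝ) : ℂ)) * ζ),
        ((1 / 8 * (iteratedDeriv 4 ξ.1 t * τ * x ^ 2 + iteratedDeriv 3 ξ.1 t * (2 * x * y))
          + 1 / 2 * (iteratedDeriv 3 χ.1 t * τ * x + iteratedDeriv 2 χ.1 t * y)
          + iteratedDeriv 2 l.1 t * τ : ℝ) : ℂ)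
          + Complex.I / 4 * ((iteratedDeriv 3 ξ.1 t * τ : ℝ) : ℂ)
          - (((iteratedDeriv 2 ξ.1 t * τ : ℝ) : ℂ) * V + ((iteratedDeriv 1 ξ.1 t : ℝ) : ℂ) * w)) := by
  apply SmoothField.fderiv_eq_of_line
  have ht : HasDerivAt (fun s : ℝ => t + s * τ) τ 0 := by
    simpa using ((hasDerivAt_id (0 : ℝ)).mul_const τ).const_add t
  have hx : HasDerivAt (fun s : ℝ => x + s * y) y 0 := by
    simpa using ((hasDerivAt_id (0 : ℝ)).mul_const y).const_add x
  have hψ : HasDerivAt (fun s : ℝ => ψ + s * ζ) ζ 0 := by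
    simpa using ((hasDerivAt_id (0 : ℝ)).ofReal_comp.mul_const ζ).const_add ψ
  have hV : HasDerivAt (fun s : ℝ => V + s * w) w 0 := by
    simpa using ((hasDerivAt_id (0 : ℝ)).ofReal_comp.mul_const w).const_add V
  have hf : ∀ (f : SmoothFun) (k : ℕ), HasDerivAt (fun s : ℝ => iteratedDeriv k f.1 (t + s * τ))
      (iteratedDeriv (k + 1) f.1 t * τ) 0 := fun f k => by
    have h := f.hasDerivAt_iteratedDeriv k (t + 0 * τ)
    have h2 := HasDerivAt.comp (0 : ℝ) h ht
    rw [zero_mul, add_zero] at h2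
    exact h2
  have hx2 : HasDerivAt (fun s : ℝ => (x + s * y) ^ 2) (2 * x * y) 0 :=
    (hx.fun_pow 2).congr_deriv (by simp)
  have e : ∀ s : ℝ, (genField ξ χ l).1 ((((t, x), ψ), V) + s • (((τ, y), ζ), w)) = _ := fun s => by
    rw [Prod.smul_mk, Prod.smul_mk, Prod.smul_mk, Prod.mk_add_mk, Prod.mk_add_mk, Prod.mk_add_mk,
      genField_apply, genBase_apply]
  simp only [e, smul_eq_mul, Complex.real_smul]
  refine HasDerivAt.prodMk (HasDerivAt.prodMk (HasDerivAt.prodMk ?_ ?_) ?_) ?_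
  · exact hf ξ 0
  · refine ((((hf ξ 1).const_mul (1 / 2)).mul hx).add (hf χ 0)).congr_deriv ?_
    simp only [zero_mul, add_zero, zero_add, Nat.reduceAdd]; ring
  · refine (((((((hf ξ 2).const_mul (1 / 8)).mul hx2).add
      (((hf χ 1).const_mul (1 / 2)).mul hx)).add (hf l 0)).ofReal_comp.mul_const
      Complex.I |>.sub ((hf ξ 1).const_mul (1 / 2)).ofReal_comp).mul hψ).congr_deriv ?_
    simp only [zero_mul, add_zero, zero_add, Nat.reduceAdd, Complex.ofReal_zero, Pi.add_apply,
      Pi.sub_apply, Pi.mul_apply]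
    push_cast; ring
  · refine ((((((((hf ξ 3).const_mul (1 / 8)).mul hx2).add
      (((hf χ 2).const_mul (1 / 2)).mul hx)).add (hf l 1)).ofReal_comp).add
      ((hf ξ 2).ofReal_comp.const_mul (Complex.I / 4))).sub
        ((hf ξ 1).ofReal_comp.mul hV)).congr_deriv ?_
    simp only [zero_mul, add_zero, Nat.reduceAdd, Complex.ofReal_zero]; push_cast; ring

/-- The product of two smooth functions. -/
def SmoothFun.mul (f g : SmoothFun) : SmoothFun := ⟨f.1 * g.1, f.2.mul g.2⟩

/-- The derivative of order `k` of a smooth function. -/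
noncomputable def SmoothFun.iter (k : ℕ) (f : SmoothFun) : SmoothFun :=
  ⟨iteratedDeriv k f.1, f.contDiff_iteratedDeriv k⟩

theorem SmoothFun.iter_iter (j k : ℕ) (f : SmoothFun) :
    iteratedDeriv j (f.iter k).1 = iteratedDeriv (j + k) f.1 := by
  simp only [SmoothFun.iter, iteratedDeriv_eq_iterate, Function.iterate_add_apply]

@[simp] theorem SmoothFun.iteratedDeriv_mul_zero (f g : SmoothFun) (t : ℝ) :
    iteratedDeriv 0 (f.mul g).1 t = iteratedDeriv 0 f.1 t * iteratedDeriv 0 g.1 t := by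
  simp [SmoothFun.mul]

theorem SmoothFun.iteratedDeriv_mul_succ (f g : SmoothFun) (k : ℕ) (t : ℝ) :
    iteratedDeriv (k + 1) (f.mul g).1 t =
      iteratedDeriv k (((f.iter 1).mul g).add (f.mul (g.iter 1))).1 t := by
  have h : deriv (f.mul g).1 = (((f.iter 1).mul g).add (f.mul (g.iter 1))).1 := by
    funext t
    have hf := f.hasDerivAt_iteratedDeriv 0 t
    have hg := g.hasDerivAt_iteratedDeriv 0 t
    rw [iteratedDeriv_zero] at hf hg
    exact (hf.mul hg).deriv
  rw [iteratedDeriv_succ', h]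

theorem lie_genField (ξ χ l ξ' χ' l' : SmoothFun) :
    ⁅genField ξ χ l, genField ξ' χ' l'⁆ ∈ spanEquiv := by
  rw [mem_spanEquiv_iff]
  refine ⟨(ξ.mul (ξ'.iter 1)).add ((ξ'.mul (ξ.iter 1)).smul (-1)),
    ((ξ.mul (χ'.iter 1)).add ((χ.mul (ξ'.iter 1)).smul (1 / 2))).add
      (((ξ'.mul (χ.iter 1)).add ((χ'.mul (ξ.iter 1)).smul (1 / 2))).smul (-1)),
    ((ξ.mul (l'.iter 1)).add ((χ.mul (χ'.iter 1)).smul (1 / 2))).add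
      (((ξ'.mul (l.iter 1)).add ((χ'.mul (χ.iter 1)).smul (1 / 2))).smul (-1)), ?_⟩
  ext1; funext ⟨⟨⟨t, x⟩, ψ⟩, V⟩
  rw [SmoothField.bracket_apply, VectorField.lieBracket]
  simp only [genField_apply, genBase_apply, fderiv_genField, SmoothFun.iteratedDeriv_add,
    SmoothFun.iteratedDeriv_smul, SmoothFun.iteratedDeriv_mul_zero,
    SmoothFun.iter_iter, Nat.reduceAdd, Prod.mk_sub_mk,
    SmoothFun.iteratedDeriv_mul_succ _ _ 0, SmoothFun.iteratedDeriv_mul_succ _ _ 1,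
    SmoothFun.iteratedDeriv_mul_succ _ _ 2]
  refine Prod.ext (Prod.ext (Prod.ext ?_ ?_) ?_) ?_
  · ring
  · ring
  · push_cast; ring_nf
  · push_cast; ring_nf

theorem lie_mem_spanEquiv {P P' : SmoothField ExtSpace} (h : P ∈ spanEquiv) (h' : P' ∈ spanEquiv) :
    ⁅P, P'⁆ ∈ spanEquiv := by
  obtain ⟨ξ, χ, l, rfl⟩ := (mem_spanEquiv_iff P).1 h
  obtain ⟨ξ', χ', l', rfl⟩ := (mem_spanEquiv_iff P').1 h'
  exact lie_genField ξ χ l ξ' χ' l'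

theorem lie_mem_spanCup {Q Q' : SmoothField Space} (h : Q ∈ spanCup) (h' : Q' ∈ spanCup) :
    ⁅Q, Q'⁆ ∈ spanCup := by
  obtain ⟨P, hP, hQ⟩ := (mem_spanCup_iff Q).1 h
  obtain ⟨P', hP', hQ'⟩ := (mem_spanCup_iff Q').1 h'
  exact (mem_spanCup_iff _).2 ⟨_, lie_mem_spanEquiv hP hP', hQ.lie hQ'⟩

/-- The Lie algebra spanned by the operators `D(ξ)`, `G(χ)`, `l M`. -/
noncomputable def lieCup : LieSubalgebra ℝ (SmoothField Space) :=
  { spanCup with lie_mem' := lie_mem_spanCup }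

/-- The Lie algebra spanned by the operators `D'(ξ)`, `G'(χ)`, `M'(l)`. -/
noncomputable def lieEquiv : LieSubalgebra ℝ (SmoothField ExtSpace) :=
  { spanEquiv with lie_mem' := lie_mem_spanEquiv }

/-- The prolongation of a base field to the variable `V`. -/
noncomputable def prolong (Q : lieCup) : lieEquiv :=
  ⟨((mem_spanCup_iff Q.1).1 Q.2).choose, ((mem_spanCup_iff Q.1).1 Q.2).choose_spec.1⟩

theorem prolongs_prolong (Q : lieCup) : Prolongs (prolong Q).1 Q.1 :=
  ((mem_spanCup_iff Q.1).1 Q.2).choose_spec.2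

theorem prolongs_iff_eq_prolong (Q : lieCup) (P : lieEquiv) :
    Prolongs P.1 Q.1 ↔ P = prolong Q :=
  ⟨fun h => Subtype.ext (prolongation_unique P.2 (prolong Q).2 h (prolongs_prolong Q)),
    fun h => h ▸ prolongs_prolong Q⟩

/-- Prolongation to `V`, as a homomorphism of Lie algebras. -/
noncomputable def prolongHom : lieCup →ₗ⁅ℝ⁆ lieEquiv where
  toFun := prolong
  map_add' Q Q' := ((prolongs_iff_eq_prolong (Q + Q') (prolong Q + prolong Q')).1
    ((prolongs_prolong Q).add (prolongs_prolong Q'))).symm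
  map_smul' c Q := ((prolongs_iff_eq_prolong (c • Q) (c • prolong Q)).1
    ((prolongs_prolong Q).smul c)).symm
  map_lie' {Q Q'} := ((prolongs_iff_eq_prolong ⁅Q, Q'⁆ ⁅prolong Q, prolong Q'⁆).1
    ((prolongs_prolong Q).lie (prolongs_prolong Q'))).symm

theorem prolongHom_bijective : Function.Bijective prolongHom := by
  refine ⟨fun Q Q' h => Subtype.ext ?_, fun P => ?_⟩
  · have h' : prolong Q = prolong Q' := h
    exact (h' ▸ prolongs_prolong Q).unique (prolongs_prolong Q')
  · obtain ⟨ξ, χ, l, h⟩ := (mem_spanEquiv_iff P.1).1 P.2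
    have hp : Prolongs P.1 (genBase ξ χ l) := h ▸ prolongs_genField ξ χ l
    exact ⟨⟨_, (mem_spanCup_iff _).2 ⟨P.1, P.2, hp⟩⟩,
      ((prolongs_iff_eq_prolong ⟨_, (mem_spanCup_iff _).2 ⟨P.1, P.2, hp⟩⟩ P).1 hp).symm⟩

/-- Prolongation to `V`, as an isomorphism of Lie algebras. -/
noncomputable def prolongEquiv : lieCup ≃ₗ⁅ℝ⁆ lieEquiv :=
  LieEquiv.ofBijective prolongHom prolongHom_bijective

theorem prolongs_iff_eq_prolongEquiv (Q : lieCup) (P : lieEquiv) :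
    Prolongs P.1 Q.1 ↔ P = prolongEquiv Q :=
  prolongs_iff_eq_prolong Q P

theorem prolongEquiv_eq {Q : lieCup} {P : SmoothField ExtSpace} (hP : P ∈ spanEquiv)
    (h : Prolongs P Q.1) : (prolongEquiv Q).1 = P :=
  congrArg Subtype.val ((prolongs_iff_eq_prolongEquiv Q ⟨P, hP⟩).1 h).symm

/-- The structure of the equivalence algebra, once its elements are known. -/
theorem equivalence_algebra_of_generators
    (H : ∀ P : SmoothField ExtSpace, P ∈ spanEquiv ↔ IsEquivGenerator P) :
    ∃ (Aequiv : LieSubalgebra ℝ (SmoothField ExtSpace)) (Acup : LieSubalgebra ℝ (SmoothField Space)),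
      (∀ P : SmoothField ExtSpace, P ∈ Aequiv ↔ IsEquivGenerator P) ∧
      Aequiv.toSubmodule = spanEquiv ∧
      Acup.toSubmodule = spanCup ∧
      ∃ e : Acup ≃ₗ⁅ℝ⁆ Aequiv,
        (∀ (Q : Acup) (P : Aequiv), Prolongs P.1 Q.1 ↔ P = e Q) ∧
        (∀ (ξ : SmoothFun) (Q : Acup), Q.1 = opD ξ → (e Q).1 = opD' ξ) ∧
        (∀ (χ : SmoothFun) (Q : Acup), Q.1 = opG χ → (e Q).1 = opG' χ) ∧
        (∀ (l : SmoothFun) (Q : Acup), Q.1 = opM l → (e Q).1 = opM' l) := by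
  refine ⟨lieEquiv, lieCup, H, rfl, rfl, prolongEquiv, prolongs_iff_eq_prolongEquiv, ?_, ?_, ?_⟩
  · intro ξ Q hQ
    exact prolongEquiv_eq (Submodule.subset_span (by simp)) (hQ ▸ fun _ => rfl)
  · intro χ Q hQ
    exact prolongEquiv_eq (Submodule.subset_span (by simp)) (hQ ▸ fun _ => rfl)
  · intro l Q hQ
    exact prolongEquiv_eq (Submodule.subset_span (by simp)) (hQ ▸ fun _ => rfl)

end Algebra

section Flow

open MeasureTheory Filter Topology

/-- A function of two real variables with partial derivatives of class `C^n` is of class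
`C^(n+1)`. -/
theorem contDiff_succ_of_partials {n : ℕ} {f f₁ f₂ : ℝ × ℝ → ℝ}
    (h₁ : ∀ p : ℝ × ℝ, HasDerivAt (fun s => f (s, p.2)) (f₁ p) p.1)
    (h₂ : ∀ p : ℝ × ℝ, HasDerivAt (fun t => f (p.1, t)) (f₂ p) p.2)
    (c₁ : ContDiff ℝ n f₁) (c₂ : ContDiff ℝ n f₂) : ContDiff ℝ (n + 1) f := by
  have c₁' : ContDiff ℝ n fun p => ContinuousLinearMap.toSpanSingleton ℝ (f₁ p) :=
    (ContinuousLinearMap.toSpanSingletonCLE (𝕜 := ℝ) (E := ℝ)).contDiff.comp c₁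
  have c₂' : ContDiff ℝ n fun p => ContinuousLinearMap.toSpanSingleton ℝ (f₂ p) :=
    (ContinuousLinearMap.toSpanSingletonCLE (𝕜 := ℝ) (E := ℝ)).contDiff.comp c₂
  refine contDiff_succ_iff_hasFDerivAt.2 ⟨fun p =>
    (ContinuousLinearMap.toSpanSingleton ℝ (f₁ p)).coprod
      (ContinuousLinearMap.toSpanSingleton ℝ (f₂ p)), ?_, fun p => ?_⟩
  · have : (fun p => (ContinuousLinearMap.toSpanSingleton ℝ (f₁ p)).coprod
      (ContinuousLinearMap.toSpanSingleton ℝ (f₂ p))) = fun p =>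
        f₁ p • ContinuousLinearMap.fst ℝ ℝ ℝ + f₂ p • ContinuousLinearMap.snd ℝ ℝ ℝ := by
      funext p; ext <;> simp
    rw [this]
    exact (c₁.smul contDiff_const).add (c₂.smul contDiff_const)
  · exact (hasStrictFDerivAt_uncurry_coprod (f := fun s t => f (s, t))
      (f₁ := fun s t => ContinuousLinearMap.toSpanSingleton ℝ (f₁ (s, t)))
      (f₂ := fun s t => ContinuousLinearMap.toSpanSingleton ℝ (f₂ (s, t)))
      (Eventually.of_forall fun v => (h₁ v).hasFDerivAt)
      (Eventually.of_forall fun v => (h₂ v).hasFDerivAt)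
      c₁'.continuous.continuousAt c₂'.continuous.continuousAt).hasFDerivAt

/-- The primitive of a function of two variables in its first variable. -/
noncomputable def primitive (f : ℝ × ℝ → ℝ) (p : ℝ × ℝ) : ℝ := ∫ σ in (0 : ℝ)..p.1, f (σ, p.2)

theorem continuous_primitive {f : ℝ × ℝ → ℝ} (hf : Continuous f) : Continuous (primitive f) := by
  have : Continuous (Function.uncurry fun (p : ℝ × ℝ) (σ : ℝ) => f (σ, p.2)) := by
    unfold Function.uncurry; fun_prop
  exact intervalIntegral.continuous_parametric_intervalIntegral_of_continuous this continuous_fst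

theorem hasDerivAt_primitive_fst {f : ℝ × ℝ → ℝ} (hf : Continuous f) (p : ℝ × ℝ) :
    HasDerivAt (fun s => primitive f (s, p.2)) (f p) p.1 := by
  have h : Continuous fun σ => f (σ, p.2) := by fun_prop
  exact intervalIntegral.integral_hasDerivAt_right (h.intervalIntegrable _ _)
    h.aestronglyMeasurable.stronglyMeasurableAtFilter h.continuousAt

theorem hasDerivAt_primitive_snd {f f₂ : ℝ × ℝ → ℝ} (hf : Continuous f) (hf₂ : Continuous f₂)
    (h₂ : ∀ p : ℝ × ℝ, HasDerivAt (fun t => f (p.1, t)) (f₂ p) p.2) (p : ℝ × ℝ) :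
    HasDerivAt (fun t => primitive f (p.1, t)) (primitive f₂ p) p.2 := by
  obtain ⟨C, hC⟩ := (isCompact_uIcc.prod (isCompact_closedBall p.2 1)).exists_bound_of_continuousOn
    (s := uIcc 0 p.1 ×ˢ Metric.closedBall p.2 1) hf₂.continuousOn
  refine (intervalIntegral.hasDerivAt_integral_of_dominated_loc_of_deriv_le (bound := fun _ => C)
    (F := fun t σ => f (σ, t)) (F' := fun t σ => f₂ (σ, t))
    (Metric.closedBall_mem_nhds p.2 one_pos) (Eventually.of_forall fun t => ?_) ?_ ?_
    (ae_of_all _ fun σ hσ t ht => hC (σ, t) ⟨uIoc_subset_uIcc hσ, ht⟩) ?_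
    (ae_of_all _ fun σ _ t _ => h₂ (σ, t))).2
  · exact Continuous.aestronglyMeasurable (by fun_prop)
  · exact Continuous.intervalIntegrable (by fun_prop) _ _
  · exact Continuous.aestronglyMeasurable (by fun_prop)
  · exact continuous_const.intervalIntegrable _ _

theorem ContDiff.hasDerivAt_snd {f : ℝ × ℝ → ℝ} {n : ℕ} (hf : ContDiff ℝ (n + 1) f) (p : ℝ × ℝ) :
    HasDerivAt (fun t => f (p.1, t)) (fderiv ℝ f p (0, 1)) p.2 := by
  have h := ((hf.differentiable (by simp)) p).hasFDerivAt
  exact h.comp_hasDerivAt p.2 ((hasDerivAt_const p.2 p.1).prodMk (hasDerivAt_id p.2))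

theorem contDiff_primitive_nat (n : ℕ) : ∀ {f : ℝ × ℝ → ℝ}, ContDiff ℝ n f →
    ContDiff ℝ n (primitive f) := by
  induction n with
  | zero =>
    intro f hf
    exact contDiff_zero.2 (continuous_primitive (contDiff_zero.1 hf))
  | succ n ih =>
    intro f hf
    have hf' : ContDiff ℝ (n + 1) f := by exact_mod_cast hf
    have hd : ContDiff ℝ n fun p => fderiv ℝ f p (0, 1) :=
      (hf'.fderiv_right le_rfl).clm_apply contDiff_const
    have := contDiff_succ_of_partials (f := primitive f)
      (hasDerivAt_primitive_fst hf'.continuous)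
      (hasDerivAt_primitive_snd hf'.continuous hd.continuous (ContDiff.hasDerivAt_snd hf'))
      (hf'.of_le (by exact_mod_cast Nat.le_succ n)) (ih hd)
    exact_mod_cast this

theorem contDiff_primitive {f : ℝ × ℝ → ℝ} (hf : ContDiff ℝ ∞ f) : ContDiff ℝ ∞ (primitive f) :=
  contDiff_infty.2 fun n => contDiff_primitive_nat n (contDiff_infty.1 hf n)

/-- Solutions of an autonomous equation `α' = ξ(α)` with a bounded Lipschitz right-hand side are
global. -/
theorem exists_global_solution {ξ : ℝ → ℝ} {K L : NNReal} (hK : LipschitzWith K ξ)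
    (hL : ∀ x, ‖ξ x‖ ≤ L) (t : ℝ) :
    ∃ α : ℝ → ℝ, α 0 = t ∧ ∀ s, HasDerivAt α (ξ (α s)) s := by
  have loc : ∀ n : ℕ, ∃ α : ℝ → ℝ, α 0 = t ∧
      ∀ s ∈ Ioo (-(n + 1 : ℝ)) (n + 1), HasDerivAt α (ξ (α s)) s := by
    intro n
    have hmem : (0 : ℝ) ∈ Icc (-(n + 1 : ℝ)) (n + 1) := by
      constructor <;> linarith [(Nat.cast_nonneg n : (0 : ℝ) ≤ n)]
    have hpl : IsPicardLindelof (fun _ => ξ) (⟨0, hmem⟩ : Icc (-(n + 1 : ℝ)) (n + 1)) t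
        (L * (n + 1)) 0 L K :=
      .of_time_independent (fun x _ => hL x) hK.lipschitzOnWith (by simp)
    obtain ⟨α, h0, h⟩ := hpl.exists_eq_forall_mem_Icc_hasDerivWithinAt₀
    exact ⟨α, h0, fun s hs => (h s (Ioo_subset_Icc_self hs)).hasDerivAt (Icc_mem_nhds hs.1 hs.2)⟩
  choose α h0 h using loc
  have agree : ∀ m n : ℕ, m ≤ n → EqOn (α m) (α n) (Ioo (-(m + 1 : ℝ)) (m + 1)) := by
    intro m n hmn
    have hm : (0 : ℝ) ≤ m := Nat.cast_nonneg m
    have hmn' : (m : ℝ) ≤ n := by exact_mod_cast hmn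
    refine ODE_solution_unique_of_mem_Ioo (v := fun _ => ξ) (s := fun _ => univ) (t₀ := 0) (K := K)
      (fun _ _ => hK.lipschitzOnWith) ⟨by linarith, by linarith⟩
      (fun s hs => ⟨h m s hs, trivial⟩) (fun s hs => ⟨h n s ⟨?_, ?_⟩, trivial⟩)
      ((h0 m).trans (h0 n).symm)
    · linarith [hs.1]
    · linarith [hs.2]
  have eqm : ∀ (n : ℕ) (s : ℝ), s ∈ Ioo (-(n + 1 : ℝ)) (n + 1) → α ⌈|s|⌉₊ s = α n s := by
    intro n s hs
    have hs' : s ∈ Ioo (-((⌈|s|⌉₊ : ℝ) + 1)) (⌈|s|⌉₊ + 1) := by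
      have := abs_le.1 (Nat.le_ceil |s|)
      constructor <;> linarith [this.1, this.2]
    rcases le_total ⌈|s|⌉₊ n with hle | hle
    · exact agree _ _ hle hs'
    · exact (agree _ _ hle hs).symm
  refine ⟨fun s => α ⌈|s|⌉₊ s, by simpa using h0 _, fun s => ?_⟩
  have hs : s ∈ Ioo (-((⌈|s|⌉₊ : ℝ) + 1)) (⌈|s|⌉₊ + 1) := by
    have := abs_le.1 (Nat.le_ceil |s|)
    constructor <;> linarith [this.1, this.2]
  refine (h ⌈|s|⌉₊ s hs).congr_of_eventuallyEq ?_
  filter_upwards [Ioo_mem_nhds hs.1 hs.2] with σ hσ using eqm _ σ hσ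

/-- The mean slope of `ξ` between two points. -/
noncomputable def meanSlope (ξ : ℝ → ℝ) (q : ℝ × ℝ) : ℝ :=
  ∫ θ in (0 : ℝ)..1, deriv ξ (q.2 + θ * (q.1 - q.2))

theorem continuous_meanSlope {ξ : ℝ → ℝ} (hξ : ContDiff ℝ ∞ ξ) : Continuous (meanSlope ξ) := by
  have h1 : Continuous (deriv ξ) := hξ.continuous_deriv (by simp)
  exact intervalIntegral.continuous_parametric_intervalIntegral_of_continuous'
    (f := fun (q : ℝ × ℝ) θ => deriv ξ (q.2 + θ * (q.1 - q.2)))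
    (by unfold Function.uncurry; fun_prop) 0 1

theorem meanSlope_mul {ξ : ℝ → ℝ} (hξ : ContDiff ℝ ∞ ξ) (a b : ℝ) :
    ξ a - ξ b = meanSlope ξ (a, b) * (a - b) := by
  have h1 : Continuous (deriv ξ) := hξ.continuous_deriv (by simp)
  have hd : ∀ θ : ℝ, HasDerivAt (fun θ : ℝ => ξ (b + θ * (a - b)))
      (deriv ξ (b + θ * (a - b)) * (a - b)) θ := fun θ => by
    have h2 : HasDerivAt (fun θ : ℝ => b + θ * (a - b)) (a - b) θ := by
      simpa using ((hasDerivAt_id θ).mul_const (a - b)).const_add b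
    exact ((hξ.differentiable (by simp)) _).hasDerivAt.comp θ h2
  have := intervalIntegral.integral_eq_sub_of_hasDerivAt (a := 0) (b := 1) (fun θ _ => hd θ)
    (Continuous.intervalIntegrable (by fun_prop) _ _)
  rw [intervalIntegral.integral_mul_const] at this
  simpa [meanSlope] using this.symm

theorem meanSlope_self (ξ : ℝ → ℝ) (a : ℝ) : meanSlope ξ (a, a) = deriv ξ a := by
  simp [meanSlope]

theorem abs_meanSlope_le {ξ : ℝ → ℝ} {K : ℝ} (hK : ∀ x, |deriv ξ x| ≤ K) (q : ℝ × ℝ) :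
    |meanSlope ξ q| ≤ K := by
  have := intervalIntegral.norm_integral_le_of_norm_le_const (a := 0) (b := 1)
    (f := fun θ => deriv ξ (q.2 + θ * (q.1 - q.2))) (C := K) (fun θ _ => hK _)
  simpa [meanSlope] using this

/-- A global smooth flow on the line, with generator `ξ`. -/
structure LineFlow (ξ : ℝ → ℝ) where
  /-- The point reached from `p.2` after the time `p.1`. -/
  toFun : ℝ × ℝ → ℝ
  contDiff : ContDiff ℝ ∞ toFun
  zero_apply : ∀ t, toFun (0, t) = t
  hasDerivAt_time : ∀ p : ℝ × ℝ, HasDerivAt (fun s => toFun (s, p.2)) (ξ (toFun p)) p.1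
  hasDerivAt_point : ∀ p : ℝ × ℝ, HasDerivAt (fun t => toFun (p.1, t))
    (Real.exp (primitive (fun q => deriv ξ (toFun q)) p)) p.2
  neg_apply : ∀ s t, toFun (-s, toFun (s, t)) = t

theorem exists_lineFlow {ξ : ℝ → ℝ} (hξ : ContDiff ℝ ∞ ξ) (hc : HasCompactSupport ξ) :
    Nonempty (LineFlow ξ) := by
  obtain ⟨K, hK⟩ := (hc.deriv).exists_bound_of_continuous (hξ.continuous_deriv (by simp))
  obtain ⟨L, hL⟩ := hc.exists_bound_of_continuous hξ.continuous
  have hK0 : 0 ≤ K := (norm_nonneg _).trans (hK 0)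
  have hL0 : 0 ≤ L := (norm_nonneg _).trans (hL 0)
  have hlip : LipschitzWith ⟨K, hK0⟩ ξ :=
    lipschitzWith_of_nnnorm_deriv_le (hξ.differentiable (by simp)) fun x => hK x
  choose T h0 hT using exists_global_solution hlip (L := ⟨L, hL0⟩) hL
  have hTc : ∀ t, Continuous (T t) := fun t =>
    continuous_iff_continuousAt.2 fun s => (hT t s).continuousAt
  have hms := continuous_meanSlope hξ
  -- the difference of two solutions
  have hdiff : ∀ t₁ t₂ s, T t₁ s - T t₂ s =
      (t₁ - t₂) * Real.exp (∫ σ in (0 : ℝ)..s, meanSlope ξ (T t₁ σ, T t₂ σ)) := by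
    intro t₁ t₂ s
    have hcont : Continuous fun σ => meanSlope ξ (T t₁ σ, T t₂ σ) :=
      hms.comp ((hTc t₁).prodMk (hTc t₂))
    have hI : ∀ s, HasDerivAt (fun s => ∫ σ in (0 : ℝ)..s, meanSlope ξ (T t₁ σ, T t₂ σ))
        (meanSlope ξ (T t₁ s, T t₂ s)) s := fun s =>
      intervalIntegral.integral_hasDerivAt_right (hcont.intervalIntegrable _ _)
        hcont.aestronglyMeasurable.stronglyMeasurableAtFilter hcont.continuousAt
    have hE : ∀ s, HasDerivAt (fun s => (T t₁ s - T t₂ s) *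
        Real.exp (-∫ σ in (0 : ℝ)..s, meanSlope ξ (T t₁ σ, T t₂ σ))) 0 s := fun s => by
      refine (((hT t₁ s).sub (hT t₂ s)).mul (hI s).neg.exp).congr_deriv ?_
      rw [meanSlope_mul hξ]
      simp only [Pi.sub_apply, Pi.neg_apply]
      ring
    have hconst := is_const_of_deriv_eq_zero (fun s => (hE s).differentiableAt)
      (fun s => (hE s).deriv) s 0
    simp only [h0, intervalIntegral.integral_same, neg_zero, Real.exp_zero, mul_one] at hconst
    rw [← hconst, mul_assoc, ← Real.exp_add]
    simp
  let F : ℝ × ℝ → ℝ := fun p => T p.2 p.1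
  have hbound : ∀ t₁ t₂ s, |T t₁ s - T t₂ s| ≤ |t₁ - t₂| * Real.exp (K * |s|) := by
    intro t₁ t₂ s
    rw [hdiff, abs_mul, Real.abs_exp]
    gcongr
    have := intervalIntegral.norm_integral_le_of_norm_le_const (a := 0) (b := s)
      (f := fun σ => meanSlope ξ (T t₁ σ, T t₂ σ)) (C := K) (fun θ _ => abs_meanSlope_le hK _)
    exact (le_abs_self _).trans (by simpa using this)
  have hFc : Continuous F := by
    refine continuous_iff_continuousAt.2 fun p => ?_
    have hlim : Tendsto (fun q : ℝ × ℝ => |q.2 - p.2| * Real.exp (K * |q.1|)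
        + |T p.2 q.1 - T p.2 p.1|) (𝓝 p) (𝓝 0) := by
      have : Continuous fun q : ℝ × ℝ => |q.2 - p.2| * Real.exp (K * |q.1|)
        + |T p.2 q.1 - T p.2 p.1| := by
        have := hTc p.2
        fun_prop
      simpa using this.tendsto p
    refine tendsto_iff_dist_tendsto_zero.2 (squeeze_zero (fun _ => dist_nonneg) (fun q => ?_) hlim)
    rw [Real.dist_eq]
    calc |T q.2 q.1 - T p.2 p.1|
        = |(T q.2 q.1 - T p.2 q.1) + (T p.2 q.1 - T p.2 p.1)| := by ring_nf
      _ ≤ _ := (abs_add_le _ _).trans (by gcongr; exact hbound _ _ _)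
  have hd1 : Continuous (deriv ξ) := hξ.continuous_deriv (by simp)
  have hF₁ : ∀ p : ℝ × ℝ, HasDerivAt (fun s => F (s, p.2)) (ξ (F p)) p.1 := fun p => hT p.2 p.1
  have hF₂ : ∀ p : ℝ × ℝ, HasDerivAt (fun t => F (p.1, t))
      (Real.exp (primitive (fun q => deriv ξ (F q)) p)) p.2 := by
    intro p
    have hcont : Continuous fun t => Real.exp (∫ σ in (0 : ℝ)..p.1, meanSlope ξ (T t σ, T p.2 σ)) := by
      refine Real.continuous_exp.comp
        (intervalIntegral.continuous_parametric_intervalIntegral_of_continuous'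
        (f := fun t σ => meanSlope ξ (T t σ, T p.2 σ)) ?_ 0 p.1)
      have e1 : Continuous fun x : ℝ × ℝ => T x.1 x.2 := hFc.comp continuous_swap
      have e2 : Continuous fun x : ℝ × ℝ => T p.2 x.2 := (hTc p.2).comp continuous_snd
      exact hms.comp (e1.prodMk e2)
    rw [hasDerivAt_iff_tendsto_slope]
    have hlim := hcont.tendsto p.2
    simp only [meanSlope_self] at hlim
    refine (hlim.mono_left nhdsWithin_le_nhds).congr' ?_
    filter_upwards [self_mem_nhdsWithin] with t ht
    have hne : t - p.2 ≠ 0 := sub_ne_zero.2 ht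
    rw [slope_def_field, eq_div_iff hne, mul_comm]
    exact (hdiff t p.2 p.1).symm
  have hFs : ∀ n : ℕ, ContDiff ℝ n F := by
    intro n
    induction n with
    | zero => exact contDiff_zero.2 hFc
    | succ n ih =>
      have hξ' : ContDiff ℝ n (deriv ξ) := by
        have : ContDiff ℝ ((n : ℕ∞ω) + 1) ξ := hξ.of_le (by exact_mod_cast le_top)
        exact (contDiff_succ_iff_deriv.1 this).2.2
      have := contDiff_succ_of_partials hF₁ hF₂ ((hξ.of_le (by exact_mod_cast le_top)).comp ih)
        (Real.contDiff_exp.comp (contDiff_primitive_nat n (hξ'.comp ih)))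
      exact_mod_cast this
  refine ⟨⟨F, contDiff_infty.2 hFs, h0, hF₁, hF₂, fun s t => ?_⟩⟩
  have hcurve := ODE_solution_unique_univ (v := fun _ => ξ) (s := fun _ => univ) (t₀ := 0)
    (K := ⟨K, hK0⟩) (f := T (T t s)) (g := fun σ => T t (σ + s)) (fun _ => hlip.lipschitzOnWith)
    (fun σ => ⟨hT _ σ, trivial⟩)
    (fun σ => ⟨(hT t (σ + s)).comp_add_const σ s, trivial⟩) (by simp [h0])
  have := congrFun hcurve (-s)
  simpa [F, h0] using this

end Flow

section PointTransformations

open Filter Topology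

theorem _root_.ContDiffOn.differentiableAt_of_isOpen {E F : Type*} [NormedAddCommGroup E]
    [NormedSpace ℝ E] [NormedAddCommGroup F] [NormedSpace ℝ F] {u : E → F} {O : Set E}
    (hu : ContDiffOn ℝ ∞ u O) (hO : IsOpen O) {q : E} (hq : q ∈ O) : DifferentiableAt ℝ u q :=
  ((hu.contDiffAt (hO.mem_nhds hq)).differentiableAt (by simp))

theorem _root_.ContDiffOn.fderiv_apply_of_isOpen {E F : Type*} [NormedAddCommGroup E]
    [NormedSpace ℝ E] [NormedAddCommGroup F] [NormedSpace ℝ F] {u : E → F} {O : Set E}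
    (hu : ContDiffOn ℝ ∞ u O) (hO : IsOpen O) (v : E) :
    ContDiffOn ℝ ∞ (fun q => fderiv ℝ u q v) O :=
  (hu.fderiv_of_isOpen hO (by simp)).clm_apply contDiffOn_const

/-- The derivative of `u` along a curve in the plane. -/
theorem hasDerivAt_comp_curve {u : Plane → ℂ} {γ₁ γ₂ : ℝ → ℝ} {a b s : ℝ}
    (hu : DifferentiableAt ℝ u (γ₁ s, γ₂ s)) (h₁ : HasDerivAt γ₁ a s) (h₂ : HasDerivAt γ₂ b s) :
    HasDerivAt (fun s => u (γ₁ s, γ₂ s))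
      (a * fderiv ℝ u (γ₁ s, γ₂ s) (1, 0) + b * fderiv ℝ u (γ₁ s, γ₂ s) (0, 1)) s := by
  refine (hu.hasFDerivAt.comp_hasDerivAt s (h₁.prodMk h₂)).congr_deriv ?_
  have : ((a, b) : ℝ × ℝ) = a • (1, 0) + b • (0, 1) := by simp
  rw [this, map_add, map_smul, map_smul]
  simp [Complex.real_smul]

theorem hasDerivAt_slice_time {u : Plane → ℂ} {q : Plane} (hu : DifferentiableAt ℝ u q) :
    HasDerivAt (fun t => u (t, q.2)) (fderiv ℝ u q (1, 0)) q.1 := by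
  simpa using hasDerivAt_comp_curve (u := u) hu (hasDerivAt_id q.1) (hasDerivAt_const q.1 q.2)

theorem hasDerivAt_slice_space {u : Plane → ℂ} {q : Plane} (hu : DifferentiableAt ℝ u q) :
    HasDerivAt (fun x => u (q.1, x)) (fderiv ℝ u q (0, 1)) q.2 := by
  simpa using hasDerivAt_comp_curve (u := u) hu (hasDerivAt_const q.2 q.1) (hasDerivAt_id q.2)

theorem iteratedDeriv_two_eq {f f' : ℝ → ℂ} {f'' : ℂ} {x : ℝ}
    (h : ∀ᶠ y in 𝓝 x, HasDerivAt f (f' y) y) (h' : HasDerivAt f' f'' x) :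
    iteratedDeriv 2 f x = f'' := by
  rw [iteratedDeriv_succ, iteratedDeriv_one]
  have : deriv f =ᶠ[𝓝 x] f' := h.mono fun y hy => hy.deriv
  rw [this.deriv_eq, h'.deriv]

theorem iteratedDeriv_slice_space {u : Plane → ℂ} {O : Set Plane} (hu : ContDiffOn ℝ ∞ u O)
    (hO : IsOpen O) {q : Plane} (hq : q ∈ O) :
    iteratedDeriv 2 (fun x => u (q.1, x)) q.2 =
      fderiv ℝ (fun p => fderiv ℝ u p (0, 1)) q (0, 1) := by
  have hnear : ∀ᶠ y in 𝓝 q.2, (q.1, y) ∈ O :=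
    (Continuous.prodMk_right q.1).continuousAt.eventually (hO.mem_nhds hq)
  refine iteratedDeriv_two_eq (f' := fun y => fderiv ℝ u (q.1, y) (0, 1))
    (hnear.mono fun y hy => hasDerivAt_slice_space (q := (q.1, y))
      (hu.differentiableAt_of_isOpen hO hy)) ?_
  exact hasDerivAt_slice_space ((hu.fderiv_apply_of_isOpen hO _).differentiableAt_of_isOpen hO hq)

/-- The left-hand side of the equation with potential value `v` at `q`. -/
noncomputable def residual (v : ℂ) (u : Plane → ℂ) (q : Plane) : ℂ :=
  Complex.I * fderiv ℝ u q (1, 0) + fderiv ℝ (fun p => fderiv ℝ u p (0, 1)) q (0, 1)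
    + u q ^ 2 * (starRingEnd ℂ) (u q) + v * u q

theorem solves_iff_residual {V u : Plane → ℂ} {O : Set Plane} (hu : ContDiffOn ℝ ∞ u O)
    (hO : IsOpen O) : Solves V u O ↔ ∀ q ∈ O, residual (V q) u q = 0 := by
  refine forall₂_congr fun q hq => ?_
  rw [residual, iteratedDeriv_slice_space hu hO hq,
    (hasDerivAt_slice_time (hu.differentiableAt_of_isOpen hO hq)).deriv]

/-- The data of a point transformation `t' = T(t)`, `x' = e^ρ x + b`, `ψ' = e^{-ρ + iS} ψ` with
`T' = e^{2ρ}` and `S = ρ' x²/4 + e^{-ρ} b' x/2 + c`. -/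
structure PointData where
  (T Tinv ρ ρ₁ ρ₂ b b₁ b₂ c c₁ : ℝ → ℝ)
  smooth_T : ContDiff ℝ ∞ T
  smooth_Tinv : ContDiff ℝ ∞ Tinv
  smooth_ρ : ContDiff ℝ ∞ ρ
  smooth_ρ₁ : ContDiff ℝ ∞ ρ₁
  smooth_ρ₂ : ContDiff ℝ ∞ ρ₂
  smooth_b : ContDiff ℝ ∞ b
  smooth_b₁ : ContDiff ℝ ∞ b₁
  smooth_b₂ : ContDiff ℝ ∞ b₂
  smooth_c : ContDiff ℝ ∞ c
  smooth_c₁ : ContDiff ℝ ∞ c₁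
  left_inv : ∀ t, Tinv (T t) = t
  right_inv : ∀ t, T (Tinv t) = t
  deriv_T : ∀ t, HasDerivAt T (Real.exp (2 * ρ t)) t
  deriv_ρ : ∀ t, HasDerivAt ρ (ρ₁ t) t
  deriv_ρ₁ : ∀ t, HasDerivAt ρ₁ (ρ₂ t) t
  deriv_b : ∀ t, HasDerivAt b (b₁ t) t
  deriv_b₁ : ∀ t, HasDerivAt b₁ (b₂ t) t
  deriv_c : ∀ t, HasDerivAt c (c₁ t) t

namespace PointData

variable (d : PointData)

/-- The action on the independent variables. -/
noncomputable def base (q : Plane) : Plane := (d.T q.1, Real.exp (d.ρ q.1) * q.2 + d.b q.1)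

/-- The inverse action on the independent variables. -/
noncomputable def baseInv (q : Plane) : Plane :=
  (d.Tinv q.1, Real.exp (-d.ρ (d.Tinv q.1)) * (q.2 - d.b (d.Tinv q.1)))

/-- The phase `S`. -/
noncomputable def phase (q : Plane) : ℝ :=
  1 / 4 * d.ρ₁ q.1 * q.2 ^ 2 + 1 / 2 * (Real.exp (-d.ρ q.1) * d.b₁ q.1) * q.2 + d.c q.1

/-- The derivative `S_x`. -/
noncomputable def phaseX (q : Plane) : ℝ :=
  1 / 2 * d.ρ₁ q.1 * q.2 + 1 / 2 * (Real.exp (-d.ρ q.1) * d.b₁ q.1)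

/-- The derivative `S_t`. -/
noncomputable def phaseT (q : Plane) : ℝ :=
  1 / 4 * d.ρ₂ q.1 * q.2 ^ 2
    + 1 / 2 * (Real.exp (-d.ρ q.1) * (d.b₂ q.1 - d.ρ₁ q.1 * d.b₁ q.1)) * q.2 + d.c₁ q.1

/-- The multiplier `e^{-ρ + iS}` of `ψ`. -/
noncomputable def mult (q : Plane) : ℂ :=
  Complex.exp (-(d.ρ q.1 : ℂ) + (d.phase q : ℂ) * Complex.I)

/-- The multiplier `e^{ρ - iS}` of the inverse transformation. -/
noncomputable def multInv (q : Plane) : ℂ :=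
  Complex.exp ((d.ρ q.1 : ℂ) - (d.phase q : ℂ) * Complex.I)

/-- The shift of the potential. -/
noncomputable def shift (q : Plane) : ℂ :=
  Complex.I / 2 * (d.ρ₁ q.1 : ℂ) + ((d.phaseT q - d.phaseX q ^ 2 : ℝ) : ℂ)

/-- The transformed potential. -/
noncomputable def potential (q : Plane) (V : ℂ) : ℂ :=
  ((Real.exp (-2 * d.ρ q.1) : ℝ) : ℂ) * (V + d.shift q)

/-- The point transformation of `(t, x, ψ, V)`. -/
noncomputable def map (p : ExtSpace) : ExtSpace :=
  ((d.base p.1.1, d.mult p.1.1 * p.1.2), d.potential p.1.1 p.2)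

/-- The inverse transformation. -/
noncomputable def inv (p : ExtSpace) : ExtSpace :=
  ((d.baseInv p.1.1, d.multInv (d.baseInv p.1.1) * p.1.2),
    ((Real.exp (2 * d.ρ (d.baseInv p.1.1).1) : ℝ) : ℂ) * p.2 - d.shift (d.baseInv p.1.1))

theorem mult_mul_multInv (q : Plane) : d.mult q * d.multInv q = 1 := by
  rw [mult, multInv, ← Complex.exp_add]
  simp

theorem multInv_mul_mult (q : Plane) : d.multInv q * d.mult q = 1 := by
  rw [mul_comm, mult_mul_multInv]

theorem baseInv_base (q : Plane) : d.baseInv (d.base q) = q := by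
  refine Prod.ext (d.left_inv _) ?_
  simp [baseInv, base, d.left_inv, ← mul_assoc, ← Real.exp_add]

theorem base_baseInv (q : Plane) : d.base (d.baseInv q) = q := by
  refine Prod.ext (d.right_inv _) ?_
  simp [baseInv, base, ← mul_assoc, ← Real.exp_add]

theorem exp_two_mul_exp_neg (q : Plane) :
    ((Real.exp (2 * d.ρ q.1) : ℝ) : ℂ) * ((Real.exp (-2 * d.ρ q.1) : ℝ) : ℂ) = 1 := by
  rw [← Complex.ofReal_mul, ← Real.exp_add]
  simp

theorem inv_map (p : ExtSpace) : d.inv (d.map p) = p := by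
  obtain ⟨⟨q, ψ⟩, V⟩ := p
  simp only [inv, map, baseInv_base, ← mul_assoc, multInv_mul_mult, one_mul, potential,
    exp_two_mul_exp_neg, add_sub_cancel_right]

theorem map_inv (p : ExtSpace) : d.map (d.inv p) = p := by
  obtain ⟨⟨q, ψ⟩, V⟩ := p
  simp only [inv, map, base_baseInv, ← mul_assoc, mult_mul_multInv, one_mul, potential,
    sub_add_cancel, mul_comm _ ((Real.exp (2 * d.ρ _) : ℝ) : ℂ), exp_two_mul_exp_neg]

theorem contDiff_base : ContDiff ℝ ∞ d.base := by
  have := d.smooth_T; have := d.smooth_ρ; have := d.smooth_b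
  unfold base; fun_prop

theorem contDiff_baseInv : ContDiff ℝ ∞ d.baseInv := by
  have := d.smooth_Tinv; have := d.smooth_ρ; have := d.smooth_b
  unfold baseInv; fun_prop

theorem contDiff_phase : ContDiff ℝ ∞ d.phase := by
  have := d.smooth_ρ; have := d.smooth_ρ₁; have := d.smooth_b₁; have := d.smooth_c
  unfold phase; fun_prop

theorem contDiff_mult : ContDiff ℝ ∞ d.mult := by
  have h1 := contDiff_ofReal d.contDiff_phase
  have h2 : ContDiff ℝ ∞ fun q : Plane => ((d.ρ q.1 : ℝ) : ℂ) :=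
    contDiff_ofReal (d.smooth_ρ.comp contDiff_fst)
  exact (h2.neg.add (h1.mul contDiff_const)).cexp

theorem contDiff_multInv : ContDiff ℝ ∞ d.multInv := by
  have h1 := contDiff_ofReal d.contDiff_phase
  have h2 : ContDiff ℝ ∞ fun q : Plane => ((d.ρ q.1 : ℝ) : ℂ) :=
    contDiff_ofReal (d.smooth_ρ.comp contDiff_fst)
  exact (h2.sub (h1.mul contDiff_const)).cexp

theorem contDiff_shift : ContDiff ℝ ∞ d.shift := by
  have h1 : ContDiff ℝ ∞ fun q : Plane => ((d.phaseT q - d.phaseX q ^ 2 : ℝ) : ℂ) := by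
    apply contDiff_ofReal
    have := d.smooth_ρ; have := d.smooth_ρ₁; have := d.smooth_ρ₂
    have := d.smooth_b₁; have := d.smooth_b₂; have := d.smooth_c₁
    unfold phaseT phaseX; fun_prop
  have h2 : ContDiff ℝ ∞ fun q : Plane => ((d.ρ₁ q.1 : ℝ) : ℂ) :=
    contDiff_ofReal (d.smooth_ρ₁.comp contDiff_fst)
  exact (contDiff_const.mul h2).add h1

theorem contDiff_factor (a : ℝ) :
    ContDiff ℝ ∞ fun q : Plane => ((Real.exp (a * d.ρ q.1) : ℝ) : ℂ) := by
  apply contDiff_ofReal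
  have := d.smooth_ρ
  fun_prop

theorem contDiff_map : ContDiff ℝ ∞ d.map := by
  have := d.contDiff_base; have := d.contDiff_mult; have := d.contDiff_shift
  have := d.contDiff_factor (-2)
  have h1 : ContDiff ℝ ∞ fun p : ExtSpace => ((Real.exp (-2 * d.ρ p.1.1.1) : ℝ) : ℂ) :=
    this.comp (contDiff_fst.comp contDiff_fst)
  unfold map potential
  fun_prop

theorem contDiff_inv : ContDiff ℝ ∞ d.inv := by
  have := d.contDiff_baseInv; have := d.contDiff_multInv; have := d.contDiff_shift
  have h1 : ContDiff ℝ ∞ fun p : ExtSpace =>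
      ((Real.exp (2 * d.ρ (d.baseInv p.1.1).1) : ℝ) : ℂ) :=
    (d.contDiff_factor 2).comp (d.contDiff_baseInv.comp (contDiff_fst.comp contDiff_fst))
  unfold inv
  fun_prop

theorem isInvertible_fderiv_map (p : ExtSpace) : (fderiv ℝ d.map p).IsInvertible := by
  have h1 := ((d.contDiff_map.differentiable (by simp)) p).hasFDerivAt
  have h2 := ((d.contDiff_inv.differentiable (by simp)) (d.map p)).hasFDerivAt
  have h12 := h2.comp p h1
  have h21 := HasFDerivAt.comp (d.map p) (by rw [inv_map]; exact h1) h2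
  have e12 : d.inv ∘ d.map = id := funext d.inv_map
  have e21 : d.map ∘ d.inv = id := funext d.map_inv
  rw [e12] at h12
  rw [e21] at h21
  exact ContinuousLinearMap.IsInvertible.of_inverse (h21.unique (hasFDerivAt_id _))
    (h12.unique (hasFDerivAt_id _))

theorem hasDerivAt_phase_space (q : Plane) :
    HasDerivAt (fun x => d.phase (q.1, x)) (d.phaseX q) q.2 := by
  refine ((((hasDerivAt_id q.2).fun_pow 2).const_mul (1 / 4 * d.ρ₁ q.1)).add
    ((hasDerivAt_id q.2).const_mul (1 / 2 * (Real.exp (-d.ρ q.1) * d.b₁ q.1))) |>.add_const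
      (d.c q.1)).congr_deriv ?_
  simp [phaseX]; ring

theorem hasDerivAt_phaseX (q : Plane) :
    HasDerivAt (fun x => d.phaseX (q.1, x)) (1 / 2 * d.ρ₁ q.1) q.2 := by
  refine (((hasDerivAt_id q.2).const_mul (1 / 2 * d.ρ₁ q.1)).add_const
    (1 / 2 * (Real.exp (-d.ρ q.1) * d.b₁ q.1))).congr_deriv ?_
  simp

theorem hasDerivAt_phase_time (q : Plane) :
    HasDerivAt (fun t => d.phase (t, q.2)) (d.phaseT q) q.1 := by
  refine ((((d.deriv_ρ₁ q.1).const_mul (1 / 4)).mul_const (q.2 ^ 2)).add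
    ((((d.deriv_ρ q.1).neg.exp.mul (d.deriv_b₁ q.1)).const_mul (1 / 2)).mul_const q.2) |>.add
      (d.deriv_c q.1)).congr_deriv ?_
  simp only [phaseT, Pi.neg_apply]; ring

/-- The equation for `u` is equivalent to the transformed equation for `u'`. -/
theorem residual_transform {O O' : Set Plane} {u u' : Plane → ℂ} (hO : IsOpen O) (hO' : IsOpen O')
    (hu' : ContDiffOn ℝ ∞ u' O') (hu : ∀ q ∈ O, d.base q ∈ O' ∧ u q = d.multInv q * u' (d.base q))
    {q : Plane} (hq : q ∈ O) (V : ℂ) (hsm : ContDiffOn ℝ ∞ u O) :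
    residual V u q = d.multInv q * ((Real.exp (2 * d.ρ q.1) : ℝ) : ℂ)
      * residual (d.potential q V) u' (d.base q) := by
  set r : ℝ := Real.exp (d.ρ q.1) with hr
  have hrr : Real.exp (2 * d.ρ q.1) = r ^ 2 := by rw [hr, ← Real.exp_nat_mul]; norm_num
  have hri : Real.exp (-d.ρ q.1) * r = 1 := by rw [hr, ← Real.exp_add]; simp
  have hxO : ∀ᶠ y in 𝓝 q.2, (q.1, y) ∈ O :=
    (Continuous.prodMk_right q.1).continuousAt.eventually (hO.mem_nhds hq)
  have htO : ∀ᶠ t in 𝓝 q.1, (t, q.2) ∈ O :=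
    (Continuous.prodMk_left q.2).continuousAt.eventually (hO.mem_nhds hq)
  have hq' := (hu q hq).1
  have hd' : ∀ p ∈ O', DifferentiableAt ℝ u' p := fun p hp => hu'.differentiableAt_of_isOpen hO' hp
  have hux := hu'.fderiv_apply_of_isOpen hO' (0, 1)
  have hdx : ∀ p ∈ O', DifferentiableAt ℝ (fun p => fderiv ℝ u' p (0, 1)) p :=
    fun p hp => hux.differentiableAt_of_isOpen hO' hp
  have hX : ∀ y : ℝ, HasDerivAt (fun x => r * x + d.b q.1) r y := fun y => by
    simpa using ((hasDerivAt_id y).const_mul r).add_const (d.b q.1)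
  have hm : ∀ y : ℝ, HasDerivAt (fun x => d.multInv (q.1, x))
      (-(d.phaseX (q.1, y) : ℂ) * Complex.I * d.multInv (q.1, y)) y := fun y => by
    refine ((((d.hasDerivAt_phase_space (q.1, y)).ofReal_comp.mul_const Complex.I).const_sub
      (d.ρ q.1 : ℂ)).cexp).congr_deriv ?_
    simp only [multInv]; ring
  -- the derivatives in `x`
  have h1 : ∀ y : ℝ, (q.1, y) ∈ O → HasDerivAt (fun x => d.multInv (q.1, x) * u' (d.base (q.1, x)))
      (-(d.phaseX (q.1, y) : ℂ) * Complex.I * d.multInv (q.1, y) * u' (d.base (q.1, y))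
        + d.multInv (q.1, y) * (r * fderiv ℝ u' (d.base (q.1, y)) (0, 1))) y := fun y hy => by
    have := hasDerivAt_comp_curve (hd' _ (hu _ hy).1) (hasDerivAt_const y (d.T q.1)) (hX y)
    refine ((hm y).mul this).congr_deriv ?_
    simp [base, hr]
  have h2 : iteratedDeriv 2 (fun x => u (q.1, x)) q.2 =
      d.multInv q * (-(d.phaseX q : ℂ) ^ 2 * u' (d.base q)
        - 2 * d.phaseX q * Complex.I * r * fderiv ℝ u' (d.base q) (0, 1)
        - Complex.I * (1 / 2 * d.ρ₁ q.1) * u' (d.base q)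
        + r ^ 2 * fderiv ℝ (fun p => fderiv ℝ u' p (0, 1)) (d.base q) (0, 1)) := by
    refine iteratedDeriv_two_eq (f' := fun y => -(d.phaseX (q.1, y) : ℂ) * Complex.I
      * d.multInv (q.1, y) * u' (d.base (q.1, y))
      + d.multInv (q.1, y) * (r * fderiv ℝ u' (d.base (q.1, y)) (0, 1))) ?_ ?_
    · filter_upwards [hxO.eventually_nhds] with y hy
      refine (h1 y hy.self_of_nhds).congr_of_eventuallyEq ?_
      filter_upwards [hy] with z hz using (hu _ hz).2
    · have e1 := hasDerivAt_comp_curve (hd' _ hq') (hasDerivAt_const q.2 (d.T q.1)) (hX q.2)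
      have e2 := hasDerivAt_comp_curve (hdx _ hq') (hasDerivAt_const q.2 (d.T q.1)) (hX q.2)
      refine (((((d.hasDerivAt_phaseX q).ofReal_comp.neg.mul_const Complex.I).mul (hm q.2)).mul
        e1).add ((hm q.2).mul (e2.const_mul (r : ℂ)))).congr_deriv ?_
      simp only [base, ← hr, Pi.mul_apply, Pi.neg_apply, Prod.mk.eta]
      push_cast
      linear_combination (d.phaseX q : ℂ) ^ 2 * d.multInv q
        * u' (d.T q.1, r * q.2 + d.b q.1) * Complex.I_sq
  -- the derivative in `t`
  have h3 : HasDerivAt (fun t => u (t, q.2))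
      (d.multInv q * ((d.ρ₁ q.1 - d.phaseT q * Complex.I) * u' (d.base q)
        + r ^ 2 * fderiv ℝ u' (d.base q) (1, 0)
        + (r * d.ρ₁ q.1 * q.2 + d.b₁ q.1) * fderiv ℝ u' (d.base q) (0, 1))) q.1 := by
    have hXt : HasDerivAt (fun t => Real.exp (d.ρ t) * q.2 + d.b t)
        (r * d.ρ₁ q.1 * q.2 + d.b₁ q.1) q.1 :=
      ((d.deriv_ρ q.1).exp.mul_const q.2).add (d.deriv_b q.1)
    have hmt : HasDerivAt (fun t => d.multInv (t, q.2))
        ((d.ρ₁ q.1 - d.phaseT q * Complex.I) * d.multInv q) q.1 := by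
      refine (((d.deriv_ρ q.1).ofReal_comp.sub
        ((d.hasDerivAt_phase_time q).ofReal_comp.mul_const Complex.I)).cexp).congr_deriv ?_
      simp only [multInv, Pi.sub_apply, Prod.mk.eta]; ring
    have e1 := hasDerivAt_comp_curve (hd' _ hq') (d.deriv_T q.1) hXt
    have := (hmt.mul e1).congr_of_eventuallyEq
      (f₁ := fun t => u (t, q.2)) (htO.mono fun t ht => (hu _ ht).2)
    refine this.congr_deriv ?_
    simp only [base, hrr]
    push_cast
    ring
  have hnorm : d.multInv q * (starRingEnd ℂ) (d.multInv q) = (r : ℂ) ^ 2 := by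
    rw [multInv, ← Complex.exp_conj, ← Complex.exp_add, hr, Complex.ofReal_exp,
      ← Complex.exp_nat_mul]
    congr 1
    simp
    ring
  have hpot : (r : ℂ) ^ 2 * d.potential q V = V + d.shift q := by
    have := d.exp_two_mul_exp_neg q
    rw [hrr] at this
    rw [potential, ← mul_assoc]
    push_cast at this ⊢
    rw [this, one_mul]
  have hSx : (r : ℂ) * (2 * d.phaseX q) = (r * d.ρ₁ q.1 * q.2 + d.b₁ q.1 : ℝ) := by
    rw [phaseX]
    have : r * (2 * (1 / 2 * d.ρ₁ q.1 * q.2 + 1 / 2 * (Real.exp (-d.ρ q.1) * d.b₁ q.1)))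
      = r * d.ρ₁ q.1 * q.2 + d.b₁ q.1 := by linear_combination d.b₁ q.1 * hri
    exact_mod_cast this
  have hxx := iteratedDeriv_slice_space hsm hO hq
  have ht := (hasDerivAt_slice_time (hsm.differentiableAt_of_isOpen hO hq)).unique h3
  rw [residual, residual, ← hxx, h2, ht, (hu q hq).2, hrr, map_mul]
  rw [shift] at hpot
  push_cast at hpot hSx ⊢
  set m := d.multInv q
  set w := u' (d.base q)
  linear_combination (m * w ^ 2 * (starRingEnd ℂ) w) * hnorm - (m * w) * hpot
    - (Complex.I * m * fderiv ℝ u' (d.base q) (0, 1)) * hSx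
    - (m * d.phaseT q * w) * Complex.I_sq

theorem isEquivTransformation : IsEquivTransformation univ d.map where
  isOpen := isOpen_univ
  smooth := d.contDiff_map.contDiffOn
  injOn := (Function.LeftInverse.injective d.inv_map).injOn
  nondegenerate p _ := d.isInvertible_fderiv_map p
  projectable := ⟨fun z => (d.base z.1, d.mult z.1 * z.2), fun _ _ => rfl⟩
  maps_class W V hW hV := by
    refine ⟨d.baseInv ⁻¹' W, fun q => d.potential (d.baseInv q) (V (d.baseInv q)),
      hW.preimage d.contDiff_baseInv.continuous, ?_, ?_, ?_⟩
    · have h1 : ContDiffOn ℝ ∞ (fun q => V (d.baseInv q)) (d.baseInv ⁻¹' W) :=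
        hV.comp d.contDiff_baseInv.contDiffOn fun _ h => h
      have h2 : ContDiff ℝ ∞ fun q => d.shift (d.baseInv q) :=
        d.contDiff_shift.comp d.contDiff_baseInv
      have h3 := (d.contDiff_factor (-2)).comp d.contDiff_baseInv
      exact h3.contDiffOn.mul (h1.add h2.contDiffOn)
    · intro q ψ hq _
      simp [map, baseInv_base, hq]
    · intro O O' u u' hO hO' hOW hOW' hu hu' _ himg
      have fwd : ∀ q ∈ O, d.base q ∈ O' ∧ u q = d.multInv q * u' (d.base q) := by
        intro q hq
        obtain ⟨q', hq', h⟩ := himg.subset (mem_image_of_mem _ hq)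
        simp only [map, Prod.mk.injEq] at h
        obtain ⟨⟨h1, h2⟩, -⟩ := h
        refine ⟨h1 ▸ hq', ?_⟩
        rw [← h1, h2, ← mul_assoc, multInv_mul_mult, one_mul]
      have bwd : ∀ q' ∈ O', ∃ q ∈ O, d.base q = q' := by
        intro q' hq'
        obtain ⟨q, hq, h⟩ := himg.superset (mem_image_of_mem _ hq')
        simp only [map, Prod.mk.injEq] at h
        exact ⟨q, hq, h.1.1⟩
      have key : ∀ q ∈ O, residual (V q) u q = 0 ↔
          residual (d.potential (d.baseInv (d.base q)) (V (d.baseInv (d.base q)))) u' (d.base q)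
            = 0 := by
        intro q hq
        rw [d.residual_transform hO hO' hu' fwd hq (V q) hu, baseInv_base]
        have h1 : d.multInv q ≠ 0 := Complex.exp_ne_zero _
        have h2 : ((Real.exp (2 * d.ρ q.1) : ℝ) : ℂ) ≠ 0 := by
          exact_mod_cast (Real.exp_pos _).ne'
        simp [h1]
      rw [solves_iff_residual hu hO, solves_iff_residual hu' hO']
      refine ⟨fun h q' hq' => ?_, fun h q hq => (key q hq).2 (h _ (fwd q hq).1)⟩
      obtain ⟨q, hq, rfl⟩ := bwd q' hq'
      exact (key q hq).1 (h q hq)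

end PointData

theorem IsEquivTransformation.mono {U U' : Set ExtSpace} {Φ : ExtSpace → ExtSpace}
    (h : IsEquivTransformation U Φ) (hU' : IsOpen U') (hsub : U' ⊆ U) :
    IsEquivTransformation U' Φ where
  isOpen := hU'
  smooth := h.smooth.mono hsub
  injOn := h.injOn.mono hsub
  nondegenerate p hp := h.nondegenerate p (hsub hp)
  projectable := h.projectable.imp fun _ hφ p hp => hφ p (hsub hp)
  maps_class W V hW hV := by
    obtain ⟨W', V', hW', hV', h1, h2⟩ := h.maps_class W V hW hV
    exact ⟨W', V', hW', hV', fun q ψ hq hp => h1 q ψ hq (hsub hp),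
      fun O O' u u' a1 a2 a3 a4 a5 a6 a7 a8 =>
        h2 O O' u u' a1 a2 a3 a4 a5 a6 (fun q hq => hsub (a7 q hq)) a8⟩

end PointTransformations

section FlowOfGenerator

open Filter Topology

/-- Directional derivatives of a smooth function commute. -/
theorem fderiv_fderiv_comm {E F : Type*} [NormedAddCommGroup E] [NormedSpace ℝ E]
    [NormedAddCommGroup F] [NormedSpace ℝ F] {f : E → F} {p : E} (hf : ContDiffAt ℝ ∞ f p)
    (v w : E) :
    fderiv ℝ (fun q => fderiv ℝ f q v) p w = fderiv ℝ (fun q => fderiv ℝ f q w) p v := by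
  have hd : DifferentiableAt ℝ (fderiv ℝ f) p :=
    (hf.fderiv_right (m := ∞) (by simp)).differentiableAt (by simp)
  have hs : IsSymmSndFDerivAt ℝ f p := hf.isSymmSndFDerivAt (by
    rw [minSmoothness_of_isRCLikeNormedField]
    exact WithTop.coe_le_coe.2 le_top)
  have e : ∀ v, fderiv ℝ (fun q => fderiv ℝ f q v) p = (fderiv ℝ (fderiv ℝ f) p).flip v := fun v => by
    have := hd.hasFDerivAt.clm_apply (hasFDerivAt_const v p)
    rw [this.fderiv]
    ext; simp
  rw [e, e]
  exact hs.eq w v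

/-- The partial derivative in the second variable. -/
noncomputable def partialSnd (f : ℝ × ℝ → ℝ) (p : ℝ × ℝ) : ℝ := fderiv ℝ f p (0, 1)

theorem contDiff_partialSnd {f : ℝ × ℝ → ℝ} (hf : ContDiff ℝ ∞ f) : ContDiff ℝ ∞ (partialSnd f) :=
  (hf.fderiv_right (m := ∞) (by simp)).clm_apply contDiff_const

theorem hasDerivAt_partialSnd {f : ℝ × ℝ → ℝ} (hf : ContDiff ℝ ∞ f) (s t : ℝ) :
    HasDerivAt (fun t => f (s, t)) (partialSnd f (s, t)) t :=
  ContDiff.hasDerivAt_snd (n := 0) (hf.of_le (by simp)) (s, t)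

theorem hasDerivAt_fst_partialSnd {f g : ℝ × ℝ → ℝ} (hf : ContDiff ℝ ∞ f)
    (hfg : ∀ s t, HasDerivAt (fun s => f (s, t)) (g (s, t)) s) {s t g' : ℝ}
    (hg : HasDerivAt (fun t => g (s, t)) g' t) :
    HasDerivAt (fun s => partialSnd f (s, t)) g' s := by
  have slice : ∀ {h : ℝ × ℝ → ℝ}, ContDiff ℝ ∞ h → ∀ p : ℝ × ℝ,
      HasDerivAt (fun s => h (s, p.2)) (fderiv ℝ h p (1, 0)) p.1 := fun {h} hh p =>
    ((hh.differentiable (by simp)) p).hasFDerivAt.comp_hasDerivAt p.1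
      ((hasDerivAt_id p.1).prodMk (hasDerivAt_const p.1 p.2))
  have e : g = fun p => fderiv ℝ f p (1, 0) :=
    funext fun p => (hfg p.1 p.2).unique (slice hf p)
  have hgs : ContDiff ℝ ∞ g := e ▸ (hf.fderiv_right (m := ∞) (by simp)).clm_apply contDiff_const
  refine (slice (contDiff_partialSnd hf) (s, t)).congr_deriv ?_
  unfold partialSnd
  rw [fderiv_fderiv_comm hf.contDiffAt, ← e]
  exact (hasDerivAt_partialSnd hgs s t).unique hg

namespace LineFlow

variable {ξ : SmoothFun} (F : LineFlow ξ.1) (χ l : SmoothFun)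

/-- Half the logarithm of `T_t`. -/
noncomputable def rho : ℝ × ℝ → ℝ :=
  fun p => 1 / 2 * primitive (fun q => iteratedDeriv 1 ξ.1 (F.toFun q)) p

theorem contDiff_comp (f : SmoothFun) (k : ℕ) :
    ContDiff ℝ ∞ fun q => iteratedDeriv k f.1 (F.toFun q) :=
  (f.contDiff_iteratedDeriv k).comp F.contDiff

theorem contDiff_rho : ContDiff ℝ ∞ F.rho :=
  contDiff_const.mul (contDiff_primitive (F.contDiff_comp ξ 1))

/-- The translation in `x`. -/
noncomputable def shiftX : ℝ × ℝ → ℝ := fun p =>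
  Real.exp (F.rho p) * primitive
    (fun q => iteratedDeriv 0 χ.1 (F.toFun q) * Real.exp (-F.rho q)) p

theorem contDiff_integrand :
    ContDiff ℝ ∞ (fun q => iteratedDeriv 0 χ.1 (F.toFun q) * Real.exp (-F.rho q)) :=
  (F.contDiff_comp χ 0).mul F.contDiff_rho.neg.exp

theorem contDiff_shiftX : ContDiff ℝ ∞ (F.shiftX χ) :=
  F.contDiff_rho.exp.mul (contDiff_primitive (F.contDiff_integrand χ))

/-- The time derivative of the phase at `x = 0`. -/
noncomputable def rate : ℝ × ℝ → ℝ := fun q =>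
  1 / 8 * iteratedDeriv 2 ξ.1 (F.toFun q) * F.shiftX χ q ^ 2
    + 1 / 2 * iteratedDeriv 1 χ.1 (F.toFun q) * F.shiftX χ q + iteratedDeriv 0 l.1 (F.toFun q)

theorem contDiff_rate : ContDiff ℝ ∞ (F.rate χ l) := by
  have := F.contDiff_comp ξ 2; have := F.contDiff_comp χ 1; have := F.contDiff_comp l 0
  have := F.contDiff_shiftX χ
  unfold rate; fun_prop

/-- The phase at `x = 0`. -/
noncomputable def phase₀ : ℝ × ℝ → ℝ := primitive (F.rate χ l)

theorem contDiff_phase₀ : ContDiff ℝ ∞ (F.phase₀ χ l) := contDiff_primitive (F.contDiff_rate χ l)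

theorem hasDerivAt_toFun_snd (s t : ℝ) :
    HasDerivAt (fun t => F.toFun (s, t)) (Real.exp (2 * F.rho (s, t))) t := by
  refine (F.hasDerivAt_point (s, t)).congr_deriv ?_
  simp [rho]

theorem hasDerivAt_comp_snd (f : SmoothFun) (k : ℕ) (s t : ℝ) :
    HasDerivAt (fun t => iteratedDeriv k f.1 (F.toFun (s, t)))
      (iteratedDeriv (k + 1) f.1 (F.toFun (s, t)) * Real.exp (2 * F.rho (s, t))) t :=
  (f.hasDerivAt_iteratedDeriv k _).comp t (F.hasDerivAt_toFun_snd s t)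

theorem hasDerivAt_rho_fst (s t : ℝ) : HasDerivAt (fun s => F.rho (s, t))
    (1 / 2 * iteratedDeriv 1 ξ.1 (F.toFun (s, t))) s :=
  (hasDerivAt_primitive_fst (F.contDiff_comp ξ 1).continuous (s, t)).const_mul (1 / 2)

theorem hasDerivAt_shiftX_fst (s t : ℝ) : HasDerivAt (fun s => F.shiftX χ (s, t))
    (1 / 2 * iteratedDeriv 1 ξ.1 (F.toFun (s, t)) * F.shiftX χ (s, t)
      + iteratedDeriv 0 χ.1 (F.toFun (s, t))) s := by
  refine ((F.hasDerivAt_rho_fst s t).exp.mul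
    (hasDerivAt_primitive_fst (F.contDiff_integrand χ).continuous (s, t))).congr_deriv ?_
  have h : Real.exp (F.rho (s, t)) * Real.exp (-F.rho (s, t)) = 1 := by
    rw [← Real.exp_add]; simp
  simp only [shiftX]
  linear_combination iteratedDeriv 0 χ.1 (F.toFun (s, t)) * h

theorem hasDerivAt_phase₀_fst (s t : ℝ) : HasDerivAt (fun s => F.phase₀ χ l (s, t))
    (F.rate χ l (s, t)) s :=
  hasDerivAt_primitive_fst (F.contDiff_rate χ l).continuous (s, t)

/-- The first `t`-derivative of `rho`. -/
noncomputable def rho₁ : ℝ × ℝ → ℝ := partialSnd F.rho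
/-- The second `t`-derivative of `rho`. -/
noncomputable def rho₂ : ℝ × ℝ → ℝ := partialSnd F.rho₁
/-- The first `t`-derivative of `shiftX`. -/
noncomputable def shiftX₁ : ℝ × ℝ → ℝ := partialSnd (F.shiftX χ)
/-- The second `t`-derivative of `shiftX`. -/
noncomputable def shiftX₂ : ℝ × ℝ → ℝ := partialSnd (F.shiftX₁ χ)
/-- The `t`-derivative of `phase₀`. -/
noncomputable def phase₁ : ℝ × ℝ → ℝ := partialSnd (F.phase₀ χ l)

theorem contDiff_rho₁ : ContDiff ℝ ∞ F.rho₁ := contDiff_partialSnd F.contDiff_rho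
theorem contDiff_rho₂ : ContDiff ℝ ∞ F.rho₂ := contDiff_partialSnd F.contDiff_rho₁
theorem contDiff_shiftX₁ : ContDiff ℝ ∞ (F.shiftX₁ χ) := contDiff_partialSnd (F.contDiff_shiftX χ)
theorem contDiff_shiftX₂ : ContDiff ℝ ∞ (F.shiftX₂ χ) := contDiff_partialSnd (F.contDiff_shiftX₁ χ)
theorem contDiff_phase₁ : ContDiff ℝ ∞ (F.phase₁ χ l) := contDiff_partialSnd (F.contDiff_phase₀ χ l)

theorem hasDerivAt_exp_two_rho_snd (s t : ℝ) :
    HasDerivAt (fun t => Real.exp (2 * F.rho (s, t)))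
      (2 * F.rho₁ (s, t) * Real.exp (2 * F.rho (s, t))) t :=
  (((hasDerivAt_partialSnd F.contDiff_rho s t).const_mul 2).exp).congr_deriv (by
    rw [rho₁]; ring)

theorem hasDerivAt_rho₁_fst (s t : ℝ) : HasDerivAt (fun s => F.rho₁ (s, t))
    (1 / 2 * iteratedDeriv 2 ξ.1 (F.toFun (s, t)) * Real.exp (2 * F.rho (s, t))) s :=
  hasDerivAt_fst_partialSnd (g := fun p => 1 / 2 * iteratedDeriv 1 ξ.1 (F.toFun p))
    F.contDiff_rho F.hasDerivAt_rho_fst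
    (((F.hasDerivAt_comp_snd ξ 1 s t).const_mul (1 / 2)).congr_deriv (by ring))

theorem hasDerivAt_rho₂_fst (s t : ℝ) : HasDerivAt (fun s => F.rho₂ (s, t))
    (1 / 2 * iteratedDeriv 3 ξ.1 (F.toFun (s, t)) * Real.exp (2 * F.rho (s, t)) ^ 2
      + iteratedDeriv 2 ξ.1 (F.toFun (s, t)) * F.rho₁ (s, t) * Real.exp (2 * F.rho (s, t))) s :=
  hasDerivAt_fst_partialSnd
    (g := fun p => 1 / 2 * iteratedDeriv 2 ξ.1 (F.toFun p) * Real.exp (2 * F.rho p))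
    F.contDiff_rho₁ F.hasDerivAt_rho₁_fst
    ((((F.hasDerivAt_comp_snd ξ 2 s t).const_mul (1 / 2)).mul
      (F.hasDerivAt_exp_two_rho_snd s t)).congr_deriv (by ring))

theorem hasDerivAt_shiftX₁_fst (s t : ℝ) : HasDerivAt (fun s => F.shiftX₁ χ (s, t))
    (1 / 2 * iteratedDeriv 2 ξ.1 (F.toFun (s, t)) * Real.exp (2 * F.rho (s, t)) * F.shiftX χ (s, t)
      + 1 / 2 * iteratedDeriv 1 ξ.1 (F.toFun (s, t)) * F.shiftX₁ χ (s, t)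
      + iteratedDeriv 1 χ.1 (F.toFun (s, t)) * Real.exp (2 * F.rho (s, t))) s :=
  hasDerivAt_fst_partialSnd (g := fun p => 1 / 2 * iteratedDeriv 1 ξ.1 (F.toFun p) * F.shiftX χ p
      + iteratedDeriv 0 χ.1 (F.toFun p))
    (F.contDiff_shiftX χ) (F.hasDerivAt_shiftX_fst χ)
    (((((F.hasDerivAt_comp_snd ξ 1 s t).const_mul (1 / 2)).mul
      (hasDerivAt_partialSnd (F.contDiff_shiftX χ) s t)).add
      (F.hasDerivAt_comp_snd χ 0 s t)).congr_deriv (by rw [shiftX₁]; ring))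

theorem hasDerivAt_shiftX₂_fst (s t : ℝ) : HasDerivAt (fun s => F.shiftX₂ χ (s, t))
    (1 / 2 * iteratedDeriv 3 ξ.1 (F.toFun (s, t)) * Real.exp (2 * F.rho (s, t)) ^ 2
        * F.shiftX χ (s, t)
      + iteratedDeriv 2 ξ.1 (F.toFun (s, t)) * F.rho₁ (s, t) * Real.exp (2 * F.rho (s, t))
        * F.shiftX χ (s, t)
      + iteratedDeriv 2 ξ.1 (F.toFun (s, t)) * Real.exp (2 * F.rho (s, t)) * F.shiftX₁ χ (s, t)
      + 1 / 2 * iteratedDeriv 1 ξ.1 (F.toFun (s, t)) * F.shiftX₂ χ (s, t)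
      + iteratedDeriv 2 χ.1 (F.toFun (s, t)) * Real.exp (2 * F.rho (s, t)) ^ 2
      + 2 * iteratedDeriv 1 χ.1 (F.toFun (s, t)) * F.rho₁ (s, t)
        * Real.exp (2 * F.rho (s, t))) s :=
  hasDerivAt_fst_partialSnd
    (g := fun p => 1 / 2 * iteratedDeriv 2 ξ.1 (F.toFun p) * Real.exp (2 * F.rho p) * F.shiftX χ p
      + 1 / 2 * iteratedDeriv 1 ξ.1 (F.toFun p) * F.shiftX₁ χ p
      + iteratedDeriv 1 χ.1 (F.toFun p) * Real.exp (2 * F.rho p))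
    (F.contDiff_shiftX₁ χ) (F.hasDerivAt_shiftX₁_fst χ)
    (((((((F.hasDerivAt_comp_snd ξ 2 s t).const_mul (1 / 2)).mul
      (F.hasDerivAt_exp_two_rho_snd s t)).mul
      (hasDerivAt_partialSnd (F.contDiff_shiftX χ) s t)).add
      (((F.hasDerivAt_comp_snd ξ 1 s t).const_mul (1 / 2)).mul
      (hasDerivAt_partialSnd (F.contDiff_shiftX₁ χ) s t))).add
      ((F.hasDerivAt_comp_snd χ 1 s t).mul (F.hasDerivAt_exp_two_rho_snd s t))).congr_deriv (by
        rw [shiftX₂, shiftX₁]; simp only [Pi.mul_apply]; ring))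

theorem hasDerivAt_phase₁_fst (s t : ℝ) : HasDerivAt (fun s => F.phase₁ χ l (s, t))
    (1 / 8 * iteratedDeriv 3 ξ.1 (F.toFun (s, t)) * Real.exp (2 * F.rho (s, t))
        * F.shiftX χ (s, t) ^ 2
      + 1 / 4 * iteratedDeriv 2 ξ.1 (F.toFun (s, t)) * F.shiftX χ (s, t) * F.shiftX₁ χ (s, t)
      + 1 / 2 * iteratedDeriv 2 χ.1 (F.toFun (s, t)) * Real.exp (2 * F.rho (s, t))
        * F.shiftX χ (s, t)
      + 1 / 2 * iteratedDeriv 1 χ.1 (F.toFun (s, t)) * F.shiftX₁ χ (s, t)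
      + iteratedDeriv 1 l.1 (F.toFun (s, t)) * Real.exp (2 * F.rho (s, t))) s :=
  hasDerivAt_fst_partialSnd (g := F.rate χ l) (F.contDiff_phase₀ χ l)
    (F.hasDerivAt_phase₀_fst χ l)
    ((((((F.hasDerivAt_comp_snd ξ 2 s t).const_mul (1 / 8)).mul
      ((hasDerivAt_partialSnd (F.contDiff_shiftX χ) s t).fun_pow 2)).add
      (((F.hasDerivAt_comp_snd χ 1 s t).const_mul (1 / 2)).mul
      (hasDerivAt_partialSnd (F.contDiff_shiftX χ) s t))).add
      (F.hasDerivAt_comp_snd l 0 s t)).congr_deriv (by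
        rw [shiftX₁]; simp only [Nat.cast_ofNat, Nat.add_one_sub_one, pow_one, Nat.reduceAdd, zero_add]; ring))

theorem contDiff_slice {f : ℝ × ℝ → ℝ} (hf : ContDiff ℝ ∞ f) (s : ℝ) :
    ContDiff ℝ ∞ fun t => f (s, t) := hf.comp (contDiff_prodMk_right s)

/-- The point transformation reached at the time `s`. -/
noncomputable def pointData (s : ℝ) : PointData where
  T t := F.toFun (s, t)
  Tinv t := F.toFun (-s, t)
  ρ t := F.rho (s, t)
  ρ₁ t := F.rho₁ (s, t)
  ρ₂ t := F.rho₂ (s, t)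
  b t := F.shiftX χ (s, t)
  b₁ t := F.shiftX₁ χ (s, t)
  b₂ t := F.shiftX₂ χ (s, t)
  c t := F.phase₀ χ l (s, t)
  c₁ t := F.phase₁ χ l (s, t)
  smooth_T := contDiff_slice F.contDiff s
  smooth_Tinv := contDiff_slice F.contDiff (-s)
  smooth_ρ := contDiff_slice F.contDiff_rho s
  smooth_ρ₁ := contDiff_slice F.contDiff_rho₁ s
  smooth_ρ₂ := contDiff_slice F.contDiff_rho₂ s
  smooth_b := contDiff_slice (F.contDiff_shiftX χ) s
  smooth_b₁ := contDiff_slice (F.contDiff_shiftX₁ χ) s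
  smooth_b₂ := contDiff_slice (F.contDiff_shiftX₂ χ) s
  smooth_c := contDiff_slice (F.contDiff_phase₀ χ l) s
  smooth_c₁ := contDiff_slice (F.contDiff_phase₁ χ l) s
  left_inv t := F.neg_apply s t
  right_inv t := by simpa using F.neg_apply (-s) t
  deriv_T t := F.hasDerivAt_toFun_snd s t
  deriv_ρ t := hasDerivAt_partialSnd F.contDiff_rho s t
  deriv_ρ₁ t := hasDerivAt_partialSnd F.contDiff_rho₁ s t
  deriv_b t := hasDerivAt_partialSnd (F.contDiff_shiftX χ) s t
  deriv_b₁ t := hasDerivAt_partialSnd (F.contDiff_shiftX₁ χ) s t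
  deriv_c t := hasDerivAt_partialSnd (F.contDiff_phase₀ χ l) s t

/-- The flow of `D'(ξ) + G'(χ) + M'(l)`. -/
noncomputable def extFlow (s : ℝ) (p : ExtSpace) : ExtSpace := (F.pointData χ l s).map p

theorem partialSnd_zero {f : ℝ × ℝ → ℝ} (hf : ContDiff ℝ ∞ f) (h : ∀ t, f (0, t) = 0) (t : ℝ) :
    partialSnd f (0, t) = 0 := by
  refine (hasDerivAt_partialSnd hf 0 t).unique ?_
  simp only [h]
  exact hasDerivAt_const t 0

theorem extFlow_zero (p : ExtSpace) : F.extFlow χ l 0 p = p := by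
  have h1 : ∀ t, F.rho (0, t) = 0 := fun t => by simp [rho, primitive]
  have h2 : ∀ t, F.rho₁ (0, t) = 0 := partialSnd_zero F.contDiff_rho h1
  have h3 : ∀ t, F.rho₂ (0, t) = 0 := partialSnd_zero F.contDiff_rho₁ h2
  have h4 : ∀ t, F.shiftX χ (0, t) = 0 := fun t => by simp [shiftX, primitive]
  have h5 : ∀ t, F.shiftX₁ χ (0, t) = 0 := partialSnd_zero (F.contDiff_shiftX χ) h4
  have h6 : ∀ t, F.shiftX₂ χ (0, t) = 0 := partialSnd_zero (F.contDiff_shiftX₁ χ) h5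
  have h7 : ∀ t, F.phase₀ χ l (0, t) = 0 := fun t => by simp [phase₀, primitive]
  have h8 : ∀ t, F.phase₁ χ l (0, t) = 0 := partialSnd_zero (F.contDiff_phase₀ χ l) h7
  obtain ⟨⟨⟨t, x⟩, ψ⟩, V⟩ := p
  simp [extFlow, PointData.map, PointData.base, PointData.mult, PointData.potential,
    PointData.shift, PointData.phase, PointData.phaseT, PointData.phaseX, pointData, h1, h2, h3, h4,
    h5, h6, h7, h8, F.zero_apply]

theorem contDiff_extFlow : ContDiff ℝ ∞ (Function.uncurry (F.extFlow χ l)) := by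
  have pull : ∀ {f : ℝ × ℝ → ℝ}, ContDiff ℝ ∞ f →
      ContDiff ℝ ∞ fun z : ℝ × ExtSpace => f (z.1, z.2.1.1.1) := fun hf =>
    hf.comp (contDiff_fst.prodMk (contDiff_fst.comp (contDiff_fst.comp
      (contDiff_fst.comp contDiff_snd))))
  have hx : ContDiff ℝ ∞ fun z : ℝ × ExtSpace => z.2.1.1.2 := by fun_prop
  have h0 := pull F.contDiff
  have h1 := pull F.contDiff_rho
  have h2 := pull F.contDiff_rho₁
  have h3 := pull F.contDiff_rho₂
  have h4 := pull (F.contDiff_shiftX χ)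
  have h5 := pull (F.contDiff_shiftX₁ χ)
  have h6 := pull (F.contDiff_shiftX₂ χ)
  have h7 := pull (F.contDiff_phase₀ χ l)
  have h8 := pull (F.contDiff_phase₁ χ l)
  have hS : ContDiff ℝ ∞ fun z : ℝ × ExtSpace => (F.pointData χ l z.1).phase z.2.1.1 := by
    unfold PointData.phase pointData; fun_prop
  have hD : ContDiff ℝ ∞ fun z : ℝ × ExtSpace => (F.pointData χ l z.1).phaseT z.2.1.1
      - (F.pointData χ l z.1).phaseX z.2.1.1 ^ 2 := by
    unfold PointData.phaseT PointData.phaseX pointData; fun_prop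
  have hE : ContDiff ℝ ∞ fun z : ℝ × ExtSpace => Real.exp (-2 * F.rho (z.1, z.2.1.1.1)) := by
    fun_prop
  have hm : ContDiff ℝ ∞ fun z : ℝ × ExtSpace => (F.pointData χ l z.1).mult z.2.1.1 :=
    ((contDiff_ofReal h1).neg.add ((contDiff_ofReal hS).mul contDiff_const)).cexp
  have hpot : ContDiff ℝ ∞ fun z : ℝ × ExtSpace =>
      (F.pointData χ l z.1).potential z.2.1.1 z.2.2 :=
    (contDiff_ofReal hE).mul ((contDiff_snd.comp contDiff_snd).add
      ((contDiff_const.mul (contDiff_ofReal h2)).add (contDiff_ofReal hD)))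
  have hb : ContDiff ℝ ∞ fun z : ℝ × ExtSpace => (F.pointData χ l z.1).base z.2.1.1 := by
    unfold PointData.base pointData; fun_prop
  unfold Function.uncurry extFlow PointData.map
  fun_prop

theorem hasDerivAt_extFlow (s : ℝ) (p : ExtSpace) :
    HasDerivAt (fun s => F.extFlow χ l s p) ((genField ξ χ l).1 (F.extFlow χ l s p)) s := by
  obtain ⟨⟨⟨t, x⟩, ψ⟩, V⟩ := p
  set r : ℝ := Real.exp (F.rho (s, t)) with hr
  have hrr : Real.exp (2 * F.rho (s, t)) = r ^ 2 := by rw [hr, ← Real.exp_nat_mul]; norm_num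
  have hri : Real.exp (-F.rho (s, t)) * r = 1 := by rw [hr, ← Real.exp_add]; simp
  have hri2 : Real.exp (-2 * F.rho (s, t)) * r ^ 2 = 1 := by
    rw [← hrr, ← Real.exp_add]; simp
  have dρ := F.hasDerivAt_rho_fst s t
  have dρ₁ := F.hasDerivAt_rho₁_fst s t
  have dρ₂ := F.hasDerivAt_rho₂_fst s t
  have db := F.hasDerivAt_shiftX_fst χ s t
  have db₁ := F.hasDerivAt_shiftX₁_fst χ s t
  have db₂ := F.hasDerivAt_shiftX₂_fst χ s t
  have dc := F.hasDerivAt_phase₀_fst χ l s t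
  have dc₁ := F.hasDerivAt_phase₁_fst χ l s t
  rw [hrr] at dρ₁ dρ₂ db₁ db₂ dc₁
  simp only [extFlow, PointData.map, PointData.base, genField_apply, genBase_apply]
  have eT : ∀ s, (F.pointData χ l s).T t = F.toFun (s, t) := fun _ => rfl
  have eρ : ∀ s, (F.pointData χ l s).ρ t = F.rho (s, t) := fun _ => rfl
  have eb : ∀ s, (F.pointData χ l s).b t = F.shiftX χ (s, t) := fun _ => rfl
  simp only [eT, eρ, eb]
  set T := F.toFun (s, t)
  set b := F.shiftX χ (s, t) with hb
  set b₁ := F.shiftX₁ χ (s, t)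
  set b₂ := F.shiftX₂ χ (s, t)
  set ρ₁ := F.rho₁ (s, t)
  set ρ₂ := F.rho₂ (s, t)
  set X := r * x + b with hX
  have dS : HasDerivAt (fun s => (F.pointData χ l s).phase (t, x))
      (1 / 8 * iteratedDeriv 2 ξ.1 T * X ^ 2 + 1 / 2 * iteratedDeriv 1 χ.1 T * X
        + iteratedDeriv 0 l.1 T) s := by
    refine ((((dρ₁.const_mul (1 / 4)).mul_const (x ^ 2)).add
      (((dρ.neg.exp.mul db₁).const_mul (1 / 2)).mul_const x)).add dc).congr_deriv ?_
    simp only [LineFlow.rate, Pi.neg_apply, ← hb, hX]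
    linear_combination ((1 / 4) * iteratedDeriv 2 ξ.1 T * r * b * x
      + (1 / 2) * iteratedDeriv 1 χ.1 T * r * x) * hri
  have dSx : HasDerivAt (fun s => (F.pointData χ l s).phaseX (t, x))
      (r * (1 / 4 * iteratedDeriv 2 ξ.1 T * X + 1 / 2 * iteratedDeriv 1 χ.1 T)) s := by
    refine (((dρ₁.const_mul (1 / 2)).mul_const x).add
      ((dρ.neg.exp.mul db₁).const_mul (1 / 2))).congr_deriv ?_
    simp only [Pi.neg_apply, hX]
    linear_combination ((1 / 4) * iteratedDeriv 2 ξ.1 T * r * b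
      + (1 / 2) * iteratedDeriv 1 χ.1 T * r) * hri
  have dSt : HasDerivAt (fun s => (F.pointData χ l s).phaseT (t, x))
      (r ^ 2 * (1 / 8 * iteratedDeriv 3 ξ.1 T * X ^ 2 + 1 / 2 * iteratedDeriv 2 χ.1 T * X
        + iteratedDeriv 1 l.1 T) + (1 / 4 * iteratedDeriv 2 ξ.1 T * X
        + 1 / 2 * iteratedDeriv 1 χ.1 T) * (r * ρ₁ * x + b₁)) s := by
    refine ((((dρ₂.const_mul (1 / 4)).mul_const (x ^ 2)).add
      (((dρ.neg.exp.mul (db₂.sub (dρ₁.mul db₁))).const_mul (1 / 2)).mul_const x)).add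
        dc₁).congr_deriv ?_
    simp only [Pi.neg_apply, Pi.sub_apply, Pi.mul_apply, hX]
    linear_combination (1 / 2 * x * r * (1 / 2 * iteratedDeriv 3 ξ.1 T * r ^ 2 * b
      + 1 / 2 * iteratedDeriv 2 ξ.1 T * ρ₁ * b + 1 / 2 * iteratedDeriv 2 ξ.1 T * b₁
      + iteratedDeriv 2 χ.1 T * r ^ 2 + iteratedDeriv 1 χ.1 T * ρ₁)) * hri
  refine HasDerivAt.prodMk (HasDerivAt.prodMk (HasDerivAt.prodMk ?_ ?_) ?_) ?_
  · simpa using F.hasDerivAt_time (s, t)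
  · refine ((dρ.exp.mul_const x).add db).congr_deriv ?_
    simp only [hX, ← hr]; ring
  · have hm : HasDerivAt (fun s => (F.pointData χ l s).mult (t, x)) _ s :=
      (dρ.ofReal_comp.neg.add (dS.ofReal_comp.mul_const Complex.I)).cexp
    refine (hm.mul_const ψ).congr_deriv ?_
    simp only [PointData.mult, pointData, Pi.add_apply, Pi.neg_apply]
    push_cast
    ring
  · have hp : HasDerivAt (fun s => (F.pointData χ l s).potential (t, x) V) _ s :=
      (dρ.const_mul (-2)).exp.ofReal_comp.mul (((dρ₁.ofReal_comp.const_mul (Complex.I / 2)).add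
        (dSt.sub (dSx.fun_pow 2)).ofReal_comp).const_add V)
    refine hp.congr_deriv ?_
    simp only [PointData.potential, PointData.shift]
    have hSx : r * (2 * (F.pointData χ l s).phaseX (t, x)) = r * ρ₁ * x + b₁ := by
      simp only [PointData.phaseX, pointData]
      linear_combination b₁ * hri
    have hSx' : (r : ℂ) * (2 * ((F.pointData χ l s).phaseX (t, x) : ℂ)) = r * ρ₁ * x + b₁ := by
      exact_mod_cast hSx
    have hri2' : ((Real.exp (-2 * F.rho (s, t)) : ℝ) : ℂ) * (r : ℂ) ^ 2 = 1 := by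
      exact_mod_cast hri2
    have e2 : (F.pointData χ l s).ρ₁ t = ρ₁ := rfl
    simp only [eρ, e2, Nat.cast_ofNat, Nat.add_one_sub_one, pow_one]
    push_cast at hri2' ⊢
    set E := Complex.exp (-2 * (F.rho (s, t) : ℂ))
    linear_combination (Complex.I / 4 * (iteratedDeriv 2 ξ.1 T : ℝ)
      + (1 / 8 * (iteratedDeriv 3 ξ.1 T : ℝ) * (X : ℂ) ^ 2 + 1 / 2 * (iteratedDeriv 2 χ.1 T : ℝ) * X
        + (iteratedDeriv 1 l.1 T : ℝ))) * hri2'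
      - E * (1 / 4 * (iteratedDeriv 2 ξ.1 T : ℝ) * X + 1 / 2 * (iteratedDeriv 1 χ.1 T : ℝ)) * hSx'

end LineFlow

end FlowOfGenerator

section Sufficiency

open Filter Topology

theorem genField_congr {ξ ξ' : SmoothFun} (χ l : SmoothFun) {p : ExtSpace}
    (h : ξ.1 =ᶠ[𝓝 p.1.1.1] ξ'.1) : (genField ξ χ l).1 p = (genField ξ' χ l).1 p := by
  obtain ⟨⟨⟨t, x⟩, ψ⟩, V⟩ := p
  simp only [genField_apply, genBase_apply, h.iteratedDeriv_eq]

theorem isEquivGenerator_genField (ξ χ l : SmoothFun) : IsEquivGenerator (genField ξ χ l) := by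
  intro p₀
  set t₀ := p₀.1.1.1
  let β : ContDiffBump t₀ := ⟨1, 2, one_pos, one_lt_two⟩
  let ξ' : SmoothFun := ⟨fun t => β t * ξ.1 t, β.contDiff.mul ξ.2⟩
  have hξ' : ∀ t, |t - t₀| < 1 → ξ.1 =ᶠ[𝓝 t] ξ'.1 := by
    intro t ht
    have hmem : t ∈ Metric.ball t₀ 1 := by rwa [Metric.mem_ball, Real.dist_eq]
    filter_upwards [Metric.isOpen_ball.mem_nhds hmem] with τ hτ
    have : β τ = 1 := β.one_of_mem_closedBall (Metric.ball_subset_closedBall hτ)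
    simp [ξ', this]
  have hc : HasCompactSupport ξ'.1 := β.hasCompactSupport.mul_right
  obtain ⟨F⟩ := exists_lineFlow ξ'.2 hc
  have hN : ∀ᶠ p : ℝ × ℝ in 𝓝 (0, t₀), |F.toFun p - t₀| < 1 := by
    have hcont : Continuous fun p : ℝ × ℝ => |F.toFun p - t₀| := by
      have := F.contDiff.continuous
      fun_prop
    exact hcont.continuousAt.eventually_lt continuousAt_const (by simp [F.zero_apply])
  obtain ⟨δ, hδ, hball⟩ := Metric.eventually_nhds_iff_ball.1 hN
  have hmem : ∀ s ∈ Ioo (-δ) δ, ∀ p ∈ {p : ExtSpace | |p.1.1.1 - t₀| < δ},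
      |F.toFun (s, p.1.1.1) - t₀| < 1 := by
    intro s hs p hp
    refine hball _ ?_
    rw [Metric.mem_ball, Prod.dist_eq, max_lt_iff, Real.dist_eq, Real.dist_eq, sub_zero]
    exact ⟨abs_lt.2 hs, hp⟩
  have hU : IsOpen {p : ExtSpace | |p.1.1.1 - t₀| < δ} :=
    isOpen_lt (by fun_prop) continuous_const
  refine ⟨δ, {p | |p.1.1.1 - t₀| < δ}, F.extFlow χ l, hδ, by simpa [t₀] using hδ,
    (F.contDiff_extFlow χ l).contDiffOn, fun p _ => F.extFlow_zero χ l p, fun s hs p hp => ?_,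
    fun s _ => (F.pointData χ l s).isEquivTransformation.mono hU (subset_univ _)⟩
  rw [genField_congr χ l (hξ' _ (hmem s hs p hp))]
  exact F.hasDerivAt_extFlow χ l s p

end Sufficiency

section Necessity

open Filter Topology

/-- A smooth family of maps that starts at the identity is invertible near the initial time, with
smooth dependence of the inverse on the parameter. -/
theorem exists_parametric_inverse {E : Type*} [NormedAddCommGroup E] [NormedSpace ℝ E]
    [CompleteSpace E] {D : Set (ℝ × E)} (hD : IsOpen D) {f : ℝ × E → E} (hf : ContDiffOn ℝ ∞ f D)
    {e₀ : E} (he₀ : (0, e₀) ∈ D) (h0 : ∀ e, (0, e) ∈ D → f (0, e) = e) :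
    ∃ K : OpenPartialHomeomorph (ℝ × E) (ℝ × E), (0, e₀) ∈ K.source ∧ K.source ⊆ D ∧
      (∀ p ∈ K.source, K p = (p.1, f p)) ∧ ContDiffOn ℝ ∞ K.symm K.target := by
  let k : ℝ × E → ℝ × E := fun p => (p.1, f p)
  have hk : ContDiffOn ℝ ∞ k D := contDiff_fst.contDiffOn.prodMk hf
  have hfa : HasFDerivAt f (fderiv ℝ f (0, e₀)) (0, e₀) :=
    (hf.differentiableAt_of_isOpen hD he₀).hasFDerivAt
  have hsnd : ∀ v, fderiv ℝ f (0, e₀) (0, v) = v := by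
    have h1 : HasFDerivAt (fun e => f (0, e)) _ e₀ :=
      HasFDerivAt.comp e₀ hfa (hasFDerivAt_prodMk_right (0 : ℝ) e₀)
    have hnear : ∀ᶠ e in 𝓝 e₀, f (0, e) = e := by
      filter_upwards [(Continuous.prodMk_right (0 : ℝ)).continuousAt.eventually
        (hD.mem_nhds he₀)] with e he using h0 e he
    have h2 : HasFDerivAt (fun e => f (0, e)) (ContinuousLinearMap.id ℝ E) e₀ :=
      (hasFDerivAt_id e₀).congr_of_eventuallyEq hnear
    intro v
    exact congrArg (fun L => L v) (h1.unique h2)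
  let A : (ℝ × E) ≃L[ℝ] (ℝ × E) := (ContinuousLinearEquiv.refl ℝ ℝ).skewProd
    (ContinuousLinearEquiv.refl ℝ E) ((fderiv ℝ f (0, e₀)).comp (ContinuousLinearMap.inl ℝ ℝ E))
  have hkA : HasFDerivAt k (A : (ℝ × E) →L[ℝ] (ℝ × E)) (0, e₀) := by
    refine (hasFDerivAt_fst.prodMk hfa).congr_fderiv ?_
    ext1
    · ext <;> simp [A]
    · ext v
      · simp [A]
      · simp [A, hsnd]
  have hk0 : ContDiffAt ℝ ∞ k (0, e₀) := hk.contDiffAt (hD.mem_nhds he₀)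
  let K₀ := hk0.toOpenPartialHomeomorph k hkA (by simp)
  have hcont : ContinuousOn (fderiv ℝ k) D :=
    (hk.fderiv_of_isOpen hD (m := ∞) (by simp)).continuousOn
  have hS : IsOpen (D ∩ fderiv ℝ k ⁻¹' range ((↑) : ((ℝ × E) ≃L[ℝ] (ℝ × E)) → _)) :=
    hcont.isOpen_inter_preimage hD ContinuousLinearEquiv.isOpen
  let K := K₀.restrOpen _ hS
  have hKk : ∀ p, K p = k p := fun p => rfl
  have hsrc : K.source = K₀.source ∩ _ := K₀.restrOpen_source _ hS
  refine ⟨K, ?_, ?_, fun p _ => rfl, fun p hp => ?_⟩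
  · rw [hsrc]
    exact ⟨hk0.mem_toOpenPartialHomeomorph_source hkA (by simp), he₀, ⟨A, hkA.fderiv.symm⟩⟩
  · rw [hsrc]
    exact fun p hp => hp.2.1
  · have hp' : K.symm p ∈ K.source := K.map_target hp
    rw [hsrc] at hp'
    obtain ⟨B, hB⟩ := hp'.2.2
    have hd : DifferentiableAt ℝ k (K.symm p) := hk.differentiableAt_of_isOpen hD hp'.2.1
    refine (K.contDiffAt_symm hp (f₀' := B) ?_ (hk.contDiffAt (hD.mem_nhds hp'.2.1))).contDiffWithinAt
    rw [hB]
    exact hd.hasFDerivAt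

theorem eq_of_locally_const {α X : Type*} [TopologicalSpace α] [PreconnectedSpace α] {f : α → X}
    (h : ∀ z, ∀ᶠ w in 𝓝 z, f w = f z) (z w : α) : f z = f w :=
  ((IsLocallyConstant.iff_eventually_eq f).2 h).apply_eq_of_preconnectedSpace z w

/-- An equivalence transformation does not send points over different points of the plane to points
over the same one. -/
theorem IsEquivTransformation.base_injective {U : Set ExtSpace} {Φ : ExtSpace → ExtSpace}
    (h : IsEquivTransformation U Φ) {q q₁ : Plane} {ψ ψ₁ v₀ : ℂ} (hp : ((q, ψ), v₀) ∈ U)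
    (hp₁ : ((q₁, ψ₁), v₀) ∈ U) (he : (Φ ((q, ψ), v₀)).1.1 = (Φ ((q₁, ψ₁), v₀)).1.1) : q = q₁ := by
  by_contra hne
  have hnear : ∀ᶠ v in 𝓝 v₀, ((q, ψ), v) ∈ U :=
    (Continuous.prodMk_right (q, ψ)).continuousAt.eventually (h.isOpen.mem_nhds hp)
  obtain ⟨v, hvU, hv⟩ := ((hnear.filter_mono nhdsWithin_le_nhds).and
    (self_mem_nhdsWithin : ∀ᶠ v in 𝓝[≠] v₀, v ∈ ({v₀}ᶜ : Set ℂ))).exists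
  obtain ⟨φ, hφ⟩ := h.projectable
  have hfst : (Φ ((q, ψ), v)).1 = (Φ ((q, ψ), v₀)).1 := (hφ _ hvU).trans (hφ _ hp).symm
  let N : Plane → ℝ := fun y => (y.1 - q₁.1) ^ 2 + (y.2 - q₁.2) ^ 2
  have hN : N q ≠ 0 := fun h0 => by
    refine hne (Prod.ext ?_ ?_) <;> nlinarith [sq_nonneg (q.1 - q₁.1), sq_nonneg (q.2 - q₁.2)]
  let V : Plane → ℂ := fun y => v₀ + ((N y / N q : ℝ) : ℂ) * (v - v₀)
  have hV : ContDiff ℝ ∞ V := by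
    have : ContDiff ℝ ∞ fun y => ((N y / N q : ℝ) : ℂ) := contDiff_ofReal (by fun_prop)
    fun_prop
  have hVq : V q = v := by simp [V, hN]
  have hVq₁ : V q₁ = v₀ := by simp [V, N]
  obtain ⟨_, V', _, _, h1, _⟩ := h.maps_class univ V isOpen_univ hV.contDiffOn
  obtain ⟨_, V'', _, _, h2, _⟩ := h.maps_class univ (fun _ => v₀) isOpen_univ contDiffOn_const
  have a1 := (h1 q ψ trivial (by rwa [hVq])).2
  have a2 := (h1 q₁ ψ₁ trivial (by rwa [hVq₁])).2
  have a3 := (h2 q ψ trivial hp).2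
  have a4 := (h2 q₁ ψ₁ trivial hp₁).2
  rw [hVq, hfst, he] at a1
  rw [hVq₁] at a2
  rw [he] at a3
  have hsnd : (Φ ((q, ψ), v)).2 = (Φ ((q, ψ), v₀)).2 := by
    rw [← a1, a2, ← a3, a4]
  have := h.injOn hvU hp (Prod.ext hfst hsnd)
  exact hv (Prod.ext_iff.1 this).2

variable {Q : SmoothField ExtSpace}

theorem IsEquivGenerator.fst_eq (hQ : IsEquivGenerator Q) (z : Space) (v v' : ℂ) :
    (Q.1 (z, v)).1 = (Q.1 (z, v')).1 := by
  refine eq_of_locally_const (f := fun v => (Q.1 (z, v)).1) (fun v₀ => ?_) v v'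
  obtain ⟨δ, U, Φ, hδ, hp₀, -, hΦ0, hΦ', hE⟩ := hQ (z, v₀)
  have h0 : (0 : ℝ) ∈ Ioo (-δ) δ := ⟨by linarith, hδ⟩
  have hU : IsOpen U := (hE 0 h0).isOpen
  filter_upwards [(Continuous.prodMk_right z).continuousAt.eventually (hU.mem_nhds hp₀)] with v hv
  have key : ∀ p ∈ U, HasDerivAt (fun s => (Φ s p).1) (Q.1 p).1 0 := fun p hp => by
    have := (hasFDerivAt_fst (𝕜 := ℝ)).comp_hasDerivAt (0 : ℝ) (hΦ' 0 h0 p hp)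
    rw [hΦ0 p hp] at this
    exact this
  refine (key _ hv).unique ((key _ hp₀).congr_of_eventuallyEq ?_)
  filter_upwards [Ioo_mem_nhds h0.1 h0.2] with ε hε
  obtain ⟨φ, hφ⟩ := (hE ε hε).projectable
  exact (hφ _ hv).trans (hφ _ hp₀).symm

theorem IsEquivGenerator.base_snd_eq (hQ : IsEquivGenerator Q) (q : Plane) (ψ ψ' v : ℂ) :
    ((Q.1 ((q, ψ), v)).1.1, (Q.1 ((q, ψ), v)).2) = ((Q.1 ((q, ψ'), v)).1.1, (Q.1 ((q, ψ'), v)).2) := by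
  refine eq_of_locally_const (f := fun ψ => ((Q.1 ((q, ψ), v)).1.1, (Q.1 ((q, ψ), v)).2))
    (fun ψ₀ => ?_) ψ ψ'
  obtain ⟨δ, U, Φ, hδ, hp₀, hΦ, hΦ0, hΦ', hE⟩ := hQ ((q, ψ₀), v)
  have h0 : (0 : ℝ) ∈ Ioo (-δ) δ := ⟨by linarith, hδ⟩
  have hU : IsOpen U := (hE 0 h0).isOpen
  let ι : ℝ × Space → ℝ × ExtSpace := fun p => (p.1, (p.2, v))
  have hι : ContDiff ℝ ∞ ι := by fun_prop
  let D : Set (ℝ × Space) := ι ⁻¹' (Ioo (-δ) δ ×ˢ U)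
  have hD : IsOpen D := (isOpen_Ioo.prod hU).preimage hι.continuous
  let f : ℝ × Space → Space := fun p => ((Φ p.1 (p.2, v)).1.1, p.2.2)
  have hf : ContDiffOn ℝ ∞ f D := by
    have h1 : ContDiffOn ℝ ∞ (fun p : ℝ × Space => Φ p.1 (p.2, v)) D :=
      hΦ.comp hι.contDiffOn fun _ h => h
    exact (contDiff_fst.comp_contDiffOn (contDiff_fst.comp_contDiffOn h1)).prodMk
      (contDiff_snd.comp contDiff_snd).contDiffOn
  obtain ⟨K, hK0, hKD, hK, -⟩ := exists_parametric_inverse hD hf (e₀ := (q, ψ₀)) ⟨h0, hp₀⟩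
    (fun e he => by simp only [f]; rw [hΦ0 _ he.2])
  obtain ⟨r, hr, hball⟩ := Metric.isOpen_iff.1 K.open_source _ hK0
  have hsrc : ∀ ε ∈ Metric.ball (0 : ℝ) r, ∀ ψ ∈ Metric.ball ψ₀ r, (ε, (q, ψ)) ∈ K.source := by
    intro ε hε ψ hψ
    refine hball ?_
    rw [← ball_prod_same, ← ball_prod_same]
    exact ⟨hε, Metric.mem_ball_self hr, hψ⟩
  have hconst : ∀ ε ∈ Metric.ball (0 : ℝ) r, ∀ ψ ∈ Metric.ball ψ₀ r,
      (Φ ε ((q, ψ), v)).1.1 = (Φ ε ((q, ψ₀), v)).1.1 := by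
    intro ε hε
    have hloc : ∀ ψ₁ ∈ Metric.ball ψ₀ r, ∀ᶠ ψ in 𝓝 ψ₁,
        (Φ ε ((q, ψ), v)).1.1 = (Φ ε ((q, ψ₁), v)).1.1 := by
      intro ψ₁ hψ₁
      have hs := hsrc ε hε ψ₁ hψ₁
      have ht : (ε, ((Φ ε ((q, ψ₁), v)).1.1, ψ₁)) ∈ K.target := by
        have := K.map_source hs
        rwa [hK _ hs] at this
      have hc : Continuous fun ψ : ℂ => (ε, ((Φ ε ((q, ψ₁), v)).1.1, ψ)) := by fun_prop
      filter_upwards [hc.continuousAt.eventually (K.open_target.mem_nhds ht),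
        Metric.isOpen_ball.mem_nhds hψ₁] with ψ hψ hψb
      have hP := K.map_target hψ
      have hKP := K.right_inv hψ
      rw [hK _ hP] at hKP
      generalize K.symm (ε, ((Φ ε ((q, ψ₁), v)).1.1, ψ)) = P at hP hKP
      obtain ⟨ε', q', ψ'⟩ := P
      simp only [f, Prod.mk.injEq] at hKP
      obtain ⟨rfl, h2, rfl⟩ := hKP
      have hq := (hE ε' (hKD hP).1).base_injective (hKD hP).2 (hKD hs).2 h2
      rw [← h2, hq]
    intro ψ hψ
    have hdiff : ∀ ψ₁ ∈ Metric.ball ψ₀ r,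
        HasFDerivAt (fun ψ => (Φ ε ((q, ψ), v)).1.1) (0 : ℂ →L[ℝ] Plane) ψ₁ := fun ψ₁ h =>
      (hasFDerivAt_const _ ψ₁).congr_of_eventuallyEq (hloc ψ₁ h)
    exact Metric.isOpen_ball.is_const_of_fderiv_eq_zero (𝕜 := ℝ)
      (convex_ball ψ₀ r).isPreconnected
      (fun ψ₁ h => (hdiff ψ₁ h).differentiableAt.differentiableWithinAt)
      (fun ψ₁ h => (hdiff ψ₁ h).fderiv) hψ (Metric.mem_ball_self hr)
  have key : ∀ p ∈ U, HasDerivAt (fun s => ((Φ s p).1.1, (Φ s p).2)) ((Q.1 p).1.1, (Q.1 p).2) 0 := by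
    intro p hp
    have := hΦ' 0 h0 p hp
    rw [hΦ0 p hp] at this
    exact ((hasFDerivAt_fst (𝕜 := ℝ)).comp_hasDerivAt (0 : ℝ)
      ((hasFDerivAt_fst (𝕜 := ℝ)).comp_hasDerivAt (0 : ℝ) this)).prodMk
      ((hasFDerivAt_snd (𝕜 := ℝ)).comp_hasDerivAt (0 : ℝ) this)
  filter_upwards [Metric.ball_mem_nhds ψ₀ hr] with ψ hψ
  have hψU : ((q, ψ), v) ∈ U := (hKD (hsrc 0 (Metric.mem_ball_self hr) ψ hψ)).2
  refine (key _ hψU).unique ((key _ hp₀).congr_of_eventuallyEq ?_)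
  filter_upwards [Metric.ball_mem_nhds (0 : ℝ) hr, Ioo_mem_nhds h0.1 h0.2] with ε hε hε'
  have e1 := hconst ε hε ψ hψ
  obtain ⟨_, V', _, _, h1, _⟩ :=
    (hE ε hε').maps_class univ (fun _ => v) isOpen_univ contDiffOn_const
  have a1 := (h1 q ψ trivial hψU).2
  have a2 := (h1 q ψ₀ trivial hp₀).2
  exact Prod.ext e1 (by simp only; rw [← a1, ← a2, e1])

end Necessity

section Linearization

open Filter Topology

/-- The derivative of a function along a parameter slice. -/
theorem fderiv_slice {E F : Type*} [NormedAddCommGroup E] [NormedSpace ℝ E] [NormedAddCommGroup F]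
    [NormedSpace ℝ F] {G : ℝ × E → F} {ε : ℝ} {e : E} (hG : DifferentiableAt ℝ G (ε, e)) (v : E) :
    fderiv ℝ (fun e => G (ε, e)) e v = fderiv ℝ G (ε, e) (0, v) := by
  have : HasFDerivAt (fun e => G (ε, e)) _ e :=
    HasFDerivAt.comp e hG.hasFDerivAt (hasFDerivAt_prodMk_right ε e)
  rw [this.fderiv]
  simp

theorem hasDerivAt_parameter {E F : Type*} [NormedAddCommGroup E] [NormedSpace ℝ E]
    [NormedAddCommGroup F] [NormedSpace ℝ F] {G : ℝ × E → F} {ε : ℝ} {e : E}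
    (hG : DifferentiableAt ℝ G (ε, e)) :
    HasDerivAt (fun ε => G (ε, e)) (fderiv ℝ G (ε, e) (1, 0)) ε :=
  hG.hasFDerivAt.comp_hasDerivAt ε ((hasDerivAt_id ε).prodMk (hasDerivAt_const ε e))

/-- The first variation of the residual of a smooth family of solutions. -/
theorem residual_variation {N : Set (ℝ × Plane)} (hN : IsOpen N) {G H : ℝ × Plane → ℂ}
    (hG : ContDiffOn ℝ ∞ G N) (hH : ContDiffOn ℝ ∞ H N) {q₀ : Plane} (h0 : (0, q₀) ∈ N)
    (hres : ∀ ε q, (ε, q) ∈ N → residual (H (ε, q)) (fun q => G (ε, q)) q = 0)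
    {w : Plane → ℂ} (hw : ∀ q, (0, q) ∈ N → fderiv ℝ G (0, q) (1, 0) = w q) :
    Complex.I * fderiv ℝ w q₀ (1, 0) + fderiv ℝ (fun p => fderiv ℝ w p (0, 1)) q₀ (0, 1)
      + 2 * G (0, q₀) * (starRingEnd ℂ) (G (0, q₀)) * w q₀
      + G (0, q₀) ^ 2 * (starRingEnd ℂ) (w q₀)
      + H (0, q₀) * w q₀ + fderiv ℝ H (0, q₀) (1, 0) * G (0, q₀) = 0 := by
  let et : ℝ × Plane := (0, (1, 0))
  let ex : ℝ × Plane := (0, (0, 1))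
  let es : ℝ × Plane := (1, 0)
  have hGv : ∀ v, ContDiffOn ℝ ∞ (fun z => fderiv ℝ G z v) N := fun v =>
    hG.fderiv_apply_of_isOpen hN v
  have hGvw : ∀ v w, ContDiffOn ℝ ∞ (fun z => fderiv ℝ (fun z => fderiv ℝ G z v) z w) N :=
    fun v w => (hGv v).fderiv_apply_of_isOpen hN w
  have dG : ∀ z ∈ N, DifferentiableAt ℝ G z := fun z hz => hG.differentiableAt_of_isOpen hN hz
  have dGv : ∀ v, ∀ z ∈ N, DifferentiableAt ℝ (fun z => fderiv ℝ G z v) z := fun v z hz =>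
    (hGv v).differentiableAt_of_isOpen hN hz
  have nearS : ∀ {ε : ℝ} {q : Plane}, (ε, q) ∈ N → ∀ᶠ q' in 𝓝 q, (ε, q') ∈ N := fun {ε q} h =>
    (Continuous.prodMk_right ε).continuousAt.eventually (hN.mem_nhds h)
  -- directional form of the residual
  have hres' : ∀ ε q, (ε, q) ∈ N → Complex.I * fderiv ℝ G (ε, q) et
      + fderiv ℝ (fun z => fderiv ℝ G z ex) (ε, q) ex
      + G (ε, q) ^ 2 * (starRingEnd ℂ) (G (ε, q)) + H (ε, q) * G (ε, q) = 0 := by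
    intro ε q hz
    rw [← hres ε q hz, residual, fderiv_slice (dG _ hz)]
    have e1 : (fun p => fderiv ℝ (fun q => G (ε, q)) p (0, 1)) =ᶠ[𝓝 q]
        fun p => fderiv ℝ G (ε, p) ex := by
      filter_upwards [nearS hz] with p hp using fderiv_slice (dG _ hp) _
    rw [e1.fderiv_eq, fderiv_slice (G := fun z => fderiv ℝ G z ex) (dGv ex _ hz)]
  -- differentiation in the parameter
  have d1 : HasDerivAt (fun ε => G (ε, q₀)) (w q₀) 0 :=
    (hasDerivAt_parameter (dG _ h0)).congr_deriv (hw q₀ h0)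
  have dconj : HasDerivAt (fun ε => (starRingEnd ℂ) (G (ε, q₀))) ((starRingEnd ℂ) (w q₀)) 0 :=
    (Complex.conjCLE.toContinuousLinearMap.hasFDerivAt).comp_hasDerivAt (0 : ℝ) d1
  have d2 := hasDerivAt_parameter (hH.differentiableAt_of_isOpen hN h0)
  have cG : ∀ z ∈ N, ContDiffAt ℝ ∞ G z := fun z hz => hG.contDiffAt (hN.mem_nhds hz)
  have hwN : (fun q => fderiv ℝ G (0, q) es) =ᶠ[𝓝 q₀] w := by
    filter_upwards [nearS h0] with q hq using hw q hq
  have d3 : HasDerivAt (fun ε => fderiv ℝ G (ε, q₀) et) (fderiv ℝ w q₀ (1, 0)) 0 := by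
    refine (hasDerivAt_parameter (G := fun z => fderiv ℝ G z et) (dGv et _ h0)).congr_deriv ?_
    rw [fderiv_fderiv_comm (cG _ h0), ← hwN.fderiv_eq]
    exact (fderiv_slice (G := fun z => fderiv ℝ G z es) (dGv es _ h0) _).symm
  have d4 : HasDerivAt (fun ε => fderiv ℝ (fun z => fderiv ℝ G z ex) (ε, q₀) ex)
      (fderiv ℝ (fun p => fderiv ℝ w p (0, 1)) q₀ (0, 1)) 0 := by
    refine (hasDerivAt_parameter (G := fun z => fderiv ℝ (fun z => fderiv ℝ G z ex) z ex)
      ((hGvw ex ex).differentiableAt_of_isOpen hN h0)).congr_deriv ?_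
    rw [fderiv_fderiv_comm ((hGv ex).contDiffAt (hN.mem_nhds h0))]
    have e1 : (fun z => fderiv ℝ (fun z => fderiv ℝ G z ex) z (1, 0)) =ᶠ[𝓝 (0, q₀)]
        fun z => fderiv ℝ (fun z => fderiv ℝ G z es) z ex := by
      filter_upwards [hN.mem_nhds h0] with z hz using fderiv_fderiv_comm (cG z hz) _ _
    rw [e1.fderiv_eq]
    have e2 : (fun p => fderiv ℝ w p (0, 1)) =ᶠ[𝓝 q₀]
        fun p => fderiv ℝ (fun z => fderiv ℝ G z es) (0, p) ex := by
      filter_upwards [nearS h0, hwN.eventuallyEq_nhds] with p hp hp'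
      rw [← hp'.fderiv_eq]
      exact fderiv_slice (G := fun z => fderiv ℝ G z es) (dGv es _ hp) _
    rw [e2.fderiv_eq]
    exact (fderiv_slice (G := fun z => fderiv ℝ (fun z => fderiv ℝ G z es) z ex)
      ((hGvw es ex).differentiableAt_of_isOpen hN h0) _).symm
  have hzero : (fun ε => Complex.I * fderiv ℝ G (ε, q₀) et
      + fderiv ℝ (fun z => fderiv ℝ G z ex) (ε, q₀) ex
      + G (ε, q₀) ^ 2 * (starRingEnd ℂ) (G (ε, q₀)) + H (ε, q₀) * G (ε, q₀)) =ᶠ[𝓝 0]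
      fun _ => 0 := by
    filter_upwards [(Continuous.prodMk_left q₀).continuousAt.eventually (hN.mem_nhds h0)]
      with ε hε using hres' ε q₀ hε
  have dE := ((((d3.const_mul Complex.I).add d4).add ((d1.fun_pow 2).mul dconj)).add (d2.mul d1))
  have := dE.unique ((hasDerivAt_const (0 : ℝ) (0 : ℂ)).congr_of_eventuallyEq hzero)
  rw [← this]
  simp only [Nat.cast_ofNat, Nat.add_one_sub_one, pow_one]
  ring

/-- The linearized equation that a generator of the equivalence group satisfies on every
solution. -/
theorem IsEquivGenerator.linearized {Q : SmoothField ExtSpace} (hQ : IsEquivGenerator Q)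
    {u V : Plane → ℂ} (hu : ContDiff ℝ ∞ u) (hV : ContDiff ℝ ∞ V)
    (hres : ∀ q, residual (V q) u q = 0) {w k : Plane → ℂ}
    (hw : ∀ q, w q = (Q.1 ((q, u q), V q)).1.2 - fderiv ℝ u q (Q.1 ((q, u q), V q)).1.1)
    (hk : ∀ q, k q = (Q.1 ((q, u q), V q)).2 - fderiv ℝ V q (Q.1 ((q, u q), V q)).1.1) (q₀ : Plane) :
    Complex.I * fderiv ℝ w q₀ (1, 0) + fderiv ℝ (fun p => fderiv ℝ w p (0, 1)) q₀ (0, 1)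
      + 2 * u q₀ * (starRingEnd ℂ) (u q₀) * w q₀ + u q₀ ^ 2 * (starRingEnd ℂ) (w q₀)
      + V q₀ * w q₀ + k q₀ * u q₀ = 0 := by
  let P : Plane → ExtSpace := fun q => ((q, u q), V q)
  have hP : ContDiff ℝ ∞ P := by fun_prop
  obtain ⟨δ, U, Φ, hδ, hp₀, hΦ, hΦ0, hΦ', hE⟩ := hQ (P q₀)
  have h0 : (0 : ℝ) ∈ Ioo (-δ) δ := ⟨by linarith, hδ⟩
  have hU : IsOpen U := (hE 0 h0).isOpen
  let ι : ℝ × Plane → ℝ × ExtSpace := fun p => (p.1, P p.2)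
  have hι : ContDiff ℝ ∞ ι := by fun_prop
  let D : Set (ℝ × Plane) := ι ⁻¹' (Ioo (-δ) δ ×ˢ U)
  have hD : IsOpen D := (isOpen_Ioo.prod hU).preimage hι.continuous
  have hA : ContDiffOn ℝ ∞ (fun p : ℝ × Plane => Φ p.1 (P p.2)) D :=
    hΦ.comp hι.contDiffOn fun _ h => h
  let f : ℝ × Plane → Plane := fun p => (Φ p.1 (P p.2)).1.1
  have hf : ContDiffOn ℝ ∞ f D := contDiff_fst.comp_contDiffOn (contDiff_fst.comp_contDiffOn hA)
  obtain ⟨K, hK0, hKD, hK, hKs⟩ := exists_parametric_inverse hD hf (e₀ := q₀) ⟨h0, hp₀⟩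
    (fun e he => by simp only [f]; rw [hΦ0 _ he.2])
  obtain ⟨r, hr, hball⟩ := Metric.isOpen_iff.1 K.open_source _ hK0
  rw [← ball_prod_same] at hball
  set B : Set (ℝ × Plane) := Metric.ball 0 r ×ˢ Metric.ball q₀ r with hB
  have hBo : IsOpen B := Metric.isOpen_ball.prod Metric.isOpen_ball
  let N : Set (ℝ × Plane) := K.target ∩ K.symm ⁻¹' B
  have hN : IsOpen N := K.isOpen_inter_preimage_symm hBo
  have hBN : ∀ p ∈ B, (p.1, f p) ∈ N ∧ K.symm (p.1, f p) = p := by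
    intro p hp
    rw [← hK p (hball hp)]
    have := K.left_inv (hball hp)
    exact ⟨⟨K.map_source (hball hp), by rwa [mem_preimage, this]⟩, this⟩
  have hNB : ∀ ε q, (ε, q) ∈ N → ∃ q₁, (ε, q₁) ∈ B ∧ K.symm (ε, q) = (ε, q₁) ∧ f (ε, q₁) = q := by
    intro ε q hz
    have h1 := K.right_inv hz.1
    rw [hK _ (K.map_target hz.1)] at h1
    have h2 : K.symm (ε, q) = (ε, (K.symm (ε, q)).2) := Prod.ext (Prod.ext_iff.1 h1).1 rfl
    refine ⟨(K.symm (ε, q)).2, ?_, h2, ?_⟩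
    · rw [← h2]
      exact hz.2
    · rw [← h2]
      exact (Prod.ext_iff.1 h1).2
  let A : ℝ × Plane → ExtSpace := fun z => Φ z.1 (P (K.symm z).2)
  have hAs : ContDiffOn ℝ ∞ A N := by
    have h1 : ContDiffOn ℝ ∞ (fun z : ℝ × Plane => (z.1, (K.symm z).2)) N :=
      contDiff_fst.contDiffOn.prodMk (contDiff_snd.comp_contDiffOn (hKs.mono inter_subset_left))
    refine hA.comp h1 fun z hz => ?_
    obtain ⟨q, h1, h2, -⟩ := hNB z.1 z.2 hz
    simp only [Prod.mk.eta] at h2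
    simp only [h2]
    exact hKD (hball h1)
  have hAf : ∀ p ∈ B, A (p.1, f p) = Φ p.1 (P p.2) := fun p hp => by
    simp only [A]; rw [(hBN p hp).2]
  have hq0 : ∀ q ∈ Metric.ball q₀ r, (0, q) ∈ B := fun q hq => ⟨Metric.mem_ball_self hr, hq⟩
  have hf0 : ∀ q, (0, q) ∈ B → f (0, q) = q := fun q hq => by
    simp only [f]; rw [hΦ0 _ (hKD (hball hq)).2]
  have hN0 : ∀ q, (0, q) ∈ N → (0, q) ∈ B := by
    intro q hz
    obtain ⟨q', h1, h2, h3⟩ := hNB _ _ hz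
    rw [hf0 q' h1] at h3
    exact h3 ▸ h1
  have hBN0 : ∀ q, (0, q) ∈ B → (0, q) ∈ N := fun q hq => by
    have := (hBN _ hq).1
    rwa [hf0 q hq] at this
  have hA0 : ∀ q, (0, q) ∈ N → A (0, q) = P q := fun q hq => by
    have := hAf _ (hN0 q hq)
    rw [hf0 q (hN0 q hq)] at this
    rw [this, hΦ0 _ (hKD (hball (hN0 q hq))).2]
  -- the derivative of the transformed functions in the parameter
  have hvar : ∀ (L : ExtSpace →L[ℝ] ℂ) (q : Plane), (0, q) ∈ N →
      fderiv ℝ (fun z => L (A z)) (0, q) (1, 0) =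
        L (Q.1 (P q)) - fderiv ℝ (fun q => L (P q)) q (Q.1 (P q)).1.1 := by
    intro L q hq
    have hqB := hN0 q hq
    have hqU := (hKD (hball hqB)).2
    have hLA : ContDiffOn ℝ ∞ (fun z => L (A z)) N := L.contDiff.comp_contDiffOn hAs
    have hd := hLA.differentiableAt_of_isOpen hN hq
    have hcurve : HasDerivAt (fun ε => Φ ε (P q)) (Q.1 (P q)) 0 := by
      have := hΦ' 0 h0 _ hqU
      rwa [hΦ0 _ hqU] at this
    have hbase : HasDerivAt (fun ε => f (ε, q)) (Q.1 (P q)).1.1 0 :=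
      (ContinuousLinearMap.fst ℝ Plane ℂ).hasFDerivAt.comp_hasDerivAt (0 : ℝ)
        ((ContinuousLinearMap.fst ℝ Space ℂ).hasFDerivAt.comp_hasDerivAt (0 : ℝ) hcurve)
    have hcomp : HasDerivAt (fun ε => L (A (ε, f (ε, q))))
        (fderiv ℝ (fun z => L (A z)) (0, q) (1, (Q.1 (P q)).1.1)) 0 := by
      have h1 := (hasDerivAt_id (0 : ℝ)).prodMk hbase
      have hd' : HasFDerivAt (fun z => L (A z)) (fderiv ℝ (fun z => L (A z)) (0, q))
          (id (0 : ℝ), f (0, q)) := by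
        rw [hf0 q hqB]; exact hd.hasFDerivAt
      exact hd'.comp_hasDerivAt (0 : ℝ) h1
    have hL : HasDerivAt (fun ε => L (A (ε, f (ε, q)))) (L (Q.1 (P q))) 0 := by
      refine (L.hasFDerivAt.comp_hasDerivAt (0 : ℝ) hcurve).congr_of_eventuallyEq ?_
      filter_upwards [Metric.ball_mem_nhds (0 : ℝ) hr] with ε hε
      rw [hAf (ε, q) ⟨hε, hqB.2⟩]
      rfl
    have e1 := hcomp.unique hL
    have e2 : ((1, (Q.1 (P q)).1.1) : ℝ × Plane) = (1, 0) + (0, (Q.1 (P q)).1.1) := by simp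
    rw [e2, map_add, ← fderiv_slice hd] at e1
    have e3 : (fun q => L (A (0, q))) =ᶠ[𝓝 q] fun q => L (P q) := by
      filter_upwards [(Continuous.prodMk_right (0 : ℝ)).continuousAt.eventually
        (hN.mem_nhds hq)] with q' hq'
      rw [hA0 q' hq']
    rw [e3.fderiv_eq] at e1
    rw [← e1, add_sub_cancel_right]
  let Lψ : ExtSpace →L[ℝ] ℂ := (ContinuousLinearMap.snd ℝ Plane ℂ).comp
    (ContinuousLinearMap.fst ℝ Space ℂ)
  let LV : ExtSpace →L[ℝ] ℂ := ContinuousLinearMap.snd ℝ Space ℂ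
  have hGs : ContDiffOn ℝ ∞ (fun z => Lψ (A z)) N := Lψ.contDiff.comp_contDiffOn hAs
  have hHs : ContDiffOn ℝ ∞ (fun z => LV (A z)) N := LV.contDiff.comp_contDiffOn hAs
  have hq₀N : (0, q₀) ∈ N := hBN0 _ (hq0 _ (Metric.mem_ball_self hr))
  have hsol : ∀ ε q, (ε, q) ∈ N → residual (LV (A (ε, q))) (fun q => Lψ (A (ε, q))) q = 0 := by
    intro ε q hz
    obtain ⟨q₁, hq₁B, -, -⟩ := hNB _ _ hz
    have hε : ε ∈ Ioo (-δ) δ := (hKD (hball hq₁B)).1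
    have hεr : ε ∈ Metric.ball (0 : ℝ) r := hq₁B.1
    obtain ⟨W', V', hW', hV', h1, h2⟩ := (hE ε hε).maps_class univ V isOpen_univ hV.contDiffOn
    let O' : Set Plane := {q | (ε, q) ∈ N}
    have hO' : IsOpen O' := hN.preimage (Continuous.prodMk_right ε)
    have hval : ∀ q' ∈ O', ∃ q₁ ∈ Metric.ball q₀ r, (ε, q₁) ∈ B ∧ f (ε, q₁) = q' ∧
        A (ε, q') = Φ ε (P q₁) ∧ q' ∈ W' ∧ V' q' = LV (A (ε, q')) := by
      intro q' hq'
      obtain ⟨q₁, hB₁, -, rfl⟩ := hNB _ _ hq'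
      have hc := h1 q₁ (u q₁) trivial (hKD (hball hB₁)).2
      have hAe := hAf _ hB₁
      exact ⟨q₁, hB₁.2, hB₁, rfl, hAe, hc.1, by simp only [LV]; rw [hAe]; exact hc.2⟩
    have hmain := h2 (Metric.ball q₀ r) O' u (fun q => Lψ (A (ε, q))) Metric.isOpen_ball hO'
      (subset_univ _) (fun q' hq' => by obtain ⟨_, _, _, _, _, h, _⟩ := hval q' hq'; exact h)
      hu.contDiffOn
      (hGs.comp (contDiff_prodMk_right ε).contDiffOn fun _ h => h)
      (fun q hq => (hKD (hball (hq0 q hq))).2) ?_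
    · have hs := (solves_iff_residual (hu.contDiffOn (s := Metric.ball q₀ r))
        Metric.isOpen_ball).2 (fun q _ => hres q)
      have hs' := (solves_iff_residual
        (hGs.comp (contDiff_prodMk_right ε).contDiffOn fun _ h => h) hO').1 (hmain.1 hs)
      obtain ⟨_, _, _, _, _, _, hVe⟩ := hval q hz
      rw [← hVe]
      exact hs' q hz
    · apply Subset.antisymm
      · rintro _ ⟨q₁, hq₁, rfl⟩
        have hB₁ : (ε, q₁) ∈ B := ⟨hεr, hq₁⟩
        have hn := (hBN _ hB₁).1
        refine ⟨f (ε, q₁), hn, ?_⟩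
        obtain ⟨_, _, _, _, _, _, hVe⟩ := hval _ hn
        simp only
        rw [hVe, hAf _ hB₁]
        rfl
      · rintro _ ⟨q', hq', rfl⟩
        obtain ⟨q₁, hq₁, -, hfe, hAe, -, hVe⟩ := hval q' hq'
        refine ⟨q₁, hq₁, ?_⟩
        simp only
        rw [hVe, hAe, ← hfe]
        rfl
  have := residual_variation hN hGs hHs hq₀N hsol (w := w)
    (fun q hq => (hvar Lψ q hq).trans (hw q).symm)
  rw [hvar LV q₀ hq₀N, hA0 q₀ hq₀N] at this
  have ek : k q₀ = LV (Q.1 (P q₀)) - fderiv ℝ (fun q => LV (P q)) q₀ (Q.1 (P q₀)).1.1 := hk q₀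
  rw [← ek] at this
  exact this

end Linearization

section Jets

open Filter Topology

/-- The derivative in `t`. -/
noncomputable def dt (f : Plane → ℂ) (q : Plane) : ℂ := fderiv ℝ f q (1, 0)

/-- The derivative in `x`. -/
noncomputable def dx (f : Plane → ℂ) (q : Plane) : ℂ := fderiv ℝ f q (0, 1)

theorem contDiff_dt {f : Plane → ℂ} (hf : ContDiff ℝ ∞ f) : ContDiff ℝ ∞ (dt f) :=
  (hf.fderiv_right (m := ∞) (by simp)).clm_apply contDiff_const

theorem contDiff_dx {f : Plane → ℂ} (hf : ContDiff ℝ ∞ f) : ContDiff ℝ ∞ (dx f) :=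
  (hf.fderiv_right (m := ∞) (by simp)).clm_apply contDiff_const

theorem dt_dx {f : Plane → ℂ} (hf : ContDiff ℝ ∞ f) : dt (dx f) = dx (dt f) :=
  funext fun _ => fderiv_fderiv_comm hf.contDiffAt _ _

theorem _root_.ContDiff.hasFDerivAt_infty {E F : Type*} [NormedAddCommGroup E] [NormedSpace ℝ E]
    [NormedAddCommGroup F] [NormedSpace ℝ F] {f : E → F} (hf : ContDiff ℝ ∞ f) (q : E) :
    HasFDerivAt f (fderiv ℝ f q) q :=
  (hf.differentiable (by simp) q).hasFDerivAt

section Rules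

variable {f g : Plane → ℂ} (hf : ContDiff ℝ ∞ f) (hg : ContDiff ℝ ∞ g)
include hf

theorem dt_conj (q : Plane) :
    dt (fun q => (starRingEnd ℂ) (f q)) q = (starRingEnd ℂ) (dt f q) := by
  have h := (Complex.conjCLE.toContinuousLinearMap.hasFDerivAt).comp q (hf.hasFDerivAt_infty q)
  exact congrArg (fun L => L (1, 0)) h.fderiv

theorem dx_conj (q : Plane) :
    dx (fun q => (starRingEnd ℂ) (f q)) q = (starRingEnd ℂ) (dx f q) := by
  have h := (Complex.conjCLE.toContinuousLinearMap.hasFDerivAt).comp q (hf.hasFDerivAt_infty q)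
  exact congrArg (fun L => L (0, 1)) h.fderiv

theorem dt_const_mul (c : ℂ) (q : Plane) : dt (fun q => c * f q) q = c * dt f q :=
  congrArg (fun L => L (1, 0)) ((hf.hasFDerivAt_infty q).const_mul c).fderiv

theorem dx_const_mul (c : ℂ) (q : Plane) : dx (fun q => c * f q) q = c * dx f q :=
  congrArg (fun L => L (0, 1)) ((hf.hasFDerivAt_infty q).const_mul c).fderiv

theorem dt_exp (q : Plane) : dt (fun q => Complex.exp (f q)) q = Complex.exp (f q) * dt f q :=
  congrArg (fun L => L (1, 0)) ((hf.hasFDerivAt_infty q).cexp).fderiv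

theorem dx_exp (q : Plane) : dx (fun q => Complex.exp (f q)) q = Complex.exp (f q) * dx f q :=
  congrArg (fun L => L (0, 1)) ((hf.hasFDerivAt_infty q).cexp).fderiv

include hg

theorem dt_add (q : Plane) : dt (fun q => f q + g q) q = dt f q + dt g q :=
  congrArg (fun L => L (1, 0)) ((hf.hasFDerivAt_infty q).add (hg.hasFDerivAt_infty q)).fderiv

theorem dx_add (q : Plane) : dx (fun q => f q + g q) q = dx f q + dx g q :=
  congrArg (fun L => L (0, 1)) ((hf.hasFDerivAt_infty q).add (hg.hasFDerivAt_infty q)).fderiv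

theorem dt_sub (q : Plane) : dt (fun q => f q - g q) q = dt f q - dt g q :=
  congrArg (fun L => L (1, 0)) ((hf.hasFDerivAt_infty q).sub (hg.hasFDerivAt_infty q)).fderiv

theorem dx_sub (q : Plane) : dx (fun q => f q - g q) q = dx f q - dx g q :=
  congrArg (fun L => L (0, 1)) ((hf.hasFDerivAt_infty q).sub (hg.hasFDerivAt_infty q)).fderiv

theorem dt_mul (q : Plane) : dt (fun q => f q * g q) q = dt f q * g q + f q * dt g q := by
  have := congrArg (fun L => L (1, 0))
    ((hf.hasFDerivAt_infty q).mul (hg.hasFDerivAt_infty q)).fderiv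
  refine this.trans ?_
  simp only [dt, add_apply, smul_apply, smul_eq_mul]
  ring

theorem dx_mul (q : Plane) : dx (fun q => f q * g q) q = dx f q * g q + f q * dx g q := by
  have := congrArg (fun L => L (0, 1))
    ((hf.hasFDerivAt_infty q).mul (hg.hasFDerivAt_infty q)).fderiv
  refine this.trans ?_
  simp only [dx, add_apply, smul_apply, smul_eq_mul]
  ring

end Rules

/-- There are solutions of equations of the class with any prescribed jet. -/
theorem exists_solution_with_jet (q₀ : Plane) {u₀ : ℂ} (hu₀ : u₀ ≠ 0) (ut ux uxx utx : ℂ) :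
    ∃ u V : Plane → ℂ, ContDiff ℝ ∞ u ∧ ContDiff ℝ ∞ V ∧ (∀ q, residual (V q) u q = 0) ∧
      u q₀ = u₀ ∧ dt u q₀ = ut ∧ dx u q₀ = ux ∧ dx (dx u) q₀ = uxx ∧ dx (dt u) q₀ = utx := by
  let c₀ := Complex.log u₀
  let c₁ := ut / u₀
  let c₂ := ux / u₀
  let c₃ := uxx / u₀ - c₂ ^ 2
  let c₄ := utx / u₀ - c₁ * c₂
  let T : Plane → ℂ := fun q => ((q.1 - q₀.1 : ℝ) : ℂ)
  let X : Plane → ℂ := fun q => ((q.2 - q₀.2 : ℝ) : ℂ)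
  have hT : ContDiff ℝ ∞ T := contDiff_ofReal (by fun_prop)
  have hX : ContDiff ℝ ∞ X := contDiff_ofReal (by fun_prop)
  let h : Plane → ℂ := fun q => c₀ + c₁ * T q + c₂ * X q + c₃ / 2 * X q ^ 2 + c₄ * T q * X q
  have hh : ContDiff ℝ ∞ h := by fun_prop
  have hTd : ∀ t : ℝ, HasDerivAt (fun t : ℝ => ((t - q₀.1 : ℝ) : ℂ)) 1 t := fun t => by
    simpa using ((hasDerivAt_id t).sub_const q₀.1).ofReal_comp
  have hXd : ∀ x : ℝ, HasDerivAt (fun x : ℝ => ((x - q₀.2 : ℝ) : ℂ)) 1 x := fun x => by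
    simpa using ((hasDerivAt_id x).sub_const q₀.2).ofReal_comp
  have dth : dt h = fun q => c₁ + c₄ * X q := by
    funext q
    refine (hasDerivAt_slice_time (hh.differentiable (by simp) q)).unique ?_
    refine ((((((hTd q.1).const_mul c₁).const_add c₀).add_const (c₂ * X q)).add_const
      (c₃ / 2 * X q ^ 2)).add (((hTd q.1).const_mul c₄).mul_const (X q))).congr_deriv ?_
    ring
  have dxh : dx h = fun q => c₂ + c₃ * X q + c₄ * T q := by
    funext q
    refine (hasDerivAt_slice_space (hh.differentiable (by simp) q)).unique ?_
    refine (((((hXd q.2).const_mul c₂).const_add (c₀ + c₁ * T q)).add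
      (((hXd q.2).fun_pow 2).const_mul (c₃ / 2))).add
        ((hXd q.2).const_mul (c₄ * T q))).congr_deriv ?_
    simp only [X]
    push_cast
    ring
  have hdth := contDiff_dt hh
  have hdxh := contDiff_dx hh
  have dxdxh : ∀ q, dx (dx h) q = c₃ := by
    intro q
    refine (hasDerivAt_slice_space (hdxh.differentiable (by simp) q)).unique ?_
    rw [dxh]
    exact ((((hXd q.2).const_mul c₃).const_add c₂).add_const (c₄ * T q)).congr_deriv (by ring)
  have dxdth : ∀ q, dx (dt h) q = c₄ := by
    intro q
    refine (hasDerivAt_slice_space (hdth.differentiable (by simp) q)).unique ?_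
    rw [dth]
    exact (((hXd q.2).const_mul c₄).const_add c₁).congr_deriv (by ring)
  let u : Plane → ℂ := fun q => Complex.exp (h q)
  have hu : ContDiff ℝ ∞ u := hh.cexp
  have hut : dt u = fun q => u q * dt h q := funext (dt_exp hh)
  have hux : dx u = fun q => u q * dx h q := funext (dx_exp hh)
  let V : Plane → ℂ := fun q =>
    -(Complex.I * dt u q + dx (dx u) q + u q ^ 2 * (starRingEnd ℂ) (u q)) * Complex.exp (-h q)
  have hV : ContDiff ℝ ∞ V := by
    have h1 := contDiff_dt hu
    have h2 := contDiff_dx (contDiff_dx hu)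
    have h3 : ContDiff ℝ ∞ fun q => (starRingEnd ℂ) (u q) :=
      Complex.conjCLE.toContinuousLinearMap.contDiff.comp hu
    have h4 : ContDiff ℝ ∞ fun q => Complex.exp (-h q) := hh.neg.cexp
    fun_prop
  have hX0 : X q₀ = 0 := by simp [X]
  have hT0 : T q₀ = 0 := by simp [T]
  have e0 : u q₀ = u₀ := by
    simp only [u, h, hX0, hT0]
    simp [c₀, Complex.exp_log hu₀]
  refine ⟨u, V, hu, hV, fun q => ?_, e0, ?_, ?_, ?_, ?_⟩
  · have e : Complex.exp (-h q) * u q = 1 := by simp [u, ← Complex.exp_add]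
    have : residual (V q) u q = (Complex.I * dt u q + dx (dx u) q
      + u q ^ 2 * (starRingEnd ℂ) (u q)) + V q * u q := rfl
    rw [this]
    linear_combination -(Complex.I * dt u q + dx (dx u) q + u q ^ 2 * (starRingEnd ℂ) (u q)) * e
  · rw [hut, dth]
    simp only [hX0, e0, c₁]
    field_simp
    ring
  · rw [hux, dxh]
    simp only [hX0, hT0, e0, c₂]
    field_simp
    ring
  · rw [hux, dx_mul hu hdxh, dxdxh, hux, dxh]
    simp only [hX0, hT0, e0, c₃, c₂]
    field_simp
    ring
  · rw [hut, dx_mul hu hdth, dxdth, hux, dxh, dth]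
    simp only [hX0, hT0, e0, c₄, c₁, c₂]
    field_simp
    ring

theorem IsEquivGenerator.exists_components {Q : SmoothField ExtSpace} (hQ : IsEquivGenerator Q) :
    ∃ (τ y : Plane → ℝ) (η : Space → ℂ) (θ : Plane × ℂ → ℂ), ContDiff ℝ ∞ τ ∧ ContDiff ℝ ∞ y ∧
      ContDiff ℝ ∞ η ∧ ContDiff ℝ ∞ θ ∧
      ∀ q ψ v, Q.1 ((q, ψ), v) = (((τ q, y q), η (q, ψ)), θ (q, v)) := by
  have h := Q.contDiff
  refine ⟨fun q => (Q.1 ((q, 0), 0)).1.1.1, fun q => (Q.1 ((q, 0), 0)).1.1.2,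
    fun z => (Q.1 (z, 0)).1.2, fun z => (Q.1 ((z.1, 0), z.2)).2, by fun_prop, by fun_prop,
    by fun_prop, by fun_prop, fun q ψ v => ?_⟩
  have h1 := hQ.fst_eq (q, ψ) v 0
  have h2 := Prod.ext_iff.1 (hQ.base_snd_eq q ψ 0 v)
  have h3 := Prod.ext_iff.1 (hQ.base_snd_eq q ψ 0 0)
  refine Prod.ext (Prod.ext ?_ ?_) h2.2
  · rw [h1]
    exact h3.1
  · rw [h1]

/-- The linearized equation in terms of jets. -/
theorem IsEquivGenerator.jet_identity {Q : SmoothField ExtSpace} (hQ : IsEquivGenerator Q)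
    {τ y : Plane → ℝ} {η : Space → ℂ} {θ : Plane × ℂ → ℂ} (hτ : ContDiff ℝ ∞ τ)
    (hy : ContDiff ℝ ∞ y) (hη : ContDiff ℝ ∞ η)
    (hform : ∀ q ψ v, Q.1 ((q, ψ), v) = (((τ q, y q), η (q, ψ)), θ (q, v)))
    (q : Plane) {u₀ ut ux uxx utx V₀ : ℂ} (hu₀ : u₀ ≠ 0)
    (hV₀ : Complex.I * ut + uxx + u₀ ^ 2 * (starRingEnd ℂ) u₀ + V₀ * u₀ = 0) :
    Complex.I * (fderiv ℝ η (q, u₀) ((1, 0), ut) - dt (fun q => (τ q : ℂ)) q * ut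
        - dt (fun q => (y q : ℂ)) q * ux)
      + fderiv ℝ (fderiv ℝ η) (q, u₀) ((0, 1), ux) ((0, 1), ux) + fderiv ℝ η (q, u₀) (0, uxx)
      - dx (dx (fun q => (τ q : ℂ))) q * ut - 2 * dx (fun q => (τ q : ℂ)) q * utx
      - dx (dx (fun q => (y q : ℂ))) q * ux - 2 * dx (fun q => (y q : ℂ)) q * uxx
      + 2 * u₀ * (starRingEnd ℂ) u₀ * η (q, u₀) + u₀ ^ 2 * (starRingEnd ℂ) (η (q, u₀))
      + V₀ * η (q, u₀) + θ (q, V₀) * u₀ = 0 := by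
  obtain ⟨u, V, hu, hV, hres, e0, e1, e2, e3, e4⟩ :=
    exists_solution_with_jet q hu₀ ut ux uxx utx
  let τ' : Plane → ℂ := fun q => (τ q : ℂ)
  let y' : Plane → ℂ := fun q => (y q : ℂ)
  have hτ' : ContDiff ℝ ∞ τ' := contDiff_ofReal hτ
  have hy' : ContDiff ℝ ∞ y' := contDiff_ofReal hy
  let g : Plane → ℂ := fun q => η (q, u q)
  have hg : ContDiff ℝ ∞ g := by fun_prop
  have hut := contDiff_dt hu
  have hux := contDiff_dx hu
  have dir : ∀ (f : Plane → ℂ) (q : Plane), fderiv ℝ f q (τ q, y q) = τ' q * dt f q + y' q * dx f q := by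
    intro f q
    have : ((τ q, y q) : ℝ × ℝ) = τ q • (1, 0) + y q • (0, 1) := by simp
    rw [this, map_add, map_smul, map_smul]
    simp [Complex.real_smul, τ', y', dt, dx]
  let w : Plane → ℂ := fun q => g q - (τ' q * dt u q + y' q * dx u q)
  have lin := hQ.linearized hu hV hres (w := w)
    (k := fun q => θ (q, V q) - (τ' q * dt V q + y' q * dx V q))
    (fun q => by rw [hform, dir]) (fun q => by rw [hform, dir]) q
  -- derivatives of `g`
  have hgt : dt g q = fderiv ℝ η (q, u₀) ((1, 0), ut) := by
    have h1 : HasFDerivAt g _ q :=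
      (hη.hasFDerivAt_infty (q, u q)).comp q ((hasFDerivAt_id q).prodMk (hu.hasFDerivAt_infty q))
    rw [← e0, ← e1]
    exact congrArg (fun L => L (1, 0)) h1.fderiv
  have hgx : dx g = fun q => fderiv ℝ η (q, u q) ((0, 1), dx u q) := by
    funext q
    have h1 : HasFDerivAt g _ q :=
      (hη.hasFDerivAt_infty (q, u q)).comp q ((hasFDerivAt_id q).prodMk (hu.hasFDerivAt_infty q))
    exact congrArg (fun L => L (0, 1)) h1.fderiv
  have hgxx : dx (dx g) q = fderiv ℝ (fderiv ℝ η) (q, u₀) ((0, 1), ux) ((0, 1), ux)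
      + fderiv ℝ η (q, u₀) (0, uxx) := by
    rw [hgx, ← e0, ← e2, ← e3]
    have hη' : ContDiff ℝ ∞ (fderiv ℝ η) := hη.fderiv_right (m := ∞) (by simp)
    have h1 := (hη'.hasFDerivAt_infty (q, u q)).comp q
      ((hasFDerivAt_id q).prodMk (hu.hasFDerivAt_infty q))
    have h2 := (hasFDerivAt_const ((0, 1) : Plane) q).prodMk (hux.hasFDerivAt_infty q)
    have h3 := h1.clm_apply h2
    refine (congrArg (fun L => L (0, 1)) h3.fderiv).trans ?_
    simp [dx, add_comm]
  -- derivatives of `w`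
  have p1 := hτ'.mul hut
  have p2 := hy'.mul hux
  have hwt : dt w q = dt g q - ((dt τ' q * dt u q + τ' q * dt (dt u) q)
      + (dt y' q * dx u q + y' q * dt (dx u) q)) := by
    rw [dt_sub hg (p1.add p2), dt_add p1 p2, dt_mul hτ' hut, dt_mul hy' hux]
  have hwx : dx w = fun q => dx g q - ((dx τ' q * dt u q + τ' q * dx (dt u) q)
      + (dx y' q * dx u q + y' q * dx (dx u) q)) := by
    funext q
    rw [dx_sub hg (p1.add p2), dx_add p1 p2, dx_mul hτ' hut, dx_mul hy' hux]
  have hwxx : dx (dx w) q = dx (dx g) q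
      - ((dx (dx τ') q * dt u q + dx τ' q * dx (dt u) q
        + (dx τ' q * dx (dt u) q + τ' q * dx (dx (dt u)) q))
      + (dx (dx y') q * dx u q + dx y' q * dx (dx u) q
        + (dx y' q * dx (dx u) q + y' q * dx (dx (dx u)) q))) := by
    have hτx := contDiff_dx hτ'
    have hyx := contDiff_dx hy'
    have hutx := contDiff_dx hut
    have huxx := contDiff_dx hux
    have a1 := hτx.mul hut
    have a2 := hτ'.mul hutx
    have a3 := hyx.mul hux
    have a4 := hy'.mul huxx
    rw [hwx, dx_sub (contDiff_dx hg) ((a1.add a2).add (a3.add a4)), dx_add (a1.add a2) (a3.add a4),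
      dx_add a1 a2, dx_add a3 a4, dx_mul hτx hut, dx_mul hτ' hutx, dx_mul hyx hux, dx_mul hy' huxx]
  -- derivatives of the equation
  have hcu : ContDiff ℝ ∞ fun q => (starRingEnd ℂ) (u q) :=
    Complex.conjCLE.toContinuousLinearMap.contDiff.comp hu
  have hR : (fun q => Complex.I * dt u q + dx (dx u) q + (u q * u q) * (starRingEnd ℂ) (u q)
      + V q * u q) = fun _ => 0 := by
    funext q
    rw [← sq]
    exact hres q
  have b1 : ContDiff ℝ ∞ fun q => Complex.I * dt u q := contDiff_const.mul hut
  have b2 := contDiff_dx hux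
  have b3 := (hu.mul hu).mul hcu
  have b4 := hV.mul hu
  have hRt : Complex.I * dt (dt u) q + dt (dx (dx u)) q
      + ((dt u q * u q + u q * dt u q) * (starRingEnd ℂ) (u q)
        + (u q * u q) * (starRingEnd ℂ) (dt u q)) + (dt V q * u q + V q * dt u q) = 0 := by
    rw [← dt_conj hu, ← dt_mul hV hu, ← dt_mul hu hu, ← dt_mul (hu.mul hu) hcu, ← dt_const_mul hut,
      ← dt_add b1 b2, ← dt_add (b1.add b2) b3, ← dt_add ((b1.add b2).add b3) b4, hR]
    simp [dt]
  have hRx : Complex.I * dx (dt u) q + dx (dx (dx u)) q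
      + ((dx u q * u q + u q * dx u q) * (starRingEnd ℂ) (u q)
        + (u q * u q) * (starRingEnd ℂ) (dx u q)) + (dx V q * u q + V q * dx u q) = 0 := by
    rw [← dx_conj hu, ← dx_mul hV hu, ← dx_mul hu hu, ← dx_mul (hu.mul hu) hcu, ← dx_const_mul hut,
      ← dx_add b1 b2, ← dx_add (b1.add b2) b3, ← dx_add ((b1.add b2).add b3) b4, hR]
    simp [dx]
  have hV' : V q = V₀ := by
    have h1 := congrFun hR q
    simp only [e0, e1, e3] at h1
    exact mul_right_cancel₀ hu₀ (by linear_combination h1 - hV₀)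
  have hcomm : dt (dx (dx u)) q = dx (dx (dt u)) q := by rw [dt_dx hux, dt_dx hu]
  have cτ : (starRingEnd ℂ) (τ' q) = τ' q := Complex.conj_ofReal _
  have cy : (starRingEnd ℂ) (y' q) = y' q := Complex.conj_ofReal _
  have lin' : Complex.I * dt w q + dx (dx w) q
      + 2 * u q * (starRingEnd ℂ) (u q) * (η (q, u q) - (τ' q * dt u q + y' q * dx u q))
      + u q ^ 2 * (starRingEnd ℂ) (η (q, u q) - (τ' q * dt u q + y' q * dx u q))
      + V q * (η (q, u q) - (τ' q * dt u q + y' q * dx u q))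
      + (θ (q, V q) - (τ' q * dt V q + y' q * dx V q)) * u q = 0 := lin
  rw [hwt, hwxx, dt_dx hu, hgt, hgxx] at lin'
  rw [hcomm] at hRt
  simp only [map_sub, map_add, map_mul, cτ, cy, e0, e1, e2, e3, e4, hV'] at lin' hRt hRx
  linear_combination lin' + τ' q * hRt + y' q * hRx

end Jets

section Splitting

open Filter Topology

/-- A smooth function on `Plane × ℂ` whose second derivative vanishes along the fibres and whose
first derivative is complex linear along the fibres is affine in the fibre variable. -/
theorem affine_of_fiber {η : Space → ℂ} (hη : ContDiff ℝ ∞ η) (q : Plane)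
    (h2 : ∀ ψ : ℂ, ψ ≠ 0 → ∀ w, fderiv ℝ (fderiv ℝ η) (q, ψ) (0, w) (0, w) = 0)
    (h1 : ∀ ψ : ℂ, ψ ≠ 0 →
      fderiv ℝ η (q, ψ) (0, Complex.I) = Complex.I * fderiv ℝ η (q, ψ) (0, 1)) (ψ : ℂ) :
    η (q, ψ) = η (q, 0) + fderiv ℝ η (q, 0) (0, 1) * ψ := by
  have hη' : ContDiff ℝ ∞ (fderiv ℝ η) := hη.fderiv_right (m := ∞) (by simp)
  have hη'' : ContDiff ℝ ∞ (fderiv ℝ (fderiv ℝ η)) := hη'.fderiv_right (m := ∞) (by simp)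
  have dense : Dense {ψ : ℂ | ψ ≠ 0} := dense_compl_singleton 0
  have h2' : ∀ ψ w : ℂ, fderiv ℝ (fderiv ℝ η) (q, ψ) (0, w) (0, w) = 0 := by
    intro ψ w
    have hc : Continuous fun ψ : ℂ => fderiv ℝ (fderiv ℝ η) (q, ψ) (0, w) (0, w) := by
      have := hη''.continuous
      fun_prop
    exact congrFun (hc.ext_on dense continuous_const fun ψ hψ => h2 ψ hψ w) ψ
  have h1' : fderiv ℝ η (q, 0) (0, Complex.I) = Complex.I * fderiv ℝ η (q, 0) (0, 1) := by
    have := hη'.continuous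
    have hc : Continuous fun ψ : ℂ => fderiv ℝ η (q, ψ) (0, Complex.I) := by fun_prop
    have hc' : Continuous fun ψ : ℂ => Complex.I * fderiv ℝ η (q, ψ) (0, 1) := by fun_prop
    exact congrFun (hc.ext_on dense hc' fun ψ hψ => h1 ψ hψ) 0
  have line : ∀ s : ℝ, HasDerivAt (fun s : ℝ => ((q, (s : ℂ) * ψ) : Space)) (0, ψ) s := fun s => by
    have := ((hasDerivAt_id s).ofReal_comp.mul_const ψ)
    simpa using (hasDerivAt_const s q).prodMk this
  have d1 : ∀ s : ℝ, HasDerivAt (fun s : ℝ => η (q, (s : ℂ) * ψ))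
      (fderiv ℝ η (q, (s : ℂ) * ψ) (0, ψ)) s := fun s =>
    (hη.hasFDerivAt_infty _).comp_hasDerivAt s (line s)
  have d2 : ∀ s : ℝ, HasDerivAt (fun s : ℝ => fderiv ℝ η (q, (s : ℂ) * ψ) (0, ψ)) 0 s := fun s => by
    have h := ((hη'.hasFDerivAt_infty _).comp_hasDerivAt s (line s)).clm_apply
      (hasDerivAt_const s ((0, ψ) : Space))
    refine h.congr_deriv ?_
    simp [h2']
  have cst : ∀ s : ℝ, fderiv ℝ η (q, (s : ℂ) * ψ) (0, ψ) = fderiv ℝ η (q, 0) (0, ψ) := fun s => by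
    have := is_const_of_deriv_eq_zero (fun s => (d2 s).differentiableAt) (fun s => (d2 s).deriv) s 0
    simpa using this
  have d3 : ∀ s : ℝ, HasDerivAt
      (fun s : ℝ => η (q, (s : ℂ) * ψ) - (s : ℂ) * fderiv ℝ η (q, 0) (0, ψ)) 0 s := fun s => by
    refine ((d1 s).sub ((hasDerivAt_id s).ofReal_comp.mul_const _)).congr_deriv ?_
    rw [cst]; simp
  have e := is_const_of_deriv_eq_zero (fun s => (d3 s).differentiableAt) (fun s => (d3 s).deriv) 1 0
  have e' : fderiv ℝ η (q, 0) (0, ψ) = fderiv ℝ η (q, 0) (0, 1) * ψ := by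
    have : ((0, ψ) : Space) = ψ.re • (0, 1) + ψ.im • (0, Complex.I) := by
      refine Prod.ext (by simp) ?_
      simp [Complex.re_add_im]
    rw [this, map_add, map_smul, map_smul, h1', Complex.real_smul, Complex.real_smul]
    linear_combination fderiv ℝ η (q, 0) (0, 1) * Complex.re_add_im ψ
  simp only [Complex.ofReal_one, one_mul, Complex.ofReal_zero, zero_mul, sub_zero] at e
  rw [← e']
  linear_combination e

variable {τ y : Plane → ℝ} {η : Space → ℂ} {θ : Plane × ℂ → ℂ}

/-- The linearized equation, for functions `τ`, `y`, `η`, `θ`. -/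
def JetIdentity (τ y : Plane → ℝ) (η : Space → ℂ) (θ : Plane × ℂ → ℂ) : Prop :=
  ∀ (q : Plane) (u₀ ut ux uxx utx V₀ : ℂ), u₀ ≠ 0 →
    Complex.I * ut + uxx + u₀ ^ 2 * (starRingEnd ℂ) u₀ + V₀ * u₀ = 0 →
    Complex.I * (fderiv ℝ η (q, u₀) ((1, 0), ut) - dt (fun q => (τ q : ℂ)) q * ut
        - dt (fun q => (y q : ℂ)) q * ux)
      + fderiv ℝ (fderiv ℝ η) (q, u₀) ((0, 1), ux) ((0, 1), ux) + fderiv ℝ η (q, u₀) (0, uxx)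
      - dx (dx (fun q => (τ q : ℂ))) q * ut - 2 * dx (fun q => (τ q : ℂ)) q * utx
      - dx (dx (fun q => (y q : ℂ))) q * ux - 2 * dx (fun q => (y q : ℂ)) q * uxx
      + 2 * u₀ * (starRingEnd ℂ) u₀ * η (q, u₀) + u₀ ^ 2 * (starRingEnd ℂ) (η (q, u₀))
      + V₀ * η (q, u₀) + θ (q, V₀) * u₀ = 0

theorem JetIdentity.dx_time (J : JetIdentity τ y η θ) : dx (fun q => (τ q : ℂ)) = fun _ => 0 := by
  funext q
  have h0 := J q 1 0 0 0 0 (-1) one_ne_zero (by simp)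
  have h1 := J q 1 0 0 0 1 (-1) one_ne_zero (by simp)
  linear_combination (h0 - h1) / 2

theorem JetIdentity.dx_dx_time (J : JetIdentity τ y η θ) (q : Plane) :
    dx (dx (fun q => (τ q : ℂ))) q = 0 := by
  rw [J.dx_time]
  simp [dx]

theorem JetIdentity.fiber_second (J : JetIdentity τ y η θ) (q : Plane) {ψ : ℂ} (hψ : ψ ≠ 0) (w : ℂ) :
    fderiv ℝ (fderiv ℝ η) (q, ψ) (0, w) (0, w) = 0 := by
  have hc : Complex.I * 0 + 0 + ψ ^ 2 * (starRingEnd ℂ) ψ + -(ψ * (starRingEnd ℂ) ψ) * ψ = 0 := by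
    ring
  have h0 := J q ψ 0 0 0 0 _ hψ hc
  have h1 := J q ψ 0 w 0 0 _ hψ hc
  have h2 := J q ψ 0 (-w) 0 0 _ hψ hc
  have e0 : (((0, 1), w) : Space) = ((0, 1), 0) + (0, w) := by simp
  have e1 : (((0, 1), -w) : Space) = ((0, 1), 0) - (0, w) := by simp
  rw [e0] at h1
  rw [e1] at h2
  simp only [map_add, map_sub, add_apply, sub_apply] at h1 h2
  linear_combination (h1 + h2) / 2 - h0

theorem JetIdentity.fiber_first (J : JetIdentity τ y η θ) (q : Plane) {ψ : ℂ} (hψ : ψ ≠ 0) :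
    fderiv ℝ η (q, ψ) (0, Complex.I) = Complex.I * fderiv ℝ η (q, ψ) (0, 1) := by
  have hI := Complex.I_mul_I
  have key : ∀ w : ℂ, Complex.I * fderiv ℝ η (q, ψ) (0, Complex.I * w) + fderiv ℝ η (q, ψ) (0, w)
      = (2 * dx (fun q => (y q : ℂ)) q - dt (fun q => (τ q : ℂ)) q) * w := by
    intro w
    have h0 := J q ψ 0 0 0 0 (-(ψ * (starRingEnd ℂ) ψ)) hψ (by ring)
    have h1 := J q ψ (Complex.I * w) 0 w 0 (-(ψ * (starRingEnd ℂ) ψ)) hψ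
      (by linear_combination w * hI)
    rw [J.dx_dx_time] at h0 h1
    have e0 : (((1, 0), Complex.I * w) : Space) = ((1, 0), 0) + (0, Complex.I * w) := by simp
    have e1 : ((0, 0) : Space) = 0 := rfl
    rw [e0] at h1
    rw [e1] at h0
    simp only [map_add, map_zero] at h0 h1
    linear_combination h1 - h0 + dt (fun q => (τ q : ℂ)) q * w * hI
  have k1 := key 1
  have k2 := key Complex.I
  have e : ((0, Complex.I * Complex.I) : Space) = -(0, 1) := by simp
  rw [e, map_neg] at k2
  rw [mul_one] at k1
  linear_combination (-Complex.I / 2) * k1 + k2 / 2 + (1 / 2) * fderiv ℝ η (q, ψ) (0, Complex.I) * hI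

theorem JetIdentity.exists_affine (J : JetIdentity τ y η θ) (hη : ContDiff ℝ ∞ η) :
    ∃ c a : Plane → ℂ, ContDiff ℝ ∞ c ∧ ContDiff ℝ ∞ a ∧ η = fun z => c z.1 + a z.1 * z.2 := by
  have hη' : ContDiff ℝ ∞ (fderiv ℝ η) := hη.fderiv_right (m := ∞) (by simp)
  refine ⟨fun q => η (q, 0), fun q => fderiv ℝ η (q, 0) (0, 1), by fun_prop, by fun_prop, ?_⟩
  funext ⟨q, ψ⟩
  exact affine_of_fiber hη q (fun ψ hψ w => J.fiber_second q hψ w) (fun ψ hψ => J.fiber_first q hψ) ψ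

theorem fderiv_affine {c a : Plane → ℂ} (hc : ContDiff ℝ ∞ c) (ha : ContDiff ℝ ∞ a)
    (z : Space) (v : Plane) (w : ℂ) :
    fderiv ℝ (fun z : Space => c z.1 + a z.1 * z.2) z (v, w)
      = fderiv ℝ c z.1 v + fderiv ℝ a z.1 v * z.2 + a z.1 * w := by
  have h1 := (hc.hasFDerivAt_infty z.1).comp z (hasFDerivAt_fst (𝕜 := ℝ) (p := z))
  have h2 := (ha.hasFDerivAt_infty z.1).comp z (hasFDerivAt_fst (𝕜 := ℝ) (p := z))
  refine (congrArg (fun L => L (v, w))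
    (h1.add (h2.mul (hasFDerivAt_snd (𝕜 := ℝ) (p := z)))).fderiv).trans ?_
  simp
  ring

/-- The determining equations of the symmetries. -/
structure DeterminingEquations (τ y : Plane → ℝ) (a : Plane → ℂ) (θ : Plane × ℂ → ℂ) : Prop where
  time : ∀ q, dx (fun q => (τ q : ℂ)) q = 0
  space : ∀ q, dt (fun q => (τ q : ℂ)) q = 2 * dx (fun q => (y q : ℂ)) q
  phase : ∀ q, 2 * dx a q
    = dx (dx (fun q => (y q : ℂ))) q + Complex.I * dt (fun q => (y q : ℂ)) q
  modulus : ∀ q, dt (fun q => (τ q : ℂ)) q + a q + (starRingEnd ℂ) (a q) = 0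
  potential : ∀ q v, θ (q, v)
    = -dt (fun q => (τ q : ℂ)) q * v - Complex.I * dt a q - dx (dx a) q

theorem JetIdentity.determining (J : JetIdentity τ y η θ) (hη : ContDiff ℝ ∞ η) :
    ∃ a : Plane → ℂ, ContDiff ℝ ∞ a ∧ (∀ q ψ, η (q, ψ) = a q * ψ) ∧
      DeterminingEquations τ y a θ := by
  obtain ⟨c, a, hc, ha, rfl⟩ := J.exists_affine hη
  have hI := Complex.I_mul_I
  have second : ∀ q u w, fderiv ℝ (fderiv ℝ fun z : Space => c z.1 + a z.1 * z.2) (q, u)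
      ((0, 1), w) ((0, 1), w) = dx (dx c) q + dx (dx a) q * u + 2 * dx a q * w := by
    intro q u w
    have hη' : ContDiff ℝ ∞ (fderiv ℝ fun z : Space => c z.1 + a z.1 * z.2) :=
      hη.fderiv_right (m := ∞) (by simp)
    have h1 := ((hη'.hasFDerivAt_infty (q, u)).clm_apply
      (hasFDerivAt_const (((0, 1), w) : Space) (q, u))).fderiv
    have h2 := congrArg (fun L => L (((0, 1), w) : Space)) h1
    simp only [fderiv_affine hc ha] at h2
    have h3 : ContDiff ℝ ∞ fun q => dx c q + a q * w :=
      (contDiff_dx hc).add (ha.mul contDiff_const)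
    have h4 := fderiv_affine h3 (contDiff_dx ha) (q, u) (0, 1) w
    have e : (fun z : Space => dx c z.1 + a z.1 * w + dx a z.1 * z.2)
        = fun z : Space => fderiv ℝ c z.1 (0, 1) + fderiv ℝ a z.1 (0, 1) * z.2 + a z.1 * w := by
      funext z; simp only [dx]; ring
    rw [e] at h4
    rw [h4] at h2
    have h5 : dx (fun q => dx c q + a q * w) q = dx (dx c) q + dx a q * w := by
      rw [dx_add (contDiff_dx hc) (ha.mul contDiff_const), dx_mul ha contDiff_const]
      simp [dx]
    change dx (fun q => dx c q + a q * w) q + dx (dx a) q * u + dx a q * w = _ at h2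
    rw [h5] at h2
    refine Eq.trans ?_ (h2.symm.trans ?_)
    · simp
    · ring
  have E : ∀ (q : Plane) (u ut ux uxx V : ℂ), u ≠ 0 →
      Complex.I * ut + uxx + u ^ 2 * (starRingEnd ℂ) u + V * u = 0 →
      Complex.I * (dt c q + dt a q * u + a q * ut - dt (fun q => (τ q : ℂ)) q * ut
        - dt (fun q => (y q : ℂ)) q * ux)
      + (dx (dx c) q + dx (dx a) q * u + 2 * dx a q * ux) + a q * uxx
      - dx (dx (fun q => (y q : ℂ))) q * ux - 2 * dx (fun q => (y q : ℂ)) q * uxx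
      + 2 * u * (starRingEnd ℂ) u * (c q + a q * u) + u ^ 2 * (starRingEnd ℂ) (c q + a q * u)
      + V * (c q + a q * u) + θ (q, V) * u = 0 := by
    intro q u ut ux uxx V hu h
    have h1 := J q u ut ux uxx 0 V hu h
    rw [second, fderiv_affine hc ha, fderiv_affine hc ha, J.dx_dx_time] at h1
    simp only [map_zero] at h1
    simp only [dt] at h1 ⊢
    linear_combination h1
  have conj2 : (starRingEnd ℂ) (2 : ℂ) = 2 := Complex.conj_ofNat 2
  have base : ∀ q (u V : ℂ), u ≠ 0 → Complex.I * (dt c q + dt a q * u)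
      - (a q - dt (fun q => (τ q : ℂ)) q) * (u ^ 2 * (starRingEnd ℂ) u + V * u)
      + (dx (dx c) q + dx (dx a) q * u) + 2 * u * (starRingEnd ℂ) u * (c q + a q * u)
      + u ^ 2 * (starRingEnd ℂ) (c q + a q * u) + V * (c q + a q * u) + θ (q, V) * u = 0 := by
    intro q u V hu
    have h1 := E q u (Complex.I * (u ^ 2 * (starRingEnd ℂ) u + V * u)) 0 0 V hu
      (by linear_combination (u ^ 2 * (starRingEnd ℂ) u + V * u) * hI)
    linear_combination h1 - (a q - dt (fun q => (τ q : ℂ)) q)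
      * (u ^ 2 * (starRingEnd ℂ) u + V * u) * hI
  have hc0 : ∀ q, c q = 0 := by
    intro q
    have h1 := base q 1 0 one_ne_zero
    have h2 := base q (-1) 0 (by simp)
    have h3 := base q 1 1 one_ne_zero
    have h4 := base q (-1) 1 (by simp)
    simp only [map_neg, map_one, map_add, map_mul] at h1 h2 h3 h4
    linear_combination (h3 + h4 - h1 - h2) / 2
  have hc' : c = fun _ => 0 := funext hc0
  subst hc'
  have mod : ∀ q, dt (fun q => (τ q : ℂ)) q + a q + (starRingEnd ℂ) (a q) = 0 := by
    intro q
    have h1 := base q 1 0 one_ne_zero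
    have h2 := base q (-1) 0 (by simp)
    have h3 := base q 2 0 two_ne_zero
    have h4 := base q (-2) 0 (by simp)
    simp only [map_neg, map_one, map_add, map_mul, conj2, map_zero] at h1 h2 h3 h4
    linear_combination (h3 - h4) / 12 - (h1 - h2) / 6
  refine ⟨a, ha, fun q ψ => by simp, congrFun J.dx_time, fun q => ?_, fun q => ?_, mod,
    fun q v => ?_⟩
  · have h1 := E q 1 (Complex.I * 1) 0 0 0 one_ne_zero (by simp)
    have h2 := E q 1 (Complex.I * 2) 0 1 0 one_ne_zero (by simp; linear_combination 2 * hI)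
    linear_combination h2 - h1 - (a q - dt (fun q => (τ q : ℂ)) q) * hI
  · have h1 := E q 1 (Complex.I * 1) 0 0 0 one_ne_zero (by simp)
    have h2 := E q 1 (Complex.I * 1) 1 0 0 one_ne_zero (by simp)
    linear_combination h2 - h1
  · have h1 := base q 1 v one_ne_zero
    have h2 := base q (-1) v (by simp)
    simp only [map_neg, map_one, map_add, map_mul, map_zero] at h1 h2
    linear_combination (h1 - h2) / 2 - mod q

end Splitting

section Integration

theorem eq_of_dx_eq {f g : Plane → ℂ} (hf : ContDiff ℝ ∞ f) (hg : ContDiff ℝ ∞ g)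
    (h : ∀ q, dx f q = dx g q) (h0 : ∀ t, f (t, 0) = g (t, 0)) : f = g := by
  funext ⟨t, x⟩
  have d : ∀ x : ℝ, HasDerivAt (fun x => f (t, x) - g (t, x)) 0 x := fun x =>
    ((hasDerivAt_slice_space (q := (t, x)) (hf.differentiable (by simp) _)).sub
      (hasDerivAt_slice_space (q := (t, x)) (hg.differentiable (by simp) _))).congr_deriv
        (sub_eq_zero.2 (h (t, x)))
  have := is_const_of_deriv_eq_zero (fun s => (d s).differentiableAt) (fun s => (d s).deriv) x 0
  simp only [h0, sub_self] at this
  exact sub_eq_zero.1 this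

/-- The polynomial of degree two in `x` with coefficients depending on `t`. -/
def quadratic (α β γ : ℝ → ℂ) (q : Plane) : ℂ := α q.1 * (q.2 : ℂ) ^ 2 + β q.1 * q.2 + γ q.1

section Quadratic

variable {α β γ α' β' γ' : ℝ → ℂ}

theorem contDiff_quadratic (hα : ContDiff ℝ ∞ α) (hβ : ContDiff ℝ ∞ β) (hγ : ContDiff ℝ ∞ γ) :
    ContDiff ℝ ∞ (quadratic α β γ) := by
  have : ContDiff ℝ ∞ fun q : Plane => (q.2 : ℂ) := contDiff_ofReal contDiff_snd
  unfold quadratic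
  fun_prop

theorem dx_quadratic (hα : ContDiff ℝ ∞ α) (hβ : ContDiff ℝ ∞ β) (hγ : ContDiff ℝ ∞ γ) :
    dx (quadratic α β γ) = quadratic (fun _ => 0) (fun t => 2 * α t) β := by
  funext q
  refine (hasDerivAt_slice_space
    ((contDiff_quadratic hα hβ hγ).differentiable (by simp) q)).unique ?_
  have h : HasDerivAt (fun x : ℝ => (x : ℂ)) 1 q.2 := by
    simpa using (hasDerivAt_id q.2).ofReal_comp
  refine ((((h.fun_pow 2).const_mul (α q.1)).add (h.const_mul (β q.1))).add_const
    (γ q.1)).congr_deriv ?_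
  simp only [quadratic]
  push_cast
  ring

theorem dt_quadratic (hα : ContDiff ℝ ∞ α) (hβ : ContDiff ℝ ∞ β) (hγ : ContDiff ℝ ∞ γ)
    (dα : ∀ t, HasDerivAt α (α' t) t) (dβ : ∀ t, HasDerivAt β (β' t) t)
    (dγ : ∀ t, HasDerivAt γ (γ' t) t) :
    dt (quadratic α β γ) = quadratic α' β' γ' := by
  funext q
  refine (hasDerivAt_slice_time
    ((contDiff_quadratic hα hβ hγ).differentiable (by simp) q)).unique ?_
  exact (((dα q.1).mul_const ((q.2 : ℂ) ^ 2)).add ((dβ q.1).mul_const (q.2 : ℂ))).add (dγ q.1)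

end Quadratic

/-- The solutions of the determining equations. -/
theorem DeterminingEquations.solve {τ y : Plane → ℝ} {a : Plane → ℂ} {θ : Plane × ℂ → ℂ}
    (D : DeterminingEquations τ y a θ) (hτ : ContDiff ℝ ∞ τ) (hy : ContDiff ℝ ∞ y)
    (ha : ContDiff ℝ ∞ a) :
    ∃ ξ χ l : SmoothFun, ∀ q ψ v,
      (genField ξ χ l).1 ((q, ψ), v) = (((τ q, y q), a q * ψ), θ (q, v)) := by
  let ξ : SmoothFun := ⟨fun t => τ (t, 0), by fun_prop⟩
  let χ : SmoothFun := ⟨fun t => y (t, 0), by fun_prop⟩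
  let l : SmoothFun := ⟨fun t => (a (t, 0)).im, by
    have h : ContDiff ℝ ∞ fun t : ℝ => a (t, 0) := by fun_prop
    exact Complex.imCLM.contDiff.comp h⟩
  have smooth : ∀ (f : SmoothFun) (k : ℕ) (c : ℂ),
      ContDiff ℝ ∞ fun t => c * ((iteratedDeriv k f.1 t : ℝ) : ℂ) := fun f k c =>
    contDiff_const.mul (contDiff_ofReal (f.contDiff_iteratedDeriv k))
  have deriv' : ∀ (f : SmoothFun) (k : ℕ) (c : ℂ) (t : ℝ),
      HasDerivAt (fun t => c * ((iteratedDeriv k f.1 t : ℝ) : ℂ))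
        (c * ((iteratedDeriv (k + 1) f.1 t : ℝ) : ℂ)) t := fun f k c t =>
    ((f.hasDerivAt_iteratedDeriv k t).ofReal_comp).const_mul c
  have smooth0 : ContDiff ℝ ∞ fun _ : ℝ => (0 : ℂ) := contDiff_const
  have deriv0 : ∀ t : ℝ, HasDerivAt (fun _ : ℝ => (0 : ℂ)) 0 t := fun t => hasDerivAt_const t 0
  have eτ : (fun q => (τ q : ℂ))
      = quadratic (fun _ => 0) (fun _ => 0) (fun t => 1 * ((iteratedDeriv 0 ξ.1 t : ℝ) : ℂ)) := by
    refine eq_of_dx_eq (contDiff_ofReal hτ) (contDiff_quadratic smooth0 smooth0 (smooth ξ 0 1))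
      (fun q => ?_) fun t => ?_
    · rw [D.time, dx_quadratic smooth0 smooth0 (smooth ξ 0 1)]
      simp [quadratic]
    · simp [quadratic, ξ]
  have eτt : dt (fun q => (τ q : ℂ))
      = quadratic (fun _ => 0) (fun _ => 0) (fun t => 1 * ((iteratedDeriv 1 ξ.1 t : ℝ) : ℂ)) := by
    rw [eτ]
    exact dt_quadratic smooth0 smooth0 (smooth ξ 0 1) deriv0 deriv0 (deriv' ξ 0 1)
  have ey : (fun q => (y q : ℂ)) = quadratic (fun _ => 0)
      (fun t => 1 / 2 * ((iteratedDeriv 1 ξ.1 t : ℝ) : ℂ)) (fun t => 1 * ((iteratedDeriv 0 χ.1 t : ℝ) : ℂ)) := by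
    refine eq_of_dx_eq (contDiff_ofReal hy)
      (contDiff_quadratic smooth0 (smooth ξ 1 (1 / 2)) (smooth χ 0 1)) (fun q => ?_) fun t => ?_
    · have h := D.space q
      rw [eτt] at h
      rw [dx_quadratic smooth0 (smooth ξ 1 (1 / 2)) (smooth χ 0 1)]
      simp only [quadratic] at h ⊢
      linear_combination -h / 2
    · simp [quadratic, χ]
  have eyt : dt (fun q => (y q : ℂ)) = quadratic (fun _ => 0)
      (fun t => 1 / 2 * ((iteratedDeriv 2 ξ.1 t : ℝ) : ℂ)) (fun t => 1 * ((iteratedDeriv 1 χ.1 t : ℝ) : ℂ)) := by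
    rw [ey]
    exact dt_quadratic smooth0 (smooth ξ 1 (1 / 2)) (smooth χ 0 1) deriv0 (deriv' ξ 1 (1 / 2))
      (deriv' χ 0 1)
  have eyxx : ∀ q, dx (dx (fun q => (y q : ℂ))) q = 0 := by
    intro q
    rw [ey, dx_quadratic smooth0 (smooth ξ 1 (1 / 2)) (smooth χ 0 1),
      dx_quadratic smooth0 (contDiff_const.mul smooth0) (smooth ξ 1 (1 / 2))]
    simp [quadratic]
  have s2 := smooth ξ 2 (Complex.I / 8)
  have s1 := smooth χ 1 (Complex.I / 2)
  have s0 := (smooth l 0 Complex.I).add (smooth ξ 1 (-1 / 2))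
  have ea : a = quadratic (fun t => Complex.I / 8 * ((iteratedDeriv 2 ξ.1 t : ℝ) : ℂ))
      (fun t => Complex.I / 2 * ((iteratedDeriv 1 χ.1 t : ℝ) : ℂ))
      (fun t => Complex.I * ((iteratedDeriv 0 l.1 t : ℝ) : ℂ) + -1 / 2 * ((iteratedDeriv 1 ξ.1 t : ℝ) : ℂ)) := by
    refine eq_of_dx_eq ha (contDiff_quadratic s2 s1 s0) (fun q => ?_) fun t => ?_
    · have h := D.phase q
      rw [eyxx, eyt] at h
      rw [dx_quadratic s2 s1 s0]
      simp only [quadratic] at h ⊢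
      linear_combination h / 2
    · have h := D.modulus (t, 0)
      rw [eτt, add_assoc, Complex.add_conj] at h
      have h1 := Complex.re_add_im (a (t, 0))
      simp only [quadratic, iteratedDeriv_zero, l, Complex.ofReal_zero] at h ⊢
      push_cast at h
      linear_combination -h1 + h / 2
  have eat : dt a = quadratic (fun t => Complex.I / 8 * ((iteratedDeriv 3 ξ.1 t : ℝ) : ℂ))
      (fun t => Complex.I / 2 * ((iteratedDeriv 2 χ.1 t : ℝ) : ℂ))
      (fun t => Complex.I * ((iteratedDeriv 1 l.1 t : ℝ) : ℂ) + -1 / 2 * ((iteratedDeriv 2 ξ.1 t : ℝ) : ℂ)) := by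
    rw [ea]
    exact dt_quadratic s2 s1 s0 (deriv' ξ 2 _) (deriv' χ 1 _)
      fun t => (deriv' l 0 _ t).add (deriv' ξ 1 _ t)
  have eaxx : ∀ q, dx (dx a) q = 2 * (Complex.I / 8 * ((iteratedDeriv 2 ξ.1 q.1 : ℝ) : ℂ)) := by
    intro q
    rw [ea, dx_quadratic s2 s1 s0, dx_quadratic smooth0 (contDiff_const.mul s2) s1]
    simp [quadratic]
  refine ⟨ξ, χ, l, fun ⟨t, x⟩ ψ v => ?_⟩
  rw [genField_apply, genBase_apply]
  refine Prod.ext (Prod.ext (Prod.ext ?_ ?_) ?_) ?_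
  · have h := congrFun eτ (t, x)
    simp only [quadratic, zero_mul, zero_add, one_mul] at h
    exact_mod_cast h.symm
  · have h := congrFun ey (t, x)
    simp only [quadratic, zero_mul, zero_add, one_mul] at h
    have h' : (y (t, x) : ℂ)
        = ((1 / 2 * iteratedDeriv 1 ξ.1 t * x + iteratedDeriv 0 χ.1 t : ℝ) : ℂ) := by
      rw [h]; push_cast; ring
    exact (Complex.ofReal_injective h').symm
  · have h := congrFun ea (t, x)
    simp only [quadratic] at h
    change _ = a (t, x) * ψ
    rw [h]
    push_cast
    ring
  · have h := D.potential (t, x) v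
    rw [eτt, eat, eaxx] at h
    simp only [quadratic] at h
    change _ = θ ((t, x), v)
    rw [h]
    push_cast
    linear_combination ((1 / 8 * ((iteratedDeriv 3 ξ.1 t : ℝ) : ℂ) * x ^ 2
      + 1 / 2 * ((iteratedDeriv 2 χ.1 t : ℝ) : ℂ) * x + ((iteratedDeriv 1 l.1 t : ℝ) : ℂ))) * Complex.I_mul_I

/-- The infinitesimal equivalence transformations are the combinations of the operators `D'(ξ)`,
`G'(χ)` and `M'(λ)`. -/
theorem mem_spanEquiv_iff_isEquivGenerator (Q : SmoothField ExtSpace) :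
    Q ∈ spanEquiv ↔ IsEquivGenerator Q := by
  rw [mem_spanEquiv_iff]
  constructor
  · rintro ⟨ξ, χ, l, rfl⟩
    exact isEquivGenerator_genField ξ χ l
  · intro hQ
    obtain ⟨τ, y, η, θ, hτ, hy, hη, -, hform⟩ := hQ.exists_components
    have J : JetIdentity τ y η θ := fun q _ _ _ _ _ _ hu₀ hV₀ =>
      hQ.jet_identity hτ hy hη hform q hu₀ hV₀
    obtain ⟨a, ha, hηa, D⟩ := J.determining hη
    obtain ⟨ξ, χ, l, h⟩ := D.solve hτ hy ha
    refine ⟨ξ, χ, l, Subtype.ext (funext fun ⟨⟨q, ψ⟩, v⟩ => ?_)⟩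
    rw [hform, h, hηa]

end Integration

end CubicNLS

theorem theorem3 :
    ∃ (Aequiv : LieSubalgebra ℝ (CubicNLS.SmoothField CubicNLS.ExtSpace))
      (Acup : LieSubalgebra ℝ (CubicNLS.SmoothField CubicNLS.Space)),
      (∀ P : CubicNLS.SmoothField CubicNLS.ExtSpace,
        P ∈ Aequiv ↔ CubicNLS.IsEquivGenerator P) ∧
      Aequiv.toSubmodule = CubicNLS.spanEquiv ∧
      Acup.toSubmodule = CubicNLS.spanCup ∧
      ∃ e : Acup ≃ₗ⁅ℝ⁆ Aequiv,
        (∀ (Q : Acup) (P : Aequiv), CubicNLS.Prolongs P.1 Q.1 ↔ P = e Q) ∧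
        (∀ (ξ : CubicNLS.SmoothFun) (Q : Acup),
          Q.1 = CubicNLS.opD ξ → (e Q).1 = CubicNLS.opD' ξ) ∧
        (∀ (χ : CubicNLS.SmoothFun) (Q : Acup),
          Q.1 = CubicNLS.opG χ → (e Q).1 = CubicNLS.opG' χ) ∧
        (∀ (l : CubicNLS.SmoothFun) (Q : Acup),
          Q.1 = CubicNLS.opM l → (e Q).1 = CubicNLS.opM' l) := by
  exact CubicNLS.equivalence_algebra_of_generators CubicNLS.mem_spanEquiv_iff_isEquivGenerator
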